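/- An MT-space is a set with a topology and a $\sigma$-algebra (not necessarily the Borel one); an MT-map is a continuous measurable map, and an MT-isomorphism is a homeomorphism that is also a measurable isomorphism. Products and subsets carry the product and induced structures. A measurable lamination is an MT-space $X$ covered by countably many open measurable sets, each MT-isomorphic to some $P\times T$, with $P$ a connected, locally path connected, locally compact Polish space (with its Borel $\sigma$-algebra) and $T$ a standard Borel space with the discrete topology. The leaves of an MT-space are its connected components, and $L_x$ is the leaf through $x$. Let $\Gamma$ be an abelian group that is a standard Borel space with measurable operations. Measurable singular cohomology $H^n_{\mathrm{MT}}(X,\Gamma)$ is the cohomology of the complex of those singular cochains $\omega$ with values in $\Gamma$ for which $t\mapsto\omega(\sigma|_{\Delta^n\times\{t\}})$ is measurable for every standard Borel space $T$ (with the discrete topology) and every MT-map $\sigma:\Delta^n\times T\to X$. A complete transversal is a measurable set $T\subset X$ that meets each leaf in a nonempty countable set. An elementary simplex relative to $T$ is an MT-map $\sigma:\Delta^n\times T_\sigma\to X$, with $T_\sigma\subset T$ measurable (and given the discrete topology) and $\sigma(\Delta^n\times\{t\})\subset L_t$ for all $t\in T_\sigma$. An elementary $n$-cochain assigns to each such $\sigma$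 a measurable map $\omega(\sigma):T\to\Gamma$ vanishing off $T_\sigma$, such that $\omega(\sigma|_{\Delta^n\times S})=\omega(\sigma)\chi_S$ for measurable $S\subset T_\sigma$, and $\omega(\sigma\circ(\mathrm{id}\times h))=\omega(\sigma)\circ h$ on $A$ for each measurable isomorphism $h:A\to B$ between measurable subsets of $T$ that maps each point to a point of the same leaf (here $\sigma\circ(\mathrm{id}\times h)$ is defined on $\Delta^n\times h^{-1}(B\cap T_\sigma)$). With the coboundary given by the alternating sum over the faces, these cochains define the measurable countable-to-one cohomology $H^n_T(X,\Gamma)$. For a countable cover $\mathcal U=\{U_n\}_{n\in\mathbb N}$ of $X$ by measurable open sets, the measurable Čech cohomology $\check H^n(\mathcal U,\Gamma)$ is the cohomology of the complex $C^s=\prod_{(i_0,\dots,i_s)\in\mathbb N^{s+1}}F(U_{i_0}\cap\dots\cap U_{i_s},\Gamma)$ with the usual Čech coboundary, where $F(V,\Gamma)$ is the group of measurable maps $V\to\Gamma$ constant on the connected components of $V$. **Proposition.** Let $X$ be a measurable lamination with a countable cover $\mathcal U=\{U_n\}_{n\in\mathbb N}$ by measurable open sets, such that every finite intersection $V=U_{i_0}\cap\dots\cap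 U_{i_s}$ is measurably contractible along its leaves: there is an MT-map $H:V\times[0,1]\to V$ with $H(x,0)=x$ for all $x\in V$ and $H(\cdot,1)$ constant on each connected component of $V$. Then for every complete transversal $T$ of $X$ and every $n\ge 0$ there are group isomorphisms $$H^n_{\mathrm{MT}}(X,\Gamma)\cong H^n_T(X,\Gamma),\qquad H^n_{\mathrm{MT}}(X,\Gamma)\cong\check H^n(\mathcal U,\Gamma),\qquad H^n_T(X,\Gamma)\cong\check H^n(\mathcal U,\Gamma).$$ -/

import Mathlib

open CategoryTheory

universe u v

noncomputable section

namespace MTSpace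

/-! ### MT-spaces and measurable laminations

An MT-space is a type with a topology and a σ-algebra, with no compatibility between the two:
`[TopologicalSpace X] [MeasurableSpace X]`. Products carry the product topology and the product
σ-algebra, subsets carry the induced structures. -/

/-- An MT-map is a continuous and measurable map. -/
structure IsMTMap {X Y : Type*} [TopologicalSpace X] [MeasurableSpace X]
    [TopologicalSpace Y] [MeasurableSpace Y] (f : X → Y) : Prop where
  continuous : Continuous f
  measurable : Measurable f

/-- `U` is the domain of a measurable chart: `U` is open and measurable, and it is MT-isomorphic
to `P × T`, with `P` a connected, locally path connected, locally compact Polish space with its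
Borel σ-algebra, and `T` a standard Borel space with the discrete topology. -/
def IsChartDomain {X : Type u} [TopologicalSpace X] [MeasurableSpace X] (U : Set X) : Prop :=
  IsOpen U ∧ MeasurableSet U ∧
    ∃ (P T : Type u) (_ : TopologicalSpace P) (_ : MeasurableSpace P) (_ : BorelSpace P)
      (_ : PolishSpace P) (_ : LocallyCompactSpace P) (_ : ConnectedSpace P)
      (_ : LocallyPathConnectedSpace P)
      (_ : TopologicalSpace T) (_ : DiscreteTopology T)
      (_ : MeasurableSpace T) (_ : StandardBorelSpace T)
      (φ : U ≃ P × T), IsMTMap φ ∧ IsMTMap φ.symm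

/-- A measurable lamination is an MT-space covered by the domains of countably many measurable
charts. (The empty chart is allowed, so that finite atlases are included.) -/
def IsMeasurableLamination (X : Type u) [TopologicalSpace X] [MeasurableSpace X] : Prop :=
  ∃ U : ℕ → Set X, (∀ n, IsChartDomain (U n)) ∧ ⋃ n, U n = Set.univ

section Leaves

variable {X : Type u} [TopologicalSpace X] [MeasurableSpace X]

/-- The leaf through `x` is the connected component of `x`. -/
def leaf (x : X) : Set X := connectedComponent x

/-- A complete transversal: a measurable set that meets every leaf in a non-empty countable set. -/
structure IsCompleteTransversal (T : Set X) : Prop where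
  measurableSet : MeasurableSet T
  countable : ∀ x : X, (T ∩ leaf x).Countable
  nonempty : ∀ x : X, (T ∩ leaf x).Nonempty

/-- `U` is measurably contractible along its leaves: there is an MT-homotopy `U × [0,1] → U` from
the identity to a map that is constant on each leaf of `U` (connected component of the subspace
`U`). By continuity each path `t ↦ H (x, t)` stays in the leaf of `x`. -/
def IsMeasurablyContractible (U : Set X) : Prop :=
  ∃ H : U × unitInterval → U, IsMTMap H ∧ (∀ x, H (x, 0) = x) ∧
    ∀ x y : U, y ∈ leaf x → H (y, 1) = H (x, 1)

end Leaves

/-! ### Combinatorics of faces -/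

/-- The simplicial identity for the coface maps `Fin.succAbove`. -/
lemma succAbove_comp_succAbove {n : ℕ} {a b : Fin (n + 1)} (h : a ≤ b) :
    b.succ.succAbove ∘ a.succAbove = a.castSucc.succAbove ∘ b.succAbove := by
  funext k
  rcases a with ⟨a, _⟩
  rcases b with ⟨b, _⟩
  rcases k with ⟨k, _⟩
  simp only [Fin.succAbove, Function.comp]
  split_ifs <;> · simp at * <;> lia

/-- The iterated alternating sum of faces vanishes. -/
lemma alternating_sum_eq_zero {A : Type*} [AddCommGroup A] {n : ℕ}
    (g : Fin (n + 2) → Fin (n + 1) → A)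
    (hg : ∀ a b : Fin (n + 1), a ≤ b → g b.succ a = g a.castSucc b) :
    ∑ i : Fin (n + 2), (-1 : ℤ) ^ (i : ℕ) • ∑ j : Fin (n + 1), (-1 : ℤ) ^ (j : ℕ) • g i j = 0 := by
  simp only [Finset.smul_sum, smul_smul, ← Finset.sum_product']
  rw [Finset.univ_product_univ]
  let P := Fin (n + 2) × Fin (n + 1)
  let S : Finset P := {ij : P | (ij.1 : ℕ) ≤ (ij.2 : ℕ)}
  rw [← Finset.sum_add_sum_compl S, ← eq_neg_iff_add_eq_zero, ← Finset.sum_neg_distrib]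
  refine Finset.sum_bij
    (fun ij hij => (ij.2.succ,
      Fin.castLT ij.1 (lt_of_le_of_lt (Finset.mem_filter.mp hij).right (Fin.is_lt ij.2)))) ?_ ?_ ?_ ?_
  · intro ij hij
    simp_rw [S, Finset.compl_filter, Finset.mem_filter_univ, Fin.val_succ,
      Fin.val_castLT] at hij ⊢
    lia
  · rintro ⟨i, j⟩ hij ⟨i', j'⟩ hij' h
    obtain ⟨h1, h2⟩ := Prod.mk_inj.1 h
    have h2' : (i : ℕ) = i' := congrArg (fun z : Fin (n + 1) => (z : ℕ)) h2
    exact Prod.mk_inj.2 ⟨Fin.ext h2', Fin.succ_injective _ h1⟩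
  · rintro ⟨i', j'⟩ hij'
    simp_rw [S, Finset.compl_filter, Finset.mem_filter_univ, not_le] at hij'
    refine ⟨(j'.castSucc, i'.pred ?_), ?_, ?_⟩
    · rintro rfl
      simp at hij'
    · simp [S]; lia
    · simp
  · rintro ⟨i, j⟩ hij
    have hij' : (i : ℕ) ≤ j := by simpa [S] using hij
    have h := hg (i.castLT (by lia)) j (by rw [Fin.le_iff_val_le_val]; simpa using hij')
    simp only [Fin.castSucc_castLT] at h
    simp only [h, Fin.val_succ, Fin.val_castLT, ← neg_smul]
    congr 1
    ring

/-! ### Measurable singular cohomology -/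

/-- The canonical `n`-simplex. -/
abbrev Simplex (n : ℕ) : Type := stdSimplex ℝ (Fin (n + 1))

/-- The affine map between canonical simplices given by a map of the vertices. -/
def simplexMap {m n : ℕ} (f : Fin (m + 1) → Fin (n + 1)) : C(Simplex m, Simplex n) :=
  ⟨stdSimplex.map f, stdSimplex.continuous_map f⟩

lemma simplexMap_comp {l m n : ℕ} (f : Fin (m + 1) → Fin (n + 1)) (g : Fin (l + 1) → Fin (m + 1)) :
    (simplexMap f).comp (simplexMap g) = simplexMap (f ∘ g) := by
  ext1 x
  exact stdSimplex.map_comp_apply g f x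

section Singular

variable (X : Type u) [TopologicalSpace X] [MeasurableSpace X]
variable (Γ : Type v) [AddCommGroup Γ] [MeasurableSpace Γ]

/-- A singular `n`-simplex of `X`. -/
abbrev SingularSimplex (n : ℕ) : Type u := C(Simplex n, X)

variable {X} in
/-- A measurable singular `n`-simplex `Δⁿ × T → X`, seen as a family of singular simplices indexed
by `T`. Since `T` has the discrete topology, a map `Δⁿ × T → X` is continuous if and only if it is
continuous on each fibre `Δⁿ × {t}`, so it is an MT-map if and only if it is such a family for
which the map is measurable on `Δⁿ × T`. -/
def IsMeasurableFamily {n : ℕ} {T : Type*} [MeasurableSpace T] (σ : T → SingularSimplex X n) :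
    Prop :=
  Measurable fun p : Simplex n × T => σ p.2 p.1

variable {X} in
lemma IsMeasurableFamily.comp_simplexMap {m n : ℕ} {T : Type*} [MeasurableSpace T]
    {σ : T → SingularSimplex X n} (hσ : IsMeasurableFamily σ) (f : Fin (m + 1) → Fin (n + 1)) :
    IsMeasurableFamily fun t => (σ t).comp (simplexMap f) :=
  Measurable.comp (g := fun p : Simplex n × T => σ p.2 p.1) hσ
    (((simplexMap f).continuous.measurable.comp measurable_fst).prodMk measurable_snd)

variable [MeasurableAdd₂ Γ] [MeasurableNeg Γ]

/-- The group of measurable singular `n`-cochains: the singular cochains `ω` with values in `Γ`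
for which `t ↦ ω (σ_t)` is measurable for each measurable singular simplex, parametrized by any
standard Borel space. (All standard Borel spaces are isomorphic to spaces in `Type u`.) -/
def MeasurableCochain (n : ℕ) : AddSubgroup (SingularSimplex X n → Γ) where
  carrier := {ω | ∀ (T : Type u) [MeasurableSpace T] [StandardBorelSpace T]
    (σ : T → SingularSimplex X n), IsMeasurableFamily σ → Measurable fun t => ω (σ t)}
  zero_mem' := fun _ _ _ _ _ => measurable_const
  add_mem' := fun h h' T _ _ σ hσ => (h T σ hσ).add (h' T σ hσ)
  neg_mem' := fun h T _ _ σ hσ => (h T σ hσ).neg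

/-- The coboundary of measurable singular cochains. -/
def singularCoboundary (n : ℕ) : MeasurableCochain X Γ n →+ MeasurableCochain X Γ (n + 1) where
  toFun ω := ⟨fun σ => ∑ i : Fin (n + 2), (-1 : ℤ) ^ (i : ℕ) •
      ω.1 (σ.comp (simplexMap i.succAbove)), fun T _ _ σ hσ =>
    Finset.measurable_sum _ fun i _ =>
      (ω.2 T (fun t => (σ t).comp (simplexMap i.succAbove))
        (hσ.comp_simplexMap i.succAbove)).const_smul ((-1 : ℤ) ^ (i : ℕ))⟩
  map_zero' := by ext σ; simp
  map_add' ω ω' := by ext σ; simp [Finset.sum_add_distrib]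

lemma singularCoboundary_comp (n : ℕ) (ω : MeasurableCochain X Γ n) :
    singularCoboundary X Γ (n + 1) (singularCoboundary X Γ n ω) = 0 := by
  ext σ
  refine alternating_sum_eq_zero (fun (i : Fin (n + 3)) (j : Fin (n + 2)) => ω.1
    ((σ.comp (simplexMap i.succAbove)).comp (simplexMap j.succAbove))) fun a b h => ?_
  simp only [ContinuousMap.comp_assoc, simplexMap_comp, succAbove_comp_succAbove h]

/-- The complex of measurable singular cochains of `X`. -/
def singularComplex : CochainComplex AddCommGrpCat.{max u v} ℕ :=
  CochainComplex.of (fun n => AddCommGrpCat.of (MeasurableCochain X Γ n))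
    (fun n => AddCommGrpCat.ofHom (singularCoboundary X Γ n))
    (fun n => by ext ω : 2; exact singularCoboundary_comp X Γ n ω)

/-- Measurable singular cohomology. -/
def singularCohomology (n : ℕ) : AddCommGrpCat.{max u v} := (singularComplex X Γ).homology n

end Singular

/-! ### Measurable countable-to-one (elementary) cohomology -/

section Elementary

variable {X : Type u} [TopologicalSpace X] [MeasurableSpace X]

/-- An elementary measurable singular `n`-simplex relative to `T`: an MT-map `Δⁿ × dom → X`, with
`dom` a measurable subset of `T`, that maps `Δⁿ × {t}` into the leaf of `t` for all `t`. -/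
structure ElementarySimplex (T : Set X) (n : ℕ) where
  dom : Set X
  dom_subset : dom ⊆ T
  measurableSet_dom : MeasurableSet dom
  toFun : dom → SingularSimplex X n
  measurable : IsMeasurableFamily toFun
  mem_leaf : ∀ (t : dom) (x : Simplex n), toFun t x ∈ leaf (t : X)

/-- A measurable holonomy map between measurable subsets of `T`: a measurable isomorphism that
maps each point to a point of the same leaf. -/
structure Holonomy (T : Set X) where
  source : Set X
  target : Set X
  source_subset : source ⊆ T
  target_subset : target ⊆ T
  measurableSet_source : MeasurableSet source
  measurableSet_target : MeasurableSet target
  map : source ≃ᵐ target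
  map_mem_leaf : ∀ a : source, (map a : X) ∈ leaf (a : X)

namespace ElementarySimplex

variable {T : Set X} {m n : ℕ}

/-- Composition of each fibre with the affine map given by a map of the vertices; the faces of `σ`
are the `σ.reindex i.succAbove`. -/
def reindex (σ : ElementarySimplex T n) (f : Fin (m + 1) → Fin (n + 1)) :
    ElementarySimplex T m where
  dom := σ.dom
  dom_subset := σ.dom_subset
  measurableSet_dom := σ.measurableSet_dom
  toFun t := (σ.toFun t).comp (simplexMap f)
  measurable := σ.measurable.comp_simplexMap f
  mem_leaf t x := σ.mem_leaf t (simplexMap f x)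

/-- The restriction of `σ` to `Δⁿ × S`. -/
def restrict (σ : ElementarySimplex T n) (S : Set X) (hS : MeasurableSet S) (h : S ⊆ σ.dom) :
    ElementarySimplex T n where
  dom := S
  dom_subset := h.trans σ.dom_subset
  measurableSet_dom := hS
  toFun t := σ.toFun (Set.inclusion h t)
  measurable := Measurable.comp (g := fun p : Simplex n × σ.dom => σ.toFun p.2 p.1) σ.measurable
    (measurable_fst.prodMk ((measurable_inclusion h).comp measurable_snd))
  mem_leaf t x := σ.mem_leaf (Set.inclusion h t) x

/-- The composite `σ ∘ (id × h)`, defined on `Δⁿ × h⁻¹(dom)`. -/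
def pullback (σ : ElementarySimplex T n) (h : Holonomy T) : ElementarySimplex T n where
  dom := Subtype.val '' {a : h.source | (h.map a : X) ∈ σ.dom}
  dom_subset := by
    rintro _ ⟨a, -, rfl⟩
    exact h.source_subset a.2
  measurableSet_dom := h.measurableSet_source.subtype_image
    ((measurable_subtype_coe.comp h.map.measurable) σ.measurableSet_dom)
  toFun t := σ.toFun ⟨h.map ⟨t, by obtain ⟨_, a, -, rfl⟩ := t; exact a.2⟩,
    by obtain ⟨_, a, ha, rfl⟩ := t; exact ha⟩
  measurable := Measurable.comp (g := fun p : Simplex n × σ.dom => σ.toFun p.2 p.1) σ.measurable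
    (measurable_fst.prodMk ((measurable_subtype_coe.comp (h.map.measurable.comp
      (measurable_subtype_coe.comp measurable_snd).subtype_mk)).subtype_mk))
  mem_leaf t x := by
    obtain ⟨_, a, ha, rfl⟩ := t
    have h1 := σ.mem_leaf ⟨h.map a, ha⟩ x
    have h2 := h.map_mem_leaf a
    unfold leaf at h1 h2 ⊢
    rwa [connectedComponent_eq h2]

end ElementarySimplex

variable (T : Set X) (Γ : Type v) [AddCommGroup Γ] [MeasurableSpace Γ]
variable [MeasurableAdd₂ Γ] [MeasurableNeg Γ]

/-- The group of elementary `n`-cochains relative to `T`: the maps `ω` from elementary simplices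
to measurable maps `T → Γ` such that `ω σ` vanishes off the domain of `σ`, such that
`ω (σ|_(Δ × S)) = ω σ · χ_S`, and such that `ω (σ ∘ (id × h)) = ω σ ∘ h` on the source of each
measurable holonomy map `h`. -/
def ElementaryCochain (n : ℕ) : AddSubgroup (ElementarySimplex T n → T → Γ) where
  carrier := {ω | (∀ σ, Measurable (ω σ)) ∧
    (∀ σ (t : T), (t : X) ∉ σ.dom → ω σ t = 0) ∧
    (∀ σ (S : Set X) (hS : MeasurableSet S) (h : S ⊆ σ.dom),
      ω (σ.restrict S hS h) = (Subtype.val ⁻¹' S : Set T).indicator (ω σ)) ∧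
    (∀ σ (h : Holonomy T) (a : h.source), ω (σ.pullback h) ⟨a, h.source_subset a.2⟩ =
      ω σ ⟨h.map a, h.target_subset (h.map a).2⟩)}
  zero_mem' := ⟨fun _ => measurable_const, fun _ _ _ => rfl,
    fun _ _ _ _ => (Set.indicator_zero _ _).symm, fun _ _ _ => rfl⟩
  add_mem' := by
    rintro ω ω' ⟨h1, h2, h3, h4⟩ ⟨h1', h2', h3', h4'⟩
    refine ⟨fun σ => (h1 σ).add (h1' σ), fun σ t ht => ?_, fun σ S hS h => ?_, fun σ h a => ?_⟩
    · simp [h2 σ t ht, h2' σ t ht]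
    · simp only [Pi.add_apply, h3 σ S hS h, h3' σ S hS h, Set.indicator_add']
    · simp only [Pi.add_apply, h4 σ h a, h4' σ h a]
  neg_mem' := by
    rintro ω ⟨h1, h2, h3, h4⟩
    refine ⟨fun σ => (h1 σ).neg, fun σ t ht => ?_, fun σ S hS h => ?_, fun σ h a => ?_⟩
    · simp [h2 σ t ht]
    · simp only [Pi.neg_apply, h3 σ S hS h, Set.indicator_neg']
    · simp only [Pi.neg_apply, h4 σ h a]

/-- The coboundary of elementary cochains. -/
def elementaryCoboundary (n : ℕ) : ElementaryCochain T Γ n →+ ElementaryCochain T Γ (n + 1) where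
  toFun ω := ⟨fun σ => ∑ i : Fin (n + 2), (-1 : ℤ) ^ (i : ℕ) • ω.1 (σ.reindex i.succAbove), by
    obtain ⟨ω, h1, h2, h3, h4⟩ := ω
    refine ⟨fun σ => ?_, fun σ t ht => ?_, fun σ S hS h => ?_, fun σ h a => ?_⟩
    · have h := Finset.measurable_sum (f := fun i : Fin (n + 2) =>
        (-1 : ℤ) ^ (i : ℕ) • ω (σ.reindex i.succAbove)) Finset.univ
        fun i _ => (h1 _).const_smul ((-1 : ℤ) ^ (i : ℕ))
      convert h using 1
      ext t
      simp
    · simp only [Finset.sum_apply, Pi.smul_apply]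
      exact Finset.sum_eq_zero fun i _ => by
        rw [h2 (σ.reindex i.succAbove) t ht, smul_zero]
    · ext t
      have h3' : ∀ i : Fin (n + 2), ω ((σ.restrict S hS h).reindex i.succAbove) t =
          (Subtype.val ⁻¹' S : Set T).indicator (ω (σ.reindex i.succAbove)) t :=
        fun i => congrFun (h3 (σ.reindex i.succAbove) S hS h) t
      simp only [Finset.sum_apply, Pi.smul_apply, h3']
      by_cases ht : t ∈ (Subtype.val ⁻¹' S : Set T) <;> simp [ht]
    · simp only [Finset.sum_apply, Pi.smul_apply]
      exact Finset.sum_congr rfl fun i _ => congrArg _ (h4 (σ.reindex i.succAbove) h a)⟩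
  map_zero' := by ext σ; simp
  map_add' ω ω' := by ext σ; simp [Finset.sum_add_distrib]

lemma elementaryCoboundary_comp (n : ℕ) (ω : ElementaryCochain T Γ n) :
    elementaryCoboundary T Γ (n + 1) (elementaryCoboundary T Γ n ω) = 0 := by
  apply Subtype.ext
  funext σ
  refine alternating_sum_eq_zero (fun (i : Fin (n + 3)) (j : Fin (n + 2)) => ω.1
    ((σ.reindex i.succAbove).reindex j.succAbove)) fun a b h => ?_
  simp only [ElementarySimplex.reindex, ContinuousMap.comp_assoc, simplexMap_comp,
    succAbove_comp_succAbove h]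

/-- The complex of elementary cochains relative to `T`. -/
def elementaryComplex : CochainComplex AddCommGrpCat.{max u v} ℕ :=
  CochainComplex.of (fun n => AddCommGrpCat.of (ElementaryCochain T Γ n))
    (fun n => AddCommGrpCat.ofHom (elementaryCoboundary T Γ n))
    (fun n => by ext ω : 2; exact elementaryCoboundary_comp T Γ n ω)

/-- Measurable countable-to-one cohomology, relative to the transversal `T`. -/
def elementaryCohomology (n : ℕ) : AddCommGrpCat.{max u v} := (elementaryComplex T Γ).homology n

end Elementary

/-! ### Measurable Čech cohomology -/

section Cech

variable {X : Type u} [TopologicalSpace X] [MeasurableSpace X]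
variable (Γ : Type v) [AddCommGroup Γ] [MeasurableSpace Γ] [MeasurableAdd₂ Γ] [MeasurableNeg Γ]

/-- The group of measurable maps `V → Γ` that are constant on the leaves of `V`, i.e. on the
connected components of the subspace `V`. -/
def LeafwiseConstant (V : Set X) : AddSubgroup (V → Γ) where
  carrier := {f | Measurable f ∧ ∀ x y : V, y ∈ leaf x → f y = f x}
  zero_mem' := ⟨measurable_const, fun _ _ _ => rfl⟩
  add_mem' := fun h h' => ⟨h.1.add h'.1, fun x y hxy => by
    simp only [Pi.add_apply, h.2 x y hxy, h'.2 x y hxy]⟩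
  neg_mem' := fun h => ⟨h.1.neg, fun x y hxy => by simp only [Pi.neg_apply, h.2 x y hxy]⟩

/-- Restriction of leafwise constant maps to a smaller set. -/
def LeafwiseConstant.restrict {V W : Set X} (h : W ⊆ V) :
    LeafwiseConstant Γ V →+ LeafwiseConstant Γ W where
  toFun f := ⟨fun x => f.1 (Set.inclusion h x), f.2.1.comp (measurable_inclusion h),
    fun x _ hxy => f.2.2 _ _
      ((continuous_inclusion h).image_connectedComponent_subset x ⟨_, hxy, rfl⟩)⟩
  map_zero' := rfl
  map_add' _ _ := rfl

variable (U : ℕ → Set X)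

/-- The Čech cochains: `C^s = ∏ F(U_{i_0} ∩ ... ∩ U_{i_s}, Γ)`, over all `(i_0, ..., i_s)`. -/
abbrev CechCochain (s : ℕ) : Type (max u v) :=
  ∀ i : Fin (s + 1) → ℕ, LeafwiseConstant Γ (⋂ k, U (i k))

/-- The Čech coboundary. -/
def cechCoboundary (s : ℕ) : CechCochain Γ U s →+ CechCochain Γ U (s + 1) where
  toFun f i := ∑ j : Fin (s + 2), (-1 : ℤ) ^ (j : ℕ) •
    LeafwiseConstant.restrict Γ
      (Set.subset_iInter fun k => Set.iInter_subset (fun k => U (i k)) (j.succAbove k))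
      (f (i ∘ j.succAbove))
  map_zero' := by funext i; simp
  map_add' f g := by funext i; simp [Finset.sum_add_distrib]

lemma cechCoboundary_comp (s : ℕ) (f : CechCochain Γ U s) :
    cechCoboundary Γ U (s + 1) (cechCoboundary Γ U s f) = 0 := by
  funext i
  apply Subtype.ext
  funext x
  have key : ∀ (a b : Fin (s + 1) → ℕ) (_ : a = b) (ha : (x : X) ∈ ⋂ k, U (a k))
      (hb : (x : X) ∈ ⋂ k, U (b k)), (f a).1 ⟨x, ha⟩ = (f b).1 ⟨x, hb⟩ := by
    rintro a _ rfl _ _; rfl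
  have hx : ∀ a : Fin (s + 1) → Fin (s + 3), (x : X) ∈ ⋂ k, U ((i ∘ a) k) := fun a =>
    Set.mem_iInter.2 fun k => Set.mem_iInter.1 x.2 (a k)
  have := alternating_sum_eq_zero (fun (j : Fin (s + 3)) (k : Fin (s + 2)) =>
    (f (i ∘ j.succAbove ∘ k.succAbove)).1 ⟨x, hx _⟩) fun a b h => by
      apply key; rw [succAbove_comp_succAbove h]
  simpa [cechCoboundary, LeafwiseConstant.restrict, Function.comp_assoc] using this

/-- The measurable Čech complex of the covering `U`. -/
def cechComplex : CochainComplex AddCommGrpCat.{max u v} ℕ :=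
  CochainComplex.of (fun s => AddCommGrpCat.of (CechCochain Γ U s))
    (fun s => AddCommGrpCat.ofHom (cechCoboundary Γ U s))
    (fun s => by ext f : 2; exact cechCoboundary_comp Γ U s f)

/-- Measurable Čech cohomology of the covering `U`. -/
def cechCohomology (s : ℕ) : AddCommGrpCat.{max u v} := (cechComplex Γ U).homology s

end Cech

end MTSpace

end

-- Both cohomologies are compared with Čech cohomology through one double complex. A probe is a
-- standard Borel space with a base map to `X`, and `ProbeCochain 𝒞` consists of the singular
-- cochains that are measurable along families indexed by a probe in `𝒞`, each simplex lying in the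
-- leaf of its base point. Taking all probes gives the measurable singular cochains
-- (`measurableCochain_eq_probeCochain`). The single probe `T ⊆ X` gives the elementary cochains
-- (`elementaryOfProbe_bijective`), because the restriction and holonomy axioms force the value at
-- `t` to depend only on the singular simplex over `t`.
--
-- For fixed `𝒞`, the cochains supported on simplices inside finite intersections of the cover form
-- a double complex (`isBiresolution`). Its rows are contracted by choosing the least member of the
-- cover that contains a simplex. They resolve the global cochains modulo those vanishing on small
-- simplices, which form an acyclic complex by barycentric subdivision
-- (`exists_simplexCoboundary_eq`). Its columns are contracted by cones along the leafwise
-- homotopies (`IsMeasurablyContractible.exists_cone`), and the cocycles in degree zero are the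
-- leafwise constant measurable maps. A diagram chase (`IsBiresolution.cohomology`) concludes.
--
-- Two points of measurability carry the weight. The set of `t` with `σ t` inside an open measurable
-- `V` must be measurable; this amounts to the Borel measurability of projections of Borel sets with
-- compact sections, which follows from Novikov separation (`measurableSet_forall_mem`). And a
-- leafwise constant map known to be measurable only along `T` must be measurable on `V`
-- (`IsMeasurableLamination.detectsMeasurability`): countably many leaf-preserving maps with dense
-- orbits carry `T` onto a set of representatives of the leaves of `V`, and measurability descends
-- along Borel surjections.

universe w

namespace MTSpace

open MeasureTheory Set Function

/-! ### Novikov separation and Borel sets with compact sections. -/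

section Novikov

variable {α : Type*} [MeasurableSpace α]

/-- A sequence of sets can be enlarged to a sequence of measurable sets with empty intersection. -/
def IsMeasurablySeparated (P : ℕ → Set α) : Prop :=
  ∃ B : ℕ → Set α, (∀ n, P n ⊆ B n) ∧ (∀ n, MeasurableSet (B n)) ∧ ⋂ n, B n = ∅

lemma IsMeasurablySeparated.mono {P Q : ℕ → Set α} (hQ : IsMeasurablySeparated Q)
    (h : ∀ n, P n ⊆ Q n) : IsMeasurablySeparated P := by
  obtain ⟨B, h1, h2, h3⟩ := hQ
  exact ⟨B, fun n => (h n).trans (h1 n), h2, h3⟩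

/-- Take the union of the enlargements in position `k` and their intersections elsewhere: a common
point would lie in every set of a single `B i`. Contrapositively, a non-separated sequence can be
refined in one position. -/
lemma IsMeasurablySeparated.of_iUnion {P : ℕ → Set α} (k : ℕ) (Q : ℕ → ℕ → Set α)
    (hQ : ∀ i, IsMeasurablySeparated (Q i)) (hk : P k ⊆ ⋃ i, Q i k)
    (hne : ∀ i n, n ≠ k → P n ⊆ Q i n) : IsMeasurablySeparated P := by
  choose B h1 h2 h3 using hQ
  refine ⟨fun n => if n = k then ⋃ i, B i k else ⋂ i, B i n, fun n => ?_, fun n => ?_, ?_⟩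
  · dsimp only
    split_ifs with h
    · subst h
      exact hk.trans (iUnion_mono fun i => h1 i n)
    · exact subset_iInter fun i => (hne i n h).trans (h1 i n)
  · dsimp only
    split_ifs with h
    · exact MeasurableSet.iUnion fun i => h2 i k
    · exact MeasurableSet.iInter fun i => h2 i n
  · refine eq_empty_of_forall_notMem fun x hx => ?_
    rw [mem_iInter] at hx
    have hxk := hx k
    rw [if_pos rfl, mem_iUnion] at hxk
    obtain ⟨i, hi⟩ := hxk
    have : x ∈ ⋂ n, B i n := mem_iInter.2 fun n => by
      by_cases h : n = k
      · rwa [h]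
      · have := hx n
        rw [if_neg h] at this
        exact mem_iInter.1 this i
    rw [h3 i] at this
    exact this

/-- Dependent choice for a property of finite prefixes: by `hp`, `p z k` sees only the entries below
`k`, and entry `k` is fixed for good at stage `k + 1`. -/
lemma exists_sequence_of_forall_update {p : (ℕ → ℕ) → ℕ → Prop}
    (hp : ∀ z z' k, (∀ j < k, z j = z' j) → p z k → p z' k) (z₀ : ℕ → ℕ) (h0 : p z₀ 0)
    (hs : ∀ z k, p z k → ∃ c, p (update z k c) (k + 1)) : ∃ z, ∀ k, p z k := by
  classical
  choose! c hc using hs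
  let zs : ℕ → ℕ → ℕ := fun k => Nat.rec z₀ (fun k z => update z k (c z k)) k
  have hzs : ∀ k, zs (k + 1) = update (zs k) k (c (zs k) k) := fun k => rfl
  have hpz : ∀ k, p (zs k) k := by
    intro k
    induction k with
    | zero => exact h0
    | succ k ih => rw [hzs]; exact hc _ _ ih
  refine ⟨fun k => zs (k + 1) k, fun k => hp (zs k) _ k ?_ (hpz k)⟩
  induction k with
  | zero => intro j hj; exact absurd hj (Nat.not_lt_zero _)
  | succ k ih =>
    intro j hj
    rcases Nat.lt_succ_iff_lt_or_eq.1 hj with h | rfl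
    · rw [hzs, update_of_ne h.ne]
      exact ih j h
    · rfl

variable [TopologicalSpace α] [T2Space α] [OpensMeasurableSpace α]

/-- If the ranges are not separated, one coordinate of one point of Baire space after another can be
prescribed, in the order of `Nat.pair`, with the images never becoming separated. The limit points
`x n` cannot all have the same image, and disjoint open neighbourhoods of two of the images separate
a late stage. -/
lemma isMeasurablySeparated_range (f : ℕ → (ℕ → ℕ) → α) (hf : ∀ n, Continuous (f n))
    (h : ⋂ n, range (f n) = ∅) : IsMeasurablySeparated fun n => range (f n) := by
  classical
  let P : (ℕ → ℕ) → ℕ → ℕ → Set α := fun z k n =>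
    f n '' {y | ∀ j, Nat.pair n j < k → y j = z (Nat.pair n j)}
  by_contra hcon
  obtain ⟨z, hz⟩ : ∃ z, ∀ k, ¬ IsMeasurablySeparated (P z k) := by
    refine exists_sequence_of_forall_update (p := fun z k => ¬ IsMeasurablySeparated (P z k))
      (fun z z' k hzz' hsep hsep' => hsep (hsep'.mono fun n => ?_)) 0 ?_ ?_
    · exact image_mono fun y hy j hj => (hy j hj).trans (hzz' _ hj)
    · refine fun hsep => hcon (hsep.mono fun n => ?_)
      rw [← image_univ]
      exact image_mono fun y _ j hj => absurd hj (Nat.not_lt_zero _)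
    · intro z k hsep
      by_contra! hc
      refine hsep (IsMeasurablySeparated.of_iUnion (Nat.unpair k).1
        (fun c => P (update z k c) (k + 1)) hc ?_ ?_)
      · rintro _ ⟨y, hy, rfl⟩
        refine mem_iUnion.2 ⟨y (Nat.unpair k).2, y, fun j hj => ?_, rfl⟩
        rcases Nat.lt_succ_iff_lt_or_eq.1 hj with h | h
        · rw [update_of_ne h.ne]
          exact hy j h
        · rw [h, update_self, ← congrArg (fun p => p.2) (congrArg Nat.unpair h), Nat.unpair_pair]
      · intro c n hn
        refine image_mono fun y hy j hj => ?_
        have hne : Nat.pair n j ≠ k := by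
          rintro rfl
          simp at hn
        rw [update_of_ne hne]
        exact hy j (by lia)
  let x : ℕ → ℕ → ℕ := fun n j => z (Nat.pair n j)
  have hx : ∃ a b, f a (x a) ≠ f b (x b) := by
    by_contra! hall
    have : f 0 (x 0) ∈ ⋂ n, range (f n) := mem_iInter.2 fun n => ⟨x n, hall n 0⟩
    rw [h] at this
    exact this
  obtain ⟨a, b, hab⟩ := hx
  obtain ⟨O, O', hO, hO', haO, hbO', hdisj⟩ := t2_separation hab
  have key : ∀ n (O : Set α), IsOpen O → f n (x n) ∈ O → ∃ K, ∀ k ≥ K, P z k n ⊆ O := by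
    intro n O hO hn
    obtain ⟨_, ⟨y, N, rfl⟩, hxs, hs⟩ := (PiNat.isTopologicalBasis_cylinders
      (fun _ : ℕ => ℕ)).exists_subset_of_mem_open (show x n ∈ f n ⁻¹' O from hn)
      (hO.preimage (hf n))
    -- The sum is merely a bound exceeding `Nat.pair n j` for all `j < N`: from this stage on the
    -- first `N` coordinates are prescribed.
    refine ⟨∑ j ∈ Finset.range N, (Nat.pair n j + 1), fun k hk => ?_⟩
    rintro _ ⟨y', hy', rfl⟩
    refine hs ?_
    intro j hj
    rw [hy' j, ← hxs j hj]
    have := Finset.single_le_sum (f := fun j => Nat.pair n j + 1) (fun i _ => Nat.zero_le _)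
      (Finset.mem_range.2 hj)
    lia
  obtain ⟨K, hK⟩ := key a O hO haO
  obtain ⟨K', hK'⟩ := key b O' hO' hbO'
  have hne : a ≠ b := by
    rintro rfl
    exact hab rfl
  refine hz (max K K') ⟨fun n => if n = a then O else if n = b then O' else univ,
    fun n => ?_, fun n => ?_, ?_⟩
  · dsimp only
    split_ifs with h h
    · subst h; exact hK _ (le_max_left _ _)
    · subst h; exact hK' _ (le_max_right _ _)
    · exact subset_univ _
  · dsimp only
    split_ifs
    · exact hO.measurableSet
    · exact hO'.measurableSet
    · exact MeasurableSet.univ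
  · refine eq_empty_of_forall_notMem fun y hy => ?_
    rw [mem_iInter] at hy
    have h1 := hy a
    have h2 := hy b
    rw [if_pos rfl] at h1
    rw [if_neg hne.symm, if_pos rfl] at h2
    exact disjoint_left.1 hdisj h1 h2

/-- **Novikov's separation theorem**: countably many analytic sets with empty intersection can be
enlarged to Borel sets with empty intersection. -/
theorem isMeasurablySeparated_of_analyticSet {A : ℕ → Set α} (hA : ∀ n, AnalyticSet (A n))
    (h : ⋂ n, A n = ∅) : IsMeasurablySeparated A := by
  classical
  by_cases hne : ∃ k, A k = ∅
  · obtain ⟨k, hk⟩ := hne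
    refine ⟨fun n => if n = k then ∅ else univ, fun n => ?_, fun n => ?_, ?_⟩
    · dsimp only
      split_ifs with h
      · rw [h, hk]
      · exact subset_univ _
    · dsimp only
      split_ifs
      · exact MeasurableSet.empty
      · exact MeasurableSet.univ
    · exact eq_empty_of_forall_notMem fun x hx => by simpa using mem_iInter.1 hx k
  · push Not at hne
    have : ∀ n, ∃ f : (ℕ → ℕ) → α, Continuous f ∧ range f = A n := fun n => by
      have := hA n
      rw [AnalyticSet] at this
      exact this.resolve_left (hne n).ne_empty
    choose f hf hfA using this
    obtain rfl : (fun n => range (f n)) = A := funext hfA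
    exact isMeasurablySeparated_range f hf h

end Novikov

/-- For a measurable subset of `K × D` with open sections in a compact space `K`, the set of
points of `D` whose section is the whole of `K` is measurable. -/
theorem measurableSet_forall_mem {K D : Type*} [TopologicalSpace K] [PolishSpace K]
    [CompactSpace K] [MeasurableSpace K] [BorelSpace K] [MeasurableSpace D] [StandardBorelSpace D]
    {W : Set (K × D)} (hW : MeasurableSet W) (hWo : ∀ t, IsOpen {x | (x, t) ∈ W}) :
    MeasurableSet {t | ∀ x, (x, t) ∈ W} := by
  let := upgradeStandardBorel D
  obtain ⟨b, hbc, -, hb⟩ := TopologicalSpace.exists_countable_basis K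
  obtain ⟨V, hV⟩ : ∃ V : ℕ → Set K, b ∪ {∅} = range V :=
    (hbc.union (countable_singleton ∅)).exists_eq_range ⟨∅, by simp⟩
  have hVo : ∀ k, IsOpen (V k) := fun k => by
    have : V k ∈ b ∪ {∅} := hV ▸ mem_range_self k
    rcases this with h | h
    · exact hb.isOpen h
    · rw [h]; exact isOpen_empty
  have hVb : ∀ (O : Set K) (x : K), IsOpen O → x ∈ O → ∃ k, x ∈ V k ∧ V k ⊆ O := by
    intro O x hO hx
    obtain ⟨v, hv, hxv, hvO⟩ := hb.exists_subset_of_mem_open hx hO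
    obtain ⟨k, rfl⟩ : v ∈ range V := hV ▸ Or.inl hv
    exact ⟨k, hxv, hvO⟩
  -- `N k` collects the `t` whose section does not contain `V k`. It is only analytic, so its
  -- complement has to be replaced by a smaller Borel set `B k`.
  let N : ℕ → Set D := fun k => Prod.snd '' (Wᶜ ∩ Prod.fst ⁻¹' V k)
  have hN : ∀ k, AnalyticSet (N k) := fun k =>
    (hW.compl.inter (measurable_fst (hVo k).measurableSet)).analyticSet_image measurable_snd
  have hNt : ∀ k t, t ∉ N k → ∀ x ∈ V k, (x, t) ∈ W := by
    intro k t ht x hx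
    by_contra h
    exact ht ⟨(x, t), ⟨h, hx⟩, rfl⟩
  -- A common point of the `A k` would have no basic neighbourhood inside its own open section.
  let A : ℕ → Set (K × D) := fun k => W ∩ (Prod.fst ⁻¹' (V k)ᶜ ∪ Prod.snd ⁻¹' N k)
  have hA : ∀ k, AnalyticSet (A k) := by
    intro k
    have h1 : AnalyticSet (Prod.fst ⁻¹' (V k)ᶜ ∪ Prod.snd ⁻¹' N k : Set (K × D)) := by
      rw [union_eq_iUnion]
      refine AnalyticSet.iUnion fun c => ?_
      cases c
      · exact (hN k).preimage continuous_snd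
      · exact (measurable_fst (hVo k).measurableSet.compl).analyticSet
    change AnalyticSet (W ∩ _)
    rw [inter_eq_iInter]
    refine AnalyticSet.iInter fun c => ?_
    cases c
    · exact h1
    · exact hW.analyticSet
  have hAe : ⋂ k, A k = ∅ := by
    refine eq_empty_of_forall_notMem fun ⟨x, t⟩ hx => ?_
    rw [mem_iInter] at hx
    obtain ⟨k, hk, hk'⟩ := hVb _ x (hWo t) (hx 0).1
    rcases (hx k).2 with h | ⟨⟨y, t'⟩, ⟨h1, h2⟩, rfl⟩
    · exact h hk
    · exact h1 (hk' h2)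
  obtain ⟨C, hAC, hC, hCe⟩ := isMeasurablySeparated_of_analyticSet hA hAe
  -- A point of `W` outside `C k` lies over the complement of `N k`, so two disjoint analytic sets
  -- are to be separated.
  have hS : ∀ k, MeasurablySeparable (Prod.snd '' (W \ C k)) (N k) := by
    intro k
    refine AnalyticSet.measurablySeparable ((hW.diff (hC k)).analyticSet_image measurable_snd)
      (hN k) ?_
    rw [disjoint_left]
    rintro _ ⟨⟨x, t⟩, ⟨h1, h2⟩, rfl⟩ h3
    exact h2 (hAC k ⟨h1, Or.inr h3⟩)
  choose B hB1 hB2 hB3 using hS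
  -- If `t ∈ B k`, then `V k` lies in the section of `t`. If the section is full, these `V k` cover
  -- `K`, since the `C k` have empty intersection. By compactness finitely many suffice, and there
  -- are only countably many finite families.
  have : {t | ∀ x, (x, t) ∈ W} =
      ⋃ F ∈ {F : Finset ℕ | ⋃ k ∈ F, V k = univ}, ⋂ k ∈ F, B k := by
    ext t
    simp only [mem_ofPred_eq, mem_iUnion, mem_iInter, exists_prop]
    constructor
    · intro ht
      have hcov : univ ⊆ ⋃ k : {k // t ∈ B k}, V k := by
        intro x _
        have hx : (x, t) ∉ ⋂ k, C k := by rw [hCe]; exact id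
        rw [mem_iInter, not_forall] at hx
        obtain ⟨k, hk⟩ := hx
        refine mem_iUnion.2 ⟨⟨k, hB1 k ⟨(x, t), ⟨ht x, hk⟩, rfl⟩⟩, ?_⟩
        by_contra h
        exact hk (hAC k ⟨ht x, Or.inl h⟩)
      obtain ⟨F, hF⟩ := isCompact_univ.elim_finite_subcover _ (fun k => hVo _) hcov
      refine ⟨F.map (Embedding.subtype _), ?_, fun k hk => ?_⟩
      · refine eq_univ_of_univ_subset (hF.trans (iUnion₂_subset fun k hk => ?_))
        exact subset_biUnion_of_mem (s := (F.map (Embedding.subtype _) : Set ℕ)) (u := V)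
          (Finset.mem_map_of_mem (Embedding.subtype _) hk)
      · simp only [Finset.mem_map, Embedding.coe_subtype] at hk
        obtain ⟨k, -, rfl⟩ := hk
        exact k.2
    · rintro ⟨F, hF, hFB⟩ x
      have : x ∈ ⋃ k ∈ F, V k := hF ▸ mem_univ x
      simp only [mem_iUnion, exists_prop] at this
      obtain ⟨k, hk, hxk⟩ := this
      exact hNt k t (disjoint_right.1 (hB2 k) (hFB k hk)) x hxk
  rw [this]
  exact MeasurableSet.biUnion (to_countable _) fun F _ =>
    MeasurableSet.biInter (to_countable _) fun k _ => hB3 k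

end MTSpace

namespace MTSpace

open MeasureTheory Set Function

/-! ### Standard Borel spaces from countable covers. -/

section StandardBorel

lemma _root_.MeasurableEmbedding.standardBorelSpace {X Y : Type*} [MeasurableSpace X]
    [MeasurableSpace Y] [StandardBorelSpace Y] {f : X → Y} (hf : MeasurableEmbedding f) :
    StandardBorelSpace X := by
  have := hf.measurableSet_range.standardBorel
  let e := hf.equivRange
  obtain ⟨τ', hb', hp'⟩ := this.polish
  let τ : TopologicalSpace X := TopologicalSpace.induced e inferInstance
  have hb : BorelSpace X := ⟨e.measurableEmbedding.comap_eq.symm.trans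
    ((congrArg (MeasurableSpace.comap (e : X → range f)) hb'.measurable_eq).trans
      borel_comap.symm)⟩
  let h : X ≃ₜ range f := e.toEquiv.toHomeomorphOfIsInducing ⟨rfl⟩
  have hp : PolishSpace X := h.isClosedEmbedding.polishSpace
  exact ⟨τ, hb, hp⟩

/-- A measurable space covered by countably many measurable standard Borel subsets is standard
Borel. -/
lemma standardBorelSpace_of_iUnion_eq_univ {X : Type*} [MeasurableSpace X] {U : ℕ → Set X}
    (hU : ∀ n, MeasurableSet (U n)) (hB : ∀ n, StandardBorelSpace (U n))
    (hc : ⋃ n, U n = univ) : StandardBorelSpace X := by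
  classical
  have hx : ∀ x, ∃ n, x ∈ U n := fun x => mem_iUnion.1 (hc ▸ mem_univ x)
  let N : X → ℕ := fun x => Nat.find (hx x)
  have hN : Measurable N := measurable_find hx hU
  have hNU : ∀ x, x ∈ U (N x) := fun x => Nat.find_spec (hx x)
  let F : ℕ × X → ℝ := fun p => if h : p.2 ∈ U p.1 then embeddingReal (U p.1) ⟨p.2, h⟩ else 0
  have hF : Measurable F := measurable_from_prod_countable_right fun n =>
    Measurable.dite (s := U n) (f := embeddingReal (U n)) (g := fun _ => (0 : ℝ))
      (measurable_embeddingReal _) measurable_const (hU n)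
  have hFe : ∀ n x (h : x ∈ U n), F (n, x) = embeddingReal (U n) ⟨x, h⟩ := fun n x h => dif_pos h
  -- Recording the least index makes the pieces disjoint, so the embeddings of the `U n` in the line
  -- glue to one embedding.
  let g : X → ℕ × ℝ := fun x => (N x, F (N x, x))
  have hg : MeasurableEmbedding g := by
    refine ⟨fun x y hxy => ?_, hN.prodMk (hF.comp (hN.prodMk measurable_id)), fun s hs => ?_⟩
    · obtain ⟨h1, h2⟩ := Prod.ext_iff.1 hxy
      dsimp only [g] at h1 h2
      rw [hFe _ _ (hNU x), ← h1, hFe _ _ (h1 ▸ hNU y)] at h2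
      exact congrArg Subtype.val ((measurableEmbedding_embeddingReal _).injective h2)
    · have : g '' s = ⋃ n, {n} ×ˢ (embeddingReal (U n) '' {x : U n | (x : X) ∈ s ∧ N x = n}) := by
        ext ⟨n, r⟩
        simp only [mem_image, mem_iUnion, mem_prod, mem_singleton_iff, mem_ofPred_eq, g,
          Prod.mk.injEq]
        constructor
        · rintro ⟨x, hxs, rfl, rfl⟩
          exact ⟨_, rfl, ⟨x, hNU x⟩, ⟨hxs, rfl⟩, (hFe _ _ (hNU x)).symm⟩
        · rintro ⟨n, rfl, ⟨x, hx⟩, ⟨hxs, hn⟩, rfl⟩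
          dsimp only at hn
          exact ⟨x, hxs, hn, by rw [hn, hFe _ _ hx]⟩
      rw [this]
      refine MeasurableSet.iUnion fun n => (measurableSet_singleton n).prod
        ((measurableEmbedding_embeddingReal _).measurableSet_image.2 ?_)
      exact (measurable_subtype_coe hs).inter
        ((hN.comp measurable_subtype_coe) (measurableSet_singleton n))
  exact hg.standardBorelSpace

end StandardBorel

/-! ### Leaf-preserving measurable maps with dense orbits. -/

section Lamination

variable {X : Type u} [TopologicalSpace X] [MeasurableSpace X]

/-- The domain of a chart carries a countable family of measurable maps that follow the plaques
and have dense orbits in the plaques. -/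
lemma IsChartDomain.exists_plaque_maps {U : Set X} (hU : IsChartDomain U) :
    ∃ g : ℕ → X → X, (∀ j, Measurable (g j)) ∧ (∀ j x, g j x ∈ leaf x) ∧
      ∀ x ∈ U, ∃ Q : Set X, IsOpen Q ∧ x ∈ Q ∧
        ∀ y ∈ Q, ∀ z ∈ Q, ∀ O, IsOpen O → z ∈ O → ∃ j, g j y ∈ O := by
  classical
  obtain ⟨hUo, hUm, P, T, _, _, _, _, _, _, _, _, _, _, _, φ, hφ, hφ'⟩ := hU
  let d := TopologicalSpace.denseSeq P
  let f : ℕ → U → X := fun j x => φ.symm (d j, (φ x).2)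
  refine ⟨fun j x => if h : x ∈ U then f j ⟨x, h⟩ else x, fun j => ?_, fun j x => ?_, ?_⟩
  · exact Measurable.dite (f := f j) (g := fun x : (Uᶜ : Set X) => (x : X))
      (measurable_subtype_coe.comp (hφ'.measurable.comp
        (measurable_const.prodMk (measurable_snd.comp hφ.measurable)))) measurable_subtype_coe hUm
  · dsimp only
    split_ifs with h
    · have hc : IsPreconnected (range fun p : P => (φ.symm (p, (φ ⟨x, h⟩).2) : X)) :=
        isPreconnected_range (continuous_subtype_val.comp
          (hφ'.continuous.comp (Continuous.prodMk_left _)))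
      refine hc.subset_connectedComponent (x := x) ⟨(φ ⟨x, h⟩).1, ?_⟩ ⟨d j, rfl⟩
      simp
    · exact mem_connectedComponent
  · intro x hx
    -- The plaque through `x` is open because `T` is discrete.
    refine ⟨Subtype.val '' {y : U | (φ y).2 = (φ ⟨x, hx⟩).2}, ?_, ⟨⟨x, hx⟩, rfl, rfl⟩, ?_⟩
    · refine hUo.isOpenMap_subtype_val _ ?_
      exact (isOpen_discrete {(φ ⟨x, hx⟩).2}).preimage (continuous_snd.comp hφ.continuous)
    · rintro _ ⟨y, hy, rfl⟩ _ ⟨z, hz, rfl⟩ O hO hzO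
      have hO' : IsOpen ((fun p : P => (φ.symm (p, (φ y).2) : X)) ⁻¹' O) :=
        hO.preimage (continuous_subtype_val.comp (hφ'.continuous.comp (Continuous.prodMk_left _)))
      obtain ⟨_, hp, j, rfl⟩ := (TopologicalSpace.denseRange_denseSeq P).inter_open_nonempty _ hO'
        ⟨(φ z).1, by
          have h : (φ y).2 = (φ z).2 := Eq.trans hy (Eq.symm hz)
          rw [mem_preimage, h]
          simpa using hzO⟩
      exact ⟨j, by simpa [f] using hp⟩

lemma IsMeasurableLamination.standardBorelSpace (hX : IsMeasurableLamination X) :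
    StandardBorelSpace X := by
  obtain ⟨U, hU, hc⟩ := hX
  refine standardBorelSpace_of_iUnion_eq_univ (fun n => (hU n).2.1) (fun n => ?_) hc
  obtain ⟨-, -, P, T, _, _, _, _, _, _, _, _, _, _, _, φ, hφ, hφ'⟩ := hU n
  let e : U n ≃ᵐ P × T := ⟨φ, hφ.measurable, hφ'.measurable⟩
  exact e.measurableEmbedding.standardBorelSpace

/-- A measurable lamination carries countably many measurable maps that preserve the leaves and
have dense orbits in the leaves. -/
lemma IsMeasurableLamination.exists_leaf_maps (hX : IsMeasurableLamination X) :
    ∃ g : ℕ → X → X, (∀ k, Measurable (g k)) ∧ (∀ k x, g k x ∈ leaf x) ∧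
      ∀ x, ∀ y ∈ leaf x, ∀ O, IsOpen O → y ∈ O → ∃ k, g k x ∈ O := by
  obtain ⟨U, hU, hc⟩ := hX
  choose g hg1 hg2 hg3 using fun n => (hU n).exists_plaque_maps
  let G : List (ℕ × ℕ) → X → X := fun l x => l.foldr (fun p y => g p.1 p.2 y) x
  obtain ⟨e, he⟩ := exists_surjective_nat (List (ℕ × ℕ))
  suffices h : (∀ l, Measurable (G l)) ∧ (∀ l x, G l x ∈ leaf x) ∧
      ∀ x, ∀ y ∈ leaf x, ∀ O, IsOpen O → y ∈ O → ∃ l, G l x ∈ O from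
    ⟨fun k => G (e k), fun k => h.1 _, fun k => h.2.1 _, fun x y hy O hO hyO => by
      obtain ⟨l, hl⟩ := h.2.2 x y hy O hO hyO
      obtain ⟨k, rfl⟩ := he l
      exact ⟨k, hl⟩⟩
  refine ⟨fun l => ?_, fun l x => ?_, fun x => ?_⟩
  · induction l with
    | nil => exact measurable_id
    | cons p l ih => exact (hg1 p.1 p.2).comp ih
  · induction l with
    | nil => exact mem_connectedComponent
    | cons p l ih =>
      have := hg2 p.1 p.2 (G l x)
      unfold leaf at this ih ⊢
      rwa [connectedComponent_eq ih]
  -- If `y` is in the closure of the orbit, the orbit enters the open plaque of `y`, and one more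
  -- plaque map makes it dense there. The closure is therefore open as well, and contains the whole
  -- leaf.
  · have hclopen : IsClopen (closure (range fun l => G l x)) := by
      refine ⟨isClosed_closure, isOpen_iff_forall_mem_open.2 fun y hy => ?_⟩
      obtain ⟨n, hn⟩ := mem_iUnion.1 (hc ▸ mem_univ y)
      obtain ⟨Q, hQ, hyQ, hQd⟩ := hg3 n y hn
      refine ⟨Q, fun z hz => mem_closure_iff.2 fun O hO hzO => ?_, hQ, hyQ⟩
      obtain ⟨_, hlQ, l, rfl⟩ := mem_closure_iff.1 hy Q hQ hyQ
      obtain ⟨j, hj⟩ := hQd _ hlQ z hz O hO hzO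
      exact ⟨_, hj, (n, j) :: l, rfl⟩
    intro y hy O hO hyO
    have := hclopen.connectedComponent_subset (subset_closure ⟨[], rfl⟩) hy
    obtain ⟨_, hlO, l, rfl⟩ := mem_closure_iff.1 this O hO hyO
    exact ⟨l, hlO⟩

end Lamination

end MTSpace

namespace MTSpace

open Function

/-! ### Barycentric subdivision for cochains on tuples of points. -/

section Tuples

variable {E E' : Type*} {A : Type*} [AddCommGroup A]

/-- The coboundary of functions of tuples of points. -/
def tupleCoboundary (E A : Type*) [AddCommGroup A] (k : ℕ) :
    ((Fin (k + 1) → E) → A) →+ ((Fin (k + 2) → E) → A) where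
  toFun φ v := ∑ i : Fin (k + 2), (-1 : ℤ) ^ (i : ℕ) • φ (v ∘ i.succAbove)
  map_zero' := by ext; simp
  map_add' φ ψ := by ext; simp [Finset.sum_add_distrib]

lemma tupleCoboundary_apply (k : ℕ) (φ : (Fin (k + 1) → E) → A) (v : Fin (k + 2) → E) :
    tupleCoboundary E A k φ v = ∑ i : Fin (k + 2), (-1 : ℤ) ^ (i : ℕ) • φ (v ∘ i.succAbove) :=
  rfl

lemma tupleCoboundary_comp (k : ℕ) (φ : (Fin (k + 1) → E) → A) :
    tupleCoboundary E A (k + 1) (tupleCoboundary E A k φ) = 0 := by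
  ext v
  refine alternating_sum_eq_zero (fun (i : Fin (k + 3)) (j : Fin (k + 2)) =>
    φ ((v ∘ i.succAbove) ∘ j.succAbove)) fun a b h => ?_
  rw [comp_assoc, comp_assoc, succAbove_comp_succAbove h]

/-- Evaluation on the cones of tuples with apex `b`. -/
def tupleCone (A : Type*) [AddCommGroup A] (b : E) (k : ℕ) :
    ((Fin (k + 2) → E) → A) →+ ((Fin (k + 1) → E) → A) where
  toFun φ w := φ (Fin.cons b w)
  map_zero' := rfl
  map_add' _ _ := rfl

lemma cons_comp_succAbove_succ {n : ℕ} (b : E) (w : Fin (n + 1) → E) (j : Fin (n + 1)) :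
    (Fin.cons b w : Fin (n + 2) → E) ∘ j.succ.succAbove = Fin.cons b (w ∘ j.succAbove) := by
  funext i
  refine Fin.cases ?_ (fun i => ?_) i
  · simp
  · simp

lemma cons_comp_succAbove_zero {n : ℕ} (b : E) (w : Fin (n + 1) → E) :
    (Fin.cons b w : Fin (n + 2) → E) ∘ (0 : Fin (n + 2)).succAbove = w := by
  funext i
  simp

/-- Coning is a contracting homotopy: the face opposite the apex is `w`, and the other faces are the
cones of the faces of `w`, with one more sign. -/
lemma tupleCone_tupleCoboundary (b : E) (k : ℕ) (φ : (Fin (k + 2) → E) → A) :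
    tupleCone A b (k + 1) (tupleCoboundary E A (k + 1) φ) =
      φ - tupleCoboundary E A k (tupleCone A b k φ) := by
  ext w
  change ∑ i : Fin (k + 3), (-1 : ℤ) ^ (i : ℕ) •
    φ ((Fin.cons b w : Fin (k + 3) → E) ∘ i.succAbove) =
    φ w - ∑ i : Fin (k + 2), (-1 : ℤ) ^ (i : ℕ) • φ (Fin.cons b (w ∘ i.succAbove))
  rw [Fin.sum_univ_succ, cons_comp_succAbove_zero, sub_eq_add_neg, ← Finset.sum_neg_distrib]
  simp only [cons_comp_succAbove_succ, Fin.val_succ, pow_succ, Fin.val_zero, pow_zero, one_smul,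
    mul_neg, mul_one, neg_smul]

variable (A) (b : ∀ k, (Fin (k + 1) → E) → E)

/-- The dual of barycentric subdivision, for an abstract barycenter operation. -/
def subdivision : ∀ k, ((Fin (k + 1) → E) → A) →+ ((Fin (k + 1) → E) → A)
  | 0 => AddMonoidHom.id _
  | k + 1 => AddMonoidHom.mk' (fun φ v =>
      tupleCoboundary E A k (subdivision k (tupleCone A (b (k + 1) v) k φ)) v)
      fun φ ψ => by ext v; simp only [map_add, Pi.add_apply]

/-- The dual of the homotopy between barycentric subdivision and the identity. -/
def subdivisionHomotopy : ∀ k, ((Fin (k + 2) → E) → A) →+ ((Fin (k + 1) → E) → A)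
  | 0 => 0
  | k + 1 => AddMonoidHom.mk' (fun φ v => tupleCone A (b (k + 1) v) (k + 1) φ v -
      tupleCoboundary E A k (subdivisionHomotopy k (tupleCone A (b (k + 1) v) (k + 1) φ)) v)
      fun φ ψ => by ext v; simp only [map_add, Pi.add_apply]; abel

variable {A}

lemma subdivision_succ (k : ℕ) (φ : (Fin (k + 2) → E) → A) (v : Fin (k + 2) → E) :
    subdivision A b (k + 1) φ v =
      tupleCoboundary E A k (subdivision A b k (tupleCone A (b (k + 1) v) k φ)) v := rfl

lemma subdivisionHomotopy_succ (k : ℕ) (φ : (Fin (k + 3) → E) → A) (v : Fin (k + 2) → E) :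
    subdivisionHomotopy A b (k + 1) φ v = tupleCone A (b (k + 1) v) (k + 1) φ v -
      tupleCoboundary E A k (subdivisionHomotopy A b k (tupleCone A (b (k + 1) v) (k + 1) φ)) v :=
  rfl

/-- The hypothesis is the homotopy formula one degree lower after applying the coboundary. This
removes the term of the preceding degree, so that the induction starts in degree `0` without a
homotopy in negative degree. -/
lemma subdivisionHomotopy_add_of_eq (k : ℕ)
    (h : ∀ φ : (Fin (k + 1) → E) → A, tupleCoboundary E A k (subdivisionHomotopy A b k
      (tupleCoboundary E A k φ)) = tupleCoboundary E A k φ -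
        tupleCoboundary E A k (subdivision A b k φ)) (φ : (Fin (k + 2) → E) → A) :
    subdivisionHomotopy A b (k + 1) (tupleCoboundary E A (k + 1) φ) +
      tupleCoboundary E A k (subdivisionHomotopy A b k φ) = φ - subdivision A b (k + 1) φ := by
  ext v
  simp only [Pi.add_apply, Pi.sub_apply, subdivisionHomotopy_succ, subdivision_succ,
    tupleCone_tupleCoboundary, map_sub, h]
  abel

lemma tupleCoboundary_subdivisionHomotopy (k : ℕ) (φ : (Fin (k + 1) → E) → A) :
    tupleCoboundary E A k (subdivisionHomotopy A b k (tupleCoboundary E A k φ)) =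
      tupleCoboundary E A k φ - tupleCoboundary E A k (subdivision A b k φ) := by
  induction k with
  | zero => simp [subdivisionHomotopy, subdivision]
  | succ k ih =>
    have := congrArg (tupleCoboundary E A (k + 1)) (subdivisionHomotopy_add_of_eq b k ih φ)
    rwa [map_add, tupleCoboundary_comp, add_zero, map_sub] at this

lemma subdivisionHomotopy_add (k : ℕ) (φ : (Fin (k + 2) → E) → A) :
    subdivisionHomotopy A b (k + 1) (tupleCoboundary E A (k + 1) φ) +
      tupleCoboundary E A k (subdivisionHomotopy A b k φ) = φ - subdivision A b (k + 1) φ :=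
  subdivisionHomotopy_add_of_eq b k (tupleCoboundary_subdivisionHomotopy b k) φ

/-- Evaluate the homotopy formula at a coboundary: the first term vanishes and
`tupleCoboundary_subdivisionHomotopy` computes the second. No separate induction is needed. -/
lemma subdivision_tupleCoboundary (k : ℕ) (φ : (Fin (k + 1) → E) → A) :
    subdivision A b (k + 1) (tupleCoboundary E A k φ) =
      tupleCoboundary E A k (subdivision A b k φ) := by
  have h := subdivisionHomotopy_add b k (tupleCoboundary E A k φ)
  rw [tupleCoboundary_comp, map_zero, zero_add, tupleCoboundary_subdivisionHomotopy] at h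
  exact (sub_right_injective h).symm

variable {b}

section Equivariance

variable {b' : ∀ k, (Fin (k + 1) → E') → E'} {f : E → E'}

/-- Naturality under maps that preserve barycenters. For an affine map `f`, subdividing a simplex on
its own agrees with subdividing it inside the ambient simplex. -/
lemma subdivision_comp (hf : ∀ k v, f (b k v) = b' k (f ∘ v)) (k : ℕ)
    (φ : (Fin (k + 1) → E') → A) (v : Fin (k + 1) → E) :
    subdivision A b k (fun w => φ (f ∘ w)) v = subdivision A b' k φ (f ∘ v) := by
  induction k with
  | zero => rfl
  | succ k ih =>
    rw [subdivision_succ, subdivision_succ, tupleCoboundary_apply, tupleCoboundary_apply, ← hf]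
    refine Finset.sum_congr rfl fun i _ => ?_
    rw [comp_assoc, ← ih]
    congr 1
    refine congrArg (fun ψ => subdivision A b k ψ (v ∘ i.succAbove)) ?_
    funext w
    exact congrArg φ (Fin.comp_cons f _ w)

lemma subdivisionHomotopy_comp (hf : ∀ k v, f (b k v) = b' k (f ∘ v)) (k : ℕ)
    (φ : (Fin (k + 2) → E') → A) (v : Fin (k + 1) → E) :
    subdivisionHomotopy A b k (fun w => φ (f ∘ w)) v =
      subdivisionHomotopy A b' k φ (f ∘ v) := by
  induction k with
  | zero => rfl
  | succ k ih =>
    have h : tupleCone A (b (k + 1) v) (k + 1) (fun w => φ (f ∘ w)) =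
        fun w => tupleCone A (b' (k + 1) (f ∘ v)) (k + 1) φ (f ∘ w) := by
      funext w
      rw [← hf]
      exact congrArg φ (Fin.comp_cons f _ w)
    rw [subdivisionHomotopy_succ, subdivisionHomotopy_succ, tupleCoboundary_apply,
      tupleCoboundary_apply, h]
    congr 1
    refine Finset.sum_congr rfl fun i _ => ?_
    rw [ih, comp_assoc]

end Equivariance

section Measurability

variable [MeasurableSpace A] [MeasurableAdd₂ A] [MeasurableNeg A] {D : Type*} [MeasurableSpace D]

lemma measurable_tupleCoboundary {k : ℕ} {φ : D → (Fin (k + 1) → E) → A}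
    (hφ : ∀ w, Measurable fun t => φ t w) (v : Fin (k + 2) → E) :
    Measurable fun t => tupleCoboundary E A k (φ t) v := by
  simp only [tupleCoboundary_apply]
  exact Finset.measurable_fun_sum _ fun i _ => (hφ _).const_smul ((-1 : ℤ) ^ (i : ℕ))

lemma measurable_subdivision (b : ∀ k, (Fin (k + 1) → E) → E) {k : ℕ}
    {φ : D → (Fin (k + 1) → E) → A} (hφ : ∀ w, Measurable fun t => φ t w) (v : Fin (k + 1) → E) :
    Measurable fun t => subdivision A b k (φ t) v := by
  induction k with
  | zero => exact hφ v
  | succ k ih =>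
    exact measurable_tupleCoboundary
      (φ := fun t => subdivision A b k (tupleCone A (b (k + 1) v) k (φ t)))
      (fun w => ih (fun w => hφ (Fin.cons (b (k + 1) v) w)) w) v

lemma measurable_subdivisionHomotopy (b : ∀ k, (Fin (k + 1) → E) → E) {k : ℕ}
    {φ : D → (Fin (k + 2) → E) → A} (hφ : ∀ w, Measurable fun t => φ t w) (v : Fin (k + 1) → E) :
    Measurable fun t => subdivisionHomotopy A b k (φ t) v := by
  induction k with
  | zero => exact measurable_const
  | succ k ih =>
    have h1 := (hφ (Fin.cons (b (k + 1) v) v))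
    have h2 := measurable_tupleCoboundary
      (φ := fun t => subdivisionHomotopy A b k (tupleCone A (b (k + 1) v) (k + 1) (φ t)))
      (fun w => ih (fun w => hφ (Fin.cons (b (k + 1) v) w)) w) v
    simp only [subdivisionHomotopy_succ, sub_eq_add_neg]
    exact h1.add h2.neg

end Measurability

section Shrinking

variable [PseudoMetricSpace E]

/-- Subdivision shrinks simplices: if a function vanishes on the tuples of diameter at most `ρ`,
its subdivision vanishes on tuples of a larger diameter. -/
lemma subdivision_eq_zero
    (hball : ∀ k v p (r : ℝ), (∀ i, dist (v i) p ≤ r) → dist (b k v) p ≤ r)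
    (hvert : ∀ (k : ℕ) v j (r : ℝ), (∀ i i', k * dist (v i) (v i') ≤ (k + 1) * r) →
      dist (b k v) (v j) ≤ r)
    {ρ : ℝ} (hρ : 0 ≤ ρ) (k : ℕ) (C : Set E) (hC : ∀ k v, (∀ i, v i ∈ C) → b k v ∈ C)
    (φ : (Fin (k + 1) → E) → A)
    (hφ : ∀ w, (∀ i, w i ∈ C) → (∀ i j, dist (w i) (w j) ≤ ρ) → φ w = 0)
    (v : Fin (k + 1) → E) (hv : ∀ i, v i ∈ C)
    (hd : ∀ i j, k * dist (v i) (v j) ≤ (k + 1) * ρ) : subdivision A b k φ v = 0 := by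
  induction k generalizing C with
  | zero =>
    refine hφ v hv fun i j => ?_
    obtain rfl : i = j := Subsingleton.elim (α := Fin 1) i j
    rwa [dist_self]
  | succ k ih =>
    rw [subdivision_succ, tupleCoboundary_apply]
    refine Finset.sum_eq_zero fun i _ => ?_
    -- The vertices of the face lie within `ρ` of the barycenter, hence so does everything built
    -- from them by barycenters. Shrinking `C` to the ball is how the induction remembers that the
    -- apex is close to the rest.
    rw [ih (C ∩ Metric.closedBall (b (k + 1) v) ρ), smul_zero]
    · exact fun m w hw => ⟨hC m w fun j => (hw j).1, hball m w _ _ fun j => (hw j).2⟩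
    · intro w hw hwd
      refine hφ _ (fun j => ?_) (fun j j' => ?_)
      · refine Fin.cases ?_ (fun j => ?_) j
        · exact hC _ v hv
        · exact (hw j).1
      · refine Fin.cases ?_ (fun j => ?_) j <;> refine Fin.cases ?_ (fun j' => ?_) j'
        · simpa using hρ
        · rw [dist_comm]
          exact (hw j').2
        · exact (hw j).2
        · exact hwd j j'
    · intro j
      refine ⟨hv _, ?_⟩
      rw [Metric.mem_closedBall, dist_comm]
      exact hvert (k + 1) v _ _ hd
    -- The bound passes to faces because `k * (k + 2) ≤ (k + 1) ^ 2`.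
    · intro j j'
      have h := hd (i.succAbove j) (i.succAbove j')
      push_cast at h
      have hk : (0 : ℝ) ≤ k := Nat.cast_nonneg k
      simp only [Function.comp_apply]
      nlinarith [mul_le_mul_of_nonneg_left h hk]

/-- Each subdivision enlarges the admissible diameter by the factor `(k + 2) / (k + 1)`. It is
smaller than `(k + 1) / k` but makes sense for `k = 0`. -/
lemma iterate_subdivision_eq_zero
    (hball : ∀ k v p (r : ℝ), (∀ i, dist (v i) p ≤ r) → dist (b k v) p ≤ r)
    (hvert : ∀ (k : ℕ) v j (r : ℝ), (∀ i i', k * dist (v i) (v i') ≤ (k + 1) * r) →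
      dist (b k v) (v j) ≤ r)
    {ρ : ℝ} (hρ : 0 ≤ ρ) (k : ℕ) (φ : (Fin (k + 1) → E) → A)
    (hφ : ∀ w, (∀ i j, dist (w i) (w j) ≤ ρ) → φ w = 0) (m : ℕ) (v : Fin (k + 1) → E)
    (hd : ∀ i j, dist (v i) (v j) ≤ ((k + 2) / (k + 1)) ^ m * ρ) :
    (subdivision A b k)^[m] φ v = 0 := by
  induction m generalizing v with
  | zero => exact hφ v (by simpa using hd)
  | succ m ih =>
    rw [iterate_succ_apply']
    have hk : (0 : ℝ) ≤ k := Nat.cast_nonneg k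
    have hρm : 0 ≤ ((k + 2) / (k + 1) : ℝ) ^ m * ρ := by positivity
    refine subdivision_eq_zero hball hvert hρm k Set.univ (fun _ _ _ => trivial) _
      (fun w _ hw => ih w hw) v (fun _ => trivial) fun i j => ?_
    have h := mul_le_mul_of_nonneg_left (hd i j) hk
    refine h.trans ?_
    rw [pow_succ', mul_assoc, ← mul_assoc (k : ℝ)]
    refine mul_le_mul_of_nonneg_right ?_ hρm
    rw [mul_div_assoc', div_le_iff₀ (by positivity)]
    nlinarith

end Shrinking

end Tuples

/-! ### Affine simplices and the geometry of barycenters. -/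

section Affine

/-- The affine map between canonical simplices with prescribed values at the vertices. -/
def affineSimplex {k n : ℕ} (v : Fin (k + 1) → Simplex n) : C(Simplex k, Simplex n) where
  toFun x := ⟨∑ i, x i • (v i : Fin (n + 1) → ℝ),
    (convex_stdSimplex ℝ (Fin (n + 1))).sum_mem (fun i _ => x.2.1 i) x.2.2 fun i _ => (v i).2⟩
  continuous_toFun := by
    refine Continuous.subtype_mk (continuous_finsetSum _ fun i _ => ?_) _
    exact ((continuous_apply i).comp continuous_subtype_val).smul continuous_const

lemma affineSimplex_coe {k n : ℕ} (v : Fin (k + 1) → Simplex n) (x : Simplex k) :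
    (affineSimplex v x : Fin (n + 1) → ℝ) = ∑ i, x i • (v i : Fin (n + 1) → ℝ) := rfl

lemma affineSimplex_comp {k m n : ℕ} (u : Fin (m + 1) → Simplex n) (v : Fin (k + 1) → Simplex m) :
    (affineSimplex u).comp (affineSimplex v) = affineSimplex (affineSimplex u ∘ v) := by
  ext x j
  change (∑ i, (∑ l, x l • (v l : Fin (m + 1) → ℝ)) i • (u i : Fin (n + 1) → ℝ)) j =
    (∑ l, x l • ∑ i, v l i • (u i : Fin (n + 1) → ℝ)) j
  simp only [Finset.sum_apply, Pi.smul_apply, smul_eq_mul, Finset.sum_mul, Finset.mul_sum]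
  rw [Finset.sum_comm]
  exact Finset.sum_congr rfl fun _ _ => Finset.sum_congr rfl fun _ _ => mul_assoc _ _ _

/-- The vertices of the canonical simplex. -/
def vertices (n : ℕ) : Fin (n + 1) → Simplex n := fun i => stdSimplex.vertex i

lemma affineSimplex_vertex {k n : ℕ} (v : Fin (k + 1) → Simplex n) (i : Fin (k + 1)) :
    affineSimplex v (vertices k i) = v i := by
  ext j
  change (affineSimplex v (vertices k i) : Fin (n + 1) → ℝ) j = _
  rw [affineSimplex_coe]
  simp only [vertices, stdSimplex.vertex_coe]
  rw [Finset.sum_apply, Finset.sum_eq_single i]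
  · simp
  · intro l _ hl
    simp [hl]
  · simp

lemma simplexMap_eq_affineSimplex {m n : ℕ} (f : Fin (m + 1) → Fin (n + 1)) :
    simplexMap f = affineSimplex (vertices n ∘ f) := by
  ext x j
  change (FunOnFinite.linearMap ℝ ℝ f x) j =
    (∑ i, x i • (vertices n (f i) : Fin (n + 1) → ℝ)) j
  rw [FunOnFinite.linearMap_apply_apply, Finset.sum_apply, Finset.sum_filter]
  refine Finset.sum_congr rfl fun i _ => ?_
  simp [vertices, Pi.single_apply, eq_comm]

lemma affineSimplex_comp_simplexMap {k m n : ℕ} (v : Fin (k + 1) → Simplex n)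
    (f : Fin (m + 1) → Fin (k + 1)) :
    (affineSimplex v).comp (simplexMap f) = affineSimplex (v ∘ f) := by
  rw [simplexMap_eq_affineSimplex, affineSimplex_comp]
  congr 1
  funext i
  exact affineSimplex_vertex v (f i)

lemma affineSimplex_vertices (n : ℕ) : affineSimplex (vertices n) = ContinuousMap.id _ := by
  have := simplexMap_eq_affineSimplex (id : Fin (n + 1) → Fin (n + 1))
  rw [comp_id] at this
  rw [← this]
  ext1 x
  exact stdSimplex.map_id_apply x

/-- The barycenter of a tuple of points of a canonical simplex. -/
noncomputable def tupleBarycenter (n k : ℕ) (v : Fin (k + 1) → Simplex n) : Simplex n :=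
  affineSimplex v stdSimplex.barycenter

lemma affineSimplex_tupleBarycenter {m n : ℕ} (u : Fin (m + 1) → Simplex n) (k : ℕ)
    (v : Fin (k + 1) → Simplex m) :
    affineSimplex u (tupleBarycenter m k v) = tupleBarycenter n k (affineSimplex u ∘ v) :=
  DFunLike.congr_fun (affineSimplex_comp u v) _

lemma dist_affineSimplex_le {k n : ℕ} (v : Fin (k + 1) → Simplex n) (x : Simplex k)
    (p : Simplex n) : dist (affineSimplex v x) p ≤ ∑ i, x i * dist (v i) p := by
  have h : (affineSimplex v x : Fin (n + 1) → ℝ) - p =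
      ∑ i, x i • ((v i : Fin (n + 1) → ℝ) - p) := by
    simp only [smul_sub, Finset.sum_sub_distrib, affineSimplex_coe, ← Finset.sum_smul,
      stdSimplex.sum_eq_one, one_smul]
  rw [Subtype.dist_eq, dist_eq_norm]
  change ‖(affineSimplex v x : Fin (n + 1) → ℝ) - p‖ ≤ _
  rw [h]
  refine (norm_sum_le _ _).trans (Finset.sum_le_sum fun i _ => ?_)
  rw [norm_smul, Real.norm_of_nonneg (stdSimplex.zero_le x i), Subtype.dist_eq, dist_eq_norm]
  rfl

lemma dist_affineSimplex_le_of_forall_le {k n : ℕ} {v : Fin (k + 1) → Simplex n} {p : Simplex n}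
    {r : ℝ} (h : ∀ i, dist (v i) p ≤ r) (x : Simplex k) : dist (affineSimplex v x) p ≤ r := by
  refine (dist_affineSimplex_le v x p).trans ((Finset.sum_le_sum fun i _ =>
    mul_le_mul_of_nonneg_left (h i) (x.2.1 i)).trans_eq ?_)
  rw [← Finset.sum_mul]
  exact (congrArg (· * r) x.2.2).trans (one_mul r)

/-- In the average of the distances to `v j` the term of `v j` itself is zero, which leaves `k`
distances with weight `1 / (k + 1)`. -/
lemma dist_tupleBarycenter_le {k n : ℕ} {v : Fin (k + 1) → Simplex n} (j : Fin (k + 1)) {r : ℝ}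
    (h : ∀ i i', k * dist (v i) (v i') ≤ (k + 1) * r) :
    dist (tupleBarycenter n k v) (v j) ≤ r := by
  refine (dist_affineSimplex_le v _ _).trans ?_
  have hk : (0 : ℝ) < k + 1 := by positivity
  have hb : ∀ i, (stdSimplex.barycenter : Simplex k) i = ((k : ℝ) + 1)⁻¹ := fun i => by
    refine (stdSimplex.barycenter_apply (𝕜 := ℝ) i).trans ?_
    simp
  simp only [hb, ← Finset.mul_sum]
  rw [inv_mul_le_iff₀ hk, ← Finset.add_sum_erase _ _ (Finset.mem_univ j), dist_self, zero_add]
  rcases Nat.eq_zero_or_pos k with rfl | hk0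
  · have : (Finset.univ.erase j : Finset (Fin (0 + 1))) = ∅ :=
      Finset.eq_empty_of_forall_notMem fun i hi =>
        (Finset.mem_erase.1 hi).1 (Subsingleton.elim (α := Fin 1) i j)
    rw [this, Finset.sum_empty]
    simpa using h j j
  · have hk0' : (0 : ℝ) < k := Nat.cast_pos.2 hk0
    refine le_of_mul_le_mul_left ?_ hk0'
    rw [Finset.mul_sum]
    refine (Finset.sum_le_card_nsmul _ _ _ fun i _ => h i j).trans_eq ?_
    rw [Finset.card_erase_of_mem (Finset.mem_univ j), Finset.card_univ, Fintype.card_fin,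
      Nat.add_sub_cancel, nsmul_eq_mul]

lemma dist_simplex_le_one {n : ℕ} (x y : Simplex n) : dist x y ≤ 1 := by
  rw [Subtype.dist_eq, dist_pi_le_iff zero_le_one]
  intro i
  exact Real.dist_le_of_mem_Icc_01 (mem_Icc_of_mem_stdSimplex x.2 i)
    (mem_Icc_of_mem_stdSimplex y.2 i)

end Affine

end MTSpace

/-! ### Cochains measurable along probes, and the theorem of small simplices. -/

namespace MTSpace

open Function

/-- A standard Borel space with a map to `X`, used to parametrize families of simplices. -/
structure Probe (X : Type u) : Type (u + 1) where
  carrier : Type u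
  [measurableSpace : MeasurableSpace carrier]
  [standardBorelSpace : StandardBorelSpace carrier]
  base : carrier → X

attribute [instance] Probe.measurableSpace Probe.standardBorelSpace

section Cochains

variable {X : Type u} [TopologicalSpace X]

/-- A singular simplex with image in `V`. -/
def IsInside (V : Set X) {n : ℕ} (σ : SingularSimplex X n) : Prop := ∀ x, σ x ∈ V

lemma IsInside.comp {V : Set X} {m n : ℕ} {σ : SingularSimplex X n} (h : IsInside V σ)
    (f : C(Simplex m, Simplex n)) : IsInside V (σ.comp f) := fun x => h (f x)

lemma IsInside.mono {V W : Set X} {n : ℕ} {σ : SingularSimplex X n} (h : IsInside V σ)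
    (hVW : V ⊆ W) : IsInside W σ := fun x => hVW (h x)

section Raw

variable (X) (Γ : Type v) [AddCommGroup Γ]

/-- The coboundary of singular cochains. -/
noncomputable def simplexCoboundary (n : ℕ) :
    (SingularSimplex X n → Γ) →+ (SingularSimplex X (n + 1) → Γ) where
  toFun ω σ := ∑ i : Fin (n + 2), (-1 : ℤ) ^ (i : ℕ) • ω (σ.comp (simplexMap i.succAbove))
  map_zero' := by ext; simp
  map_add' φ ψ := by ext; simp [Finset.sum_add_distrib]

/-- The values of a singular cochain on the affine simplices of a singular simplex. -/
def tupleCochain {n : ℕ} (σ : SingularSimplex X n) (k : ℕ) :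
    (SingularSimplex X k → Γ) →+ ((Fin (k + 1) → Simplex n) → Γ) where
  toFun ω w := ω (σ.comp (affineSimplex w))
  map_zero' := rfl
  map_add' _ _ := rfl

/-- The dual of barycentric subdivision. -/
noncomputable def simplexSubdivision (n : ℕ) :
    (SingularSimplex X n → Γ) →+ (SingularSimplex X n → Γ) where
  toFun ω σ := subdivision Γ (tupleBarycenter n) n (tupleCochain X Γ σ n ω) (vertices n)
  map_zero' := by ext; simp
  map_add' φ ψ := by ext; simp

/-- The dual of the homotopy between barycentric subdivision and the identity. -/
noncomputable def simplexHomotopy (n : ℕ) :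
    (SingularSimplex X (n + 1) → Γ) →+ (SingularSimplex X n → Γ) where
  toFun ω σ := subdivisionHomotopy Γ (tupleBarycenter n) n (tupleCochain X Γ σ (n + 1) ω)
    (vertices n)
  map_zero' := by ext; simp
  map_add' φ ψ := by ext; simp

variable {X Γ}

lemma simplexCoboundary_apply {n : ℕ} (ω : SingularSimplex X n → Γ)
    (σ : SingularSimplex X (n + 1)) : simplexCoboundary X Γ n ω σ =
      ∑ i : Fin (n + 2), (-1 : ℤ) ^ (i : ℕ) • ω (σ.comp (simplexMap i.succAbove)) := rfl

lemma simplexCoboundary_comp (n : ℕ) (ω : SingularSimplex X n → Γ) :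
    simplexCoboundary X Γ (n + 1) (simplexCoboundary X Γ n ω) = 0 := by
  ext σ
  refine alternating_sum_eq_zero (fun (i : Fin (n + 3)) (j : Fin (n + 2)) => ω
    ((σ.comp (simplexMap i.succAbove)).comp (simplexMap j.succAbove))) fun a b h => ?_
  simp only [ContinuousMap.comp_assoc, simplexMap_comp, succAbove_comp_succAbove h]

lemma tupleCochain_vertices {n : ℕ} (ω : SingularSimplex X n → Γ) (σ : SingularSimplex X n) :
    tupleCochain X Γ σ n ω (vertices n) = ω σ := by
  change ω (σ.comp (affineSimplex (vertices n))) = ω σ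
  rw [affineSimplex_vertices, ContinuousMap.comp_id]

lemma tupleCochain_comp_affineSimplex {k m n : ℕ} (σ : SingularSimplex X n)
    (w : Fin (m + 1) → Simplex n) (ω : SingularSimplex X k → Γ) :
    tupleCochain X Γ (σ.comp (affineSimplex w)) k ω =
      fun u => tupleCochain X Γ σ k ω (affineSimplex w ∘ u) := by
  funext u
  change ω ((σ.comp (affineSimplex w)).comp (affineSimplex u)) =
    ω (σ.comp (affineSimplex (affineSimplex w ∘ u)))
  rw [ContinuousMap.comp_assoc, affineSimplex_comp]

lemma affineSimplex_comp_vertices {k n : ℕ} (w : Fin (k + 1) → Simplex n) :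
    affineSimplex w ∘ vertices k = w := funext (affineSimplex_vertex w)

/-- On the affine simplices of a fixed `σ`, the singular operators become the operators on tuples.
This lemma and the next two transport the homotopy identities to singular cochains. -/
lemma tupleCochain_simplexCoboundary {k n : ℕ} (σ : SingularSimplex X n)
    (ω : SingularSimplex X k → Γ) : tupleCochain X Γ σ (k + 1) (simplexCoboundary X Γ k ω) =
      tupleCoboundary _ Γ k (tupleCochain X Γ σ k ω) := by
  funext w
  change ∑ i : Fin (k + 2), (-1 : ℤ) ^ (i : ℕ) •
    ω ((σ.comp (affineSimplex w)).comp (simplexMap i.succAbove)) =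
    ∑ i : Fin (k + 2), (-1 : ℤ) ^ (i : ℕ) • ω (σ.comp (affineSimplex (w ∘ i.succAbove)))
  refine Finset.sum_congr rfl fun i _ => ?_
  rw [ContinuousMap.comp_assoc, affineSimplex_comp_simplexMap]

lemma tupleCochain_simplexSubdivision {k n : ℕ} (σ : SingularSimplex X n)
    (ω : SingularSimplex X k → Γ) : tupleCochain X Γ σ k (simplexSubdivision X Γ k ω) =
      subdivision Γ (tupleBarycenter n) k (tupleCochain X Γ σ k ω) := by
  funext w
  change subdivision Γ (tupleBarycenter k) k (tupleCochain X Γ (σ.comp (affineSimplex w)) k ω)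
    (vertices k) = _
  rw [tupleCochain_comp_affineSimplex,
    subdivision_comp (b' := tupleBarycenter n) (affineSimplex_tupleBarycenter w),
    affineSimplex_comp_vertices]

lemma tupleCochain_simplexHomotopy {k n : ℕ} (σ : SingularSimplex X n)
    (ω : SingularSimplex X (k + 1) → Γ) : tupleCochain X Γ σ k (simplexHomotopy X Γ k ω) =
      subdivisionHomotopy Γ (tupleBarycenter n) k (tupleCochain X Γ σ (k + 1) ω) := by
  funext w
  change subdivisionHomotopy Γ (tupleBarycenter k) k
    (tupleCochain X Γ (σ.comp (affineSimplex w)) (k + 1) ω) (vertices k) = _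
  rw [tupleCochain_comp_affineSimplex,
    subdivisionHomotopy_comp (b' := tupleBarycenter n) (affineSimplex_tupleBarycenter w),
    affineSimplex_comp_vertices]

lemma simplexHomotopy_add (n : ℕ) (ω : SingularSimplex X (n + 1) → Γ) :
    simplexHomotopy X Γ (n + 1) (simplexCoboundary X Γ (n + 1) ω) +
      simplexCoboundary X Γ n (simplexHomotopy X Γ n ω) =
      ω - simplexSubdivision X Γ (n + 1) ω := by
  funext σ
  have h := congrFun (subdivisionHomotopy_add (tupleBarycenter (n + 1)) n
    (tupleCochain X Γ σ (n + 1) ω)) (vertices (n + 1))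
  rw [← tupleCochain_simplexCoboundary, ← tupleCochain_simplexHomotopy,
    ← tupleCochain_simplexHomotopy, ← tupleCochain_simplexCoboundary,
    ← tupleCochain_simplexSubdivision, ← map_add, ← map_sub, tupleCochain_vertices,
    tupleCochain_vertices] at h
  exact h

lemma simplexSubdivision_simplexCoboundary (n : ℕ) (ω : SingularSimplex X n → Γ) :
    simplexSubdivision X Γ (n + 1) (simplexCoboundary X Γ n ω) =
      simplexCoboundary X Γ n (simplexSubdivision X Γ n ω) := by
  funext σ
  have h := congrFun (subdivision_tupleCoboundary (tupleBarycenter (n + 1)) n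
    (tupleCochain X Γ σ n ω)) (vertices (n + 1))
  rwa [← tupleCochain_simplexCoboundary, ← tupleCochain_simplexSubdivision,
    ← tupleCochain_simplexSubdivision, ← tupleCochain_simplexCoboundary, tupleCochain_vertices,
    tupleCochain_vertices] at h

section Small

variable {U : ℕ → Set X}

/-- The cochains that vanish on the simplices that are contained in a member of the covering. -/
def VanishesOnSmall (U : ℕ → Set X) {n : ℕ} (ω : SingularSimplex X n → Γ) : Prop :=
  ∀ i σ, IsInside (U i) σ → ω σ = 0

lemma VanishesOnSmall.tupleCochain_eq_zero {k n : ℕ} {ω : SingularSimplex X k → Γ}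
    (hω : VanishesOnSmall U ω) {i : ℕ} {σ : SingularSimplex X n} (hσ : IsInside (U i) σ) :
    tupleCochain X Γ σ k ω = 0 :=
  funext fun _ => hω i _ (hσ.comp _)

lemma VanishesOnSmall.simplexSubdivision {n : ℕ} {ω : SingularSimplex X n → Γ}
    (hω : VanishesOnSmall U ω) : VanishesOnSmall U (simplexSubdivision X Γ n ω) := by
  intro i σ hσ
  change subdivision Γ _ n (tupleCochain X Γ σ n ω) _ = 0
  rw [hω.tupleCochain_eq_zero hσ, map_zero, Pi.zero_apply]

lemma VanishesOnSmall.simplexHomotopy {n : ℕ} {ω : SingularSimplex X (n + 1) → Γ}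
    (hω : VanishesOnSmall U ω) : VanishesOnSmall U (simplexHomotopy X Γ n ω) := by
  intro i σ hσ
  change subdivisionHomotopy Γ _ n (tupleCochain X Γ σ (n + 1) ω) _ = 0
  rw [hω.tupleCochain_eq_zero hσ, map_zero, Pi.zero_apply]

lemma VanishesOnSmall.iterate {n : ℕ} {ω : SingularSimplex X n → Γ}
    (hω : VanishesOnSmall U ω) (m : ℕ) :
    VanishesOnSmall U ((MTSpace.simplexSubdivision X Γ n)^[m] ω) := by
  induction m with
  | zero => exact hω
  | succ m ih =>
    rw [iterate_succ_apply']
    exact ih.simplexSubdivision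

lemma tupleCochain_iterate {k n : ℕ} (σ : SingularSimplex X n) (ω : SingularSimplex X k → Γ)
    (m : ℕ) : tupleCochain X Γ σ k ((simplexSubdivision X Γ k)^[m] ω) =
      (subdivision Γ (tupleBarycenter n) k)^[m] (tupleCochain X Γ σ k ω) := by
  induction m with
  | zero => rfl
  | succ m ih => rw [iterate_succ_apply', iterate_succ_apply', tupleCochain_simplexSubdivision, ih]

/-- On a given simplex, the iterated subdivisions of a cochain that vanishes on small simplices
are eventually zero. -/
lemma VanishesOnSmall.exists_iterate_eq_zero (hUo : ∀ i, IsOpen (U i))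
    (hUc : ⋃ i, U i = Set.univ) {k n : ℕ} {ω : SingularSimplex X k → Γ}
    (hω : VanishesOnSmall U ω) (σ : SingularSimplex X n) :
    ∃ M, ∀ m ≥ M, tupleCochain X Γ σ k ((MTSpace.simplexSubdivision X Γ k)^[m] ω) = 0 := by
  obtain ⟨ε, hε, hεU⟩ := lebesgue_number_lemma_of_metric (s := (Set.univ : Set (Simplex n)))
    (c := fun i => σ ⁻¹' U i) isCompact_univ (fun i => (hUo i).preimage σ.continuous)
    (by rw [← Set.preimage_iUnion, hUc, Set.preimage_univ])
  have hk : (0 : ℝ) ≤ k := Nat.cast_nonneg k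
  have hr : (1 : ℝ) < (k + 2) / (k + 1) := by
    rw [lt_div_iff₀ (by positivity)]
    linarith
  -- After `M` subdivisions the admissible diameter exceeds `1`, a bound for all distances in the
  -- simplex. The radius `ε / 2` makes a closed ball fit into the open ball of the Lebesgue number.
  obtain ⟨M, hM⟩ := pow_unbounded_of_one_lt (1 / (ε / 2)) hr
  refine ⟨M, fun m hm => funext fun v => ?_⟩
  rw [tupleCochain_iterate]
  refine iterate_subdivision_eq_zero (ρ := ε / 2)
    (fun k v p r h => dist_affineSimplex_le_of_forall_le h _)
    (fun k v j r h => dist_tupleBarycenter_le j h) (by positivity) k _ ?_ m v ?_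
  · intro w hw
    obtain ⟨i, hi⟩ := hεU (w 0) (Set.mem_univ _)
    refine hω i _ fun x => hi ?_
    rw [Metric.mem_ball]
    exact (dist_affineSimplex_le_of_forall_le (fun l => hw l 0) x).trans_lt (by linarith)
  · intro i j
    refine (dist_simplex_le_one _ _).trans ?_
    rw [← div_le_iff₀ (by positivity)]
    exact hM.le.trans (pow_le_pow_right₀ hr.le hm)

end Small

end Raw

variable [MeasurableSpace X]

/-- A measurable family of simplices indexed by a probe, each in the leaf of the base point. -/
structure Probe.IsAdmissible (p : Probe X) {n : ℕ} (σ : p.carrier → SingularSimplex X n) :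
    Prop where
  measurable : IsMeasurableFamily σ
  mem_leaf : ∀ t x, σ t x ∈ leaf (p.base t)

lemma IsMeasurableFamily.comp_const {T : Type*} [MeasurableSpace T] {m n : ℕ}
    {σ : T → SingularSimplex X n} (hσ : IsMeasurableFamily σ) (f : C(Simplex m, Simplex n)) :
    IsMeasurableFamily fun t => (σ t).comp f :=
  Measurable.comp (g := fun p : Simplex n × T => σ p.2 p.1) hσ
    ((f.continuous.measurable.comp measurable_fst).prodMk measurable_snd)

lemma Probe.IsAdmissible.comp {p : Probe X} {m n : ℕ} {σ : p.carrier → SingularSimplex X n}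
    (hσ : p.IsAdmissible σ) (f : C(Simplex m, Simplex n)) :
    p.IsAdmissible fun t => (σ t).comp f :=
  ⟨hσ.measurable.comp_const f, fun t x => hσ.mem_leaf t (f x)⟩

/-- The simplex is compact and the preimage of `V` has open sections, so `measurableSet_forall_mem`
applies. The measurability of truncations, cones and least indices rests on this. -/
lemma IsMeasurableFamily.measurableSet_isInside {T : Type*} [MeasurableSpace T]
    [StandardBorelSpace T] {n : ℕ} {σ : T → SingularSimplex X n} (hσ : IsMeasurableFamily σ)
    {V : Set X} (hV : IsOpen V) (hVm : MeasurableSet V) : MeasurableSet {t | IsInside V (σ t)} := by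
  have : PolishSpace (Simplex n) := (isClosed_stdSimplex ℝ (Fin (n + 1))).polishSpace
  exact measurableSet_forall_mem (W := (fun p : Simplex n × T => σ p.2 p.1) ⁻¹' V) (hσ hVm)
    fun t => hV.preimage (σ t).continuous

variable (𝒞 : Set (Probe X)) (Γ : Type v) [AddCommGroup Γ] [MeasurableSpace Γ]
variable [MeasurableAdd₂ Γ] [MeasurableNeg Γ]

/-- The singular cochains that are measurable along the families indexed by a class of probes. -/
def ProbeCochain (n : ℕ) : AddSubgroup (SingularSimplex X n → Γ) where
  carrier := {ω | ∀ p ∈ 𝒞, ∀ σ : p.carrier → SingularSimplex X n, p.IsAdmissible σ →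
    Measurable fun t => ω (σ t)}
  zero_mem' := fun _ _ _ _ => measurable_const
  add_mem' := fun h h' p hp σ hσ => (h p hp σ hσ).add (h' p hp σ hσ)
  neg_mem' := fun h p hp σ hσ => (h p hp σ hσ).neg

variable {𝒞 Γ}

lemma simplexCoboundary_mem {n : ℕ} {ω : SingularSimplex X n → Γ} (hω : ω ∈ ProbeCochain 𝒞 Γ n) :
    simplexCoboundary X Γ n ω ∈ ProbeCochain 𝒞 Γ (n + 1) := fun p hp σ hσ => by
  simp only [simplexCoboundary_apply]
  exact Finset.measurable_fun_sum _ fun i _ =>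
    (hω p hp _ (hσ.comp (simplexMap i.succAbove))).const_smul ((-1 : ℤ) ^ (i : ℕ))

lemma simplexSubdivision_mem {n : ℕ} {ω : SingularSimplex X n → Γ}
    (hω : ω ∈ ProbeCochain 𝒞 Γ n) : simplexSubdivision X Γ n ω ∈ ProbeCochain 𝒞 Γ n :=
  fun p hp σ hσ => measurable_subdivision (tupleBarycenter n)
    (φ := fun t => tupleCochain X Γ (σ t) n ω)
    (fun w => hω p hp _ (hσ.comp (affineSimplex w))) (vertices n)

lemma simplexHomotopy_mem {n : ℕ} {ω : SingularSimplex X (n + 1) → Γ}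
    (hω : ω ∈ ProbeCochain 𝒞 Γ (n + 1)) : simplexHomotopy X Γ n ω ∈ ProbeCochain 𝒞 Γ n :=
  fun p hp σ hσ => measurable_subdivisionHomotopy (tupleBarycenter n)
    (φ := fun t => tupleCochain X Γ (σ t) (n + 1) ω)
    (fun w => hω p hp _ (hσ.comp (affineSimplex w))) (vertices n)

lemma iterate_simplexSubdivision_mem {n : ℕ} {ω : SingularSimplex X n → Γ}
    (hω : ω ∈ ProbeCochain 𝒞 Γ n) (m : ℕ) :
    (simplexSubdivision X Γ n)^[m] ω ∈ ProbeCochain 𝒞 Γ n := by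
  induction m with
  | zero => exact hω
  | succ m ih =>
    rw [iterate_succ_apply']
    exact simplexSubdivision_mem ih

/-- The values stabilize, so a preimage is the lower limit of the preimages; no topology on the
target is involved. -/
lemma measurable_of_eventually_eq {D E : Type*} [MeasurableSpace D] [MeasurableSpace E]
    {f : ℕ → D → E} (hf : ∀ n, Measurable (f n)) {g : D → E}
    (h : ∀ t, ∃ M, ∀ m ≥ M, f m t = g t) : Measurable g := by
  intro s hs
  have : g ⁻¹' s = ⋃ M, ⋂ m ∈ Set.Ici M, f m ⁻¹' s := by
    ext t
    obtain ⟨M, hM⟩ := h t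
    simp only [Set.mem_preimage, Set.mem_iUnion, Set.mem_iInter, Set.mem_Ici]
    constructor
    · exact fun ht => ⟨M, fun m hm => by rwa [hM m hm]⟩
    · rintro ⟨M', hM'⟩
      rw [← hM _ (le_max_left M M')]
      exact hM' _ (le_max_right M M')
  rw [this]
  exact MeasurableSet.iUnion fun M => MeasurableSet.biInter (Set.to_countable _) fun m _ => hf m hs

/-- The complex of cochains that vanish on small simplices is acyclic. -/
theorem exists_simplexCoboundary_eq {U : ℕ → Set X} (hUo : ∀ i, IsOpen (U i))
    (hUc : ⋃ i, U i = Set.univ) {n : ℕ} {ω : SingularSimplex X (n + 1) → Γ}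
    (hω : ω ∈ ProbeCochain 𝒞 Γ (n + 1)) (hs : VanishesOnSmall U ω)
    (hd : simplexCoboundary X Γ (n + 1) ω = 0) :
    ∃ η ∈ ProbeCochain 𝒞 Γ n, VanishesOnSmall U η ∧ simplexCoboundary X Γ n η = ω := by
  let S := fun m => (simplexSubdivision X Γ (n + 1))^[m] ω
  have hSd : ∀ m, simplexCoboundary X Γ (n + 1) (S m) = 0 := by
    intro m
    induction m with
    | zero => exact hd
    | succ m ih =>
      change simplexCoboundary X Γ (n + 1) ((simplexSubdivision X Γ (n + 1))^[m + 1] ω) = 0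
      rw [iterate_succ_apply', ← simplexSubdivision_simplexCoboundary]
      exact (congrArg _ ih).trans (map_zero _)
  have hSD : ∀ m, simplexCoboundary X Γ n (simplexHomotopy X Γ n (S m)) = S m - S (m + 1) := by
    intro m
    have := simplexHomotopy_add n (S m)
    rw [hSd, map_zero, zero_add] at this
    rw [this]
    congr 1
    exact (iterate_succ_apply' _ _ _).symm
  -- The primitive of `ω` is the sum of the homotopies of all the `S m`, whose coboundaries
  -- telescope. On each simplex it is a finite sum, but its length depends on the simplex.
  let P : ℕ → SingularSimplex X n → Γ := fun N => ∑ m ∈ Finset.range N, simplexHomotopy X Γ n (S m)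
  have hPd : ∀ N, simplexCoboundary X Γ n (P N) = ω - S N := by
    intro N
    simp only [P, map_sum, hSD, Finset.sum_range_sub']
    rfl
  have hM : ∀ σ : SingularSimplex X n, ∃ M, ∀ m ≥ M, simplexHomotopy X Γ n (S m) σ = 0 := by
    intro σ
    obtain ⟨M, hM⟩ := hs.exists_iterate_eq_zero hUo hUc σ
    refine ⟨M, fun m hm => ?_⟩
    change subdivisionHomotopy Γ _ n (tupleCochain X Γ σ (n + 1) (S m)) _ = 0
    rw [hM m hm, map_zero, Pi.zero_apply]
  choose M hM using hM
  let η : SingularSimplex X n → Γ := fun σ => P (M σ) σ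
  have hη : ∀ σ, ∀ N ≥ M σ, P N σ = η σ := by
    intro σ N hN
    simp only [η, P, Finset.sum_apply]
    exact Finset.eventually_constant_sum (hM σ) hN
  refine ⟨η, fun p hp σ hσ => ?_, fun i σ hσ => ?_, funext fun σ => ?_⟩
  · refine measurable_of_eventually_eq (f := fun N t => P N (σ t)) (fun N => ?_)
      fun t => ⟨M (σ t), hη (σ t)⟩
    exact AddSubgroup.sum_mem (ProbeCochain 𝒞 Γ n) (fun m _ =>
      simplexHomotopy_mem (iterate_simplexSubdivision_mem hω m)) p hp σ hσ
  · simp only [η, P, Finset.sum_apply]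
    exact Finset.sum_eq_zero fun m _ => (hs.iterate m).simplexHomotopy i σ hσ
  · obtain ⟨M', hM'⟩ := hs.exists_iterate_eq_zero hUo hUc σ
    -- At `N` the partial sums have stabilized on all faces of `σ`, and the remainder `S N` vanishes
    -- on `σ`.
    let N := M' + ∑ i : Fin (n + 2), M (σ.comp (simplexMap i.succAbove))
    have h1 : simplexCoboundary X Γ n η σ = simplexCoboundary X Γ n (P N) σ := by
      rw [simplexCoboundary_apply, simplexCoboundary_apply]
      refine Finset.sum_congr rfl fun i _ => ?_
      rw [hη _ N]
      have := Finset.single_le_sum (f := fun i : Fin (n + 2) =>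
        M (σ.comp (simplexMap i.succAbove))) (fun _ _ => Nat.zero_le _) (Finset.mem_univ i)
      exact le_add_left this
    have h2 : S N σ = 0 := by
      rw [← tupleCochain_vertices (S N) σ, hM' N (Nat.le_add_right _ _), Pi.zero_apply]
    rw [h1, hPd, Pi.sub_apply, h2, sub_zero]

end Cochains

end MTSpace

namespace MTSpace

/-! ### Homological algebra of double complexes. -/

section Algebra

/-- The coboundaries of a cochain complex of abelian groups. -/
def coboundaries {C : ℕ → Type w} [∀ n, AddCommGroup (C n)] (d : ∀ n, C n →+ C (n + 1)) :
    ∀ n, AddSubgroup (C n)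
  | 0 => ⊥
  | n + 1 => (d n).range

/-- The cohomology of a cochain complex of abelian groups, as cocycles modulo coboundaries. -/
abbrev Cohomology {C : ℕ → Type w} [∀ n, AddCommGroup (C n)] (d : ∀ n, C n →+ C (n + 1)) (n : ℕ) :
    Type w :=
  (d n).ker ⧸ (coboundaries d n).addSubgroupOf (d n).ker

/-- An additive relation between two groups that is total on both sides and matches two subgroups
induces an isomorphism of the quotients. -/
lemma nonempty_quotient_addEquiv_of_relation {G H : Type*} [AddCommGroup G] [AddCommGroup H]
    (P : AddSubgroup G) (Q : AddSubgroup H) (R : AddSubgroup (G × H))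
    (h1 : ∀ g, ∃ h, (g, h) ∈ R) (h2 : ∀ h, ∃ g, (g, h) ∈ R)
    (h3 : ∀ g h, (g, h) ∈ R → (g ∈ P ↔ h ∈ Q)) : Nonempty (G ⧸ P ≃+ H ⧸ Q) := by
  let f : R →+ G ⧸ P := (QuotientAddGroup.mk' P).comp ((AddMonoidHom.fst G H).comp R.subtype)
  let g : R →+ H ⧸ Q := (QuotientAddGroup.mk' Q).comp ((AddMonoidHom.snd G H).comp R.subtype)
  have hf : Function.Surjective f := by
    intro x
    obtain ⟨x, rfl⟩ := QuotientAddGroup.mk'_surjective P x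
    obtain ⟨y, hy⟩ := h1 x
    exact ⟨⟨_, hy⟩, rfl⟩
  have hg : Function.Surjective g := by
    intro y
    obtain ⟨y, rfl⟩ := QuotientAddGroup.mk'_surjective Q y
    obtain ⟨x, hx⟩ := h2 y
    exact ⟨⟨_, hx⟩, rfl⟩
  have hfg : f.ker = g.ker := by
    ext ⟨⟨x, y⟩, hr⟩
    simpa [AddMonoidHom.mem_ker, f, g] using h3 x y hr
  exact ⟨(QuotientAddGroup.quotientKerEquivOfSurjective f hf).symm.trans
    ((QuotientAddGroup.quotientAddEquivOfEq hfg).trans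
      (QuotientAddGroup.quotientKerEquivOfSurjective g hg))⟩

/-- The quotients of cocycles of two complexes are isomorphic as soon as there is an additive
relation between cochains, total on cocycles, that matches coboundaries. -/
lemma nonempty_cohomology_addEquiv_of_relation {C C' : ℕ → Type w} [∀ n, AddCommGroup (C n)]
    [∀ n, AddCommGroup (C' n)] {d : ∀ n, C n →+ C (n + 1)} {d' : ∀ n, C' n →+ C' (n + 1)}
    {m n : ℕ} (R : AddSubgroup (C m × C' n))
    (h1 : ∀ x, d m x = 0 → ∃ y, d' n y = 0 ∧ (x, y) ∈ R)
    (h2 : ∀ y, d' n y = 0 → ∃ x, d m x = 0 ∧ (x, y) ∈ R)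
    (h3 : ∀ x y, d m x = 0 → d' n y = 0 → (x, y) ∈ R →
      (x ∈ coboundaries d m ↔ y ∈ coboundaries d' n)) :
    Nonempty (Cohomology d m ≃+ Cohomology d' n) := by
  refine nonempty_quotient_addEquiv_of_relation _ _
    (R.comap (AddMonoidHom.prodMap (d m).ker.subtype (d' n).ker.subtype)) ?_ ?_ ?_
  · rintro ⟨x, hx⟩
    obtain ⟨y, hy, hxy⟩ := h1 x hx
    exact ⟨⟨y, hy⟩, hxy⟩
  · rintro ⟨y, hy⟩
    obtain ⟨x, hx, hxy⟩ := h2 y hy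
    exact ⟨⟨x, hx⟩, hxy⟩
  · rintro ⟨x, hx⟩ ⟨y, hy⟩ hxy
    exact h3 x y hx hy hxy

/-- A first quadrant double complex `A` with exact rows and columns, augmented by complexes `B`
and `F`, where `B` resolves up to an acyclic subcomplex. -/
structure IsBiresolution {B F : ℕ → Type w} {A : ℕ → ℕ → Type w} [∀ n, AddCommGroup (B n)]
    [∀ n, AddCommGroup (F n)] [∀ s n, AddCommGroup (A s n)]
    (dB : ∀ n, B n →+ B (n + 1)) (dF : ∀ n, F n →+ F (n + 1))
    (d : ∀ s n, A s n →+ A s (n + 1)) (δ : ∀ s n, A s n →+ A (s + 1) n)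
    (ε : ∀ n, B n →+ A 0 n) (ι : ∀ s, F s →+ A s 0) : Prop where
  dB_dB : ∀ n b, dB (n + 1) (dB n b) = 0
  d_d : ∀ s n a, d s (n + 1) (d s n a) = 0
  δ_δ : ∀ s n a, δ (s + 1) n (δ s n a) = 0
  d_δ : ∀ s n a, d (s + 1) n (δ s n a) = δ s (n + 1) (d s n a)
  δ_ε : ∀ n b, δ 0 n (ε n b) = 0
  d_ε : ∀ n b, d 0 n (ε n b) = ε (n + 1) (dB n b)
  d_ι : ∀ s f, d s 0 (ι s f) = 0
  δ_ι : ∀ s f, δ s 0 (ι s f) = ι (s + 1) (dF s f)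
  ι_injective : ∀ s f, ι s f = 0 → f = 0
  row_exact : ∀ s n a, δ (s + 1) n a = 0 → ∃ a', δ s n a' = a
  row_exact_zero : ∀ n a, δ 0 n a = 0 → ∃ b, ε n b = a
  column_exact : ∀ s n a, d s (n + 1) a = 0 → ∃ a', d s n a' = a
  column_exact_zero : ∀ s a, d s 0 a = 0 → ∃ f, ι s f = a
  kernel_acyclic : ∀ n b, ε (n + 1) b = 0 → dB (n + 1) b = 0 → ∃ c, ε n c = 0 ∧ dB n c = b
  kernel_zero : ∀ b, ε 0 b = 0 → b = 0

namespace IsBiresolution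

variable {B F : ℕ → Type w} {A : ℕ → ℕ → Type w} [∀ n, AddCommGroup (B n)]
    [∀ n, AddCommGroup (F n)] [∀ s n, AddCommGroup (A s n)]
    {dB : ∀ n, B n →+ B (n + 1)} {dF : ∀ n, F n →+ F (n + 1)}
    {d : ∀ s n, A s n →+ A s (n + 1)} {δ : ∀ s n, A s n →+ A (s + 1) n}
    {ε : ∀ n, B n →+ A 0 n} {ι : ∀ s, F s →+ A s 0}

/-- The differential of the complex of row cocycles in the column `s = 1`. -/
def rowCocycleDifferential (H : IsBiresolution dB dF d δ ε ι) (n : ℕ) :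
    (δ 1 n).ker →+ (δ 1 (n + 1)).ker :=
  ((d 1 n).comp (δ 1 n).ker.subtype).codRestrict _ fun a => by
    rw [AddMonoidHom.mem_ker, AddMonoidHom.comp_apply, ← H.d_δ,
      show δ 1 n ((δ 1 n).ker.subtype a) = 0 from a.2, map_zero]

/-- Dimension shifting: drop `s = 0` and augment by the row cocycles at `s = 1`. These embed in the
double complex, so the kernel conditions become trivial. -/
lemma shift (H : IsBiresolution dB dF d δ ε ι) :
    IsBiresolution H.rowCocycleDifferential (fun n => dF (n + 1)) (fun s n => d (s + 1) n)
      (fun s n => δ (s + 1) n) (fun n => (δ 1 n).ker.subtype) (fun s => ι (s + 1)) where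
  dB_dB n b := Subtype.ext (H.d_d 1 n b)
  d_d s := H.d_d (s + 1)
  δ_δ s := H.δ_δ (s + 1)
  d_δ s := H.d_δ (s + 1)
  δ_ε n b := b.2
  d_ε n b := rfl
  d_ι s := H.d_ι (s + 1)
  δ_ι s := H.δ_ι (s + 1)
  ι_injective s := H.ι_injective (s + 1)
  row_exact s := H.row_exact (s + 1)
  row_exact_zero n a ha := ⟨⟨a, ha⟩, rfl⟩
  column_exact s := H.column_exact (s + 1)
  column_exact_zero s := H.column_exact_zero (s + 1)
  kernel_acyclic n b hb _ := ⟨0, map_zero _, by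
    rw [map_zero]; exact (Subtype.ext hb : b = 0).symm⟩
  kernel_zero b hb := Subtype.ext hb

/-- If the image of a cochain is the boundary of the image, then so is the cochain. -/
lemma exists_dB_eq (H : IsBiresolution dB dF d δ ε ι) {n : ℕ} {b : B (n + 1)}
    (hb : dB (n + 1) b = 0) {b' : B n} (h : ε (n + 1) b = d 0 n (ε n b')) :
    ∃ c, dB n c = b := by
  obtain ⟨c, -, hc⟩ := H.kernel_acyclic n (b - dB n b')
    (by rw [map_sub, h, H.d_ε, sub_self]) (by rw [map_sub, hb, H.dB_dB, sub_self])
  exact ⟨b' + c, by rw [map_add, hc, add_sub_cancel]⟩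

/-- A cochain whose row coboundary is a cocycle bounds the image of a cocycle. -/
lemma exists_cocycle (H : IsBiresolution dB dF d δ ε ι) {n : ℕ} {a : A 0 n}
    (ha : d 1 n (δ 0 n a) = 0) : ∃ b, dB (n + 1) b = 0 ∧ ε (n + 1) b = d 0 n a := by
  obtain ⟨b, hb⟩ := H.row_exact_zero (n + 1) (d 0 n a) (by rw [← H.d_δ, ha])
  obtain ⟨c, hc, hcb⟩ := H.kernel_acyclic (n + 1) (dB (n + 1) b)
    (by rw [← H.d_ε, hb, H.d_d]) (H.dB_dB _ _)
  exact ⟨b - c, by rw [map_sub, hcb, sub_self], by rw [map_sub, hc, hb, sub_zero]⟩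

lemma ε_cocycle (H : IsBiresolution dB dF d δ ε ι) {n : ℕ} {b : B n} (hb : dB n b = 0) :
    d 0 n (ε n b) = 0 := by
  rw [H.d_ε, hb, map_zero]

lemma cohomology_zero (H : IsBiresolution dB dF d δ ε ι) :
    Nonempty (Cohomology dB 0 ≃+ Cohomology dF 0) := by
  refine nonempty_cohomology_addEquiv_of_relation
    (((ε 0).coprod (-(ι 0))).ker) ?_ ?_ ?_
  · intro b hb
    obtain ⟨f, hf⟩ := H.column_exact_zero 0 _ (H.ε_cocycle hb)
    refine ⟨f, H.ι_injective _ _ ?_, ?_⟩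
    · rw [← H.δ_ι, hf, H.δ_ε]
    · simp [AddMonoidHom.mem_ker, hf]
  · intro f hf
    obtain ⟨b, hb⟩ := H.row_exact_zero 0 (ι 0 f) (by rw [H.δ_ι, hf, map_zero])
    obtain ⟨c, hc, hcb⟩ := H.kernel_acyclic 0 (dB 0 b)
      (by rw [← H.d_ε, hb, H.d_ι]) (H.dB_dB _ _)
    obtain rfl := H.kernel_zero c hc
    exact ⟨b, by rw [← hcb, map_zero], by simp [AddMonoidHom.mem_ker, hb]⟩
  · intro b f _ _ h
    have h' : ε 0 b = ι 0 f := by simpa [AddMonoidHom.mem_ker, add_neg_eq_zero] using h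
    simp only [coboundaries, AddSubgroup.mem_bot]
    constructor
    · rintro rfl
      exact H.ι_injective _ _ (by rw [← h', map_zero])
    · rintro rfl
      exact H.kernel_zero _ (by rw [h', map_zero])

/-- The classes of `b` and `f` correspond when some `a` has `d a = ε b` and `δ a = ι f`. Shifting
down to degree zero would not do: there `coboundaries` is `⊥`, and the image of `dF 0` would be
lost. -/
lemma cohomology_one (H : IsBiresolution dB dF d δ ε ι) :
    Nonempty (Cohomology dB 1 ≃+ Cohomology dF 1) := by
  have hR : ∀ b f, (b, f) ∈ (((d 0 0).prod (δ 0 0)).range.comap ((ε 1).prodMap (ι 1))) ↔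
      ∃ a, d 0 0 a = ε 1 b ∧ δ 0 0 a = ι 1 f := by
    simp [AddMonoidHom.mem_range]
  refine nonempty_cohomology_addEquiv_of_relation
    (((d 0 0).prod (δ 0 0)).range.comap ((ε 1).prodMap (ι 1))) ?_ ?_ ?_
  · intro b hb
    obtain ⟨a, ha⟩ := H.column_exact 0 0 _ (H.ε_cocycle hb)
    obtain ⟨f, hf⟩ := H.column_exact_zero 1 (δ 0 0 a) (by rw [H.d_δ, ha, H.δ_ε])
    exact ⟨f, H.ι_injective _ _ (by rw [← H.δ_ι, hf, H.δ_δ]), (hR b f).2 ⟨a, ha, hf.symm⟩⟩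
  · intro f hf
    obtain ⟨a, ha⟩ := H.row_exact 0 0 (ι 1 f) (by rw [H.δ_ι, hf, map_zero])
    obtain ⟨b, hb, hba⟩ := H.exists_cocycle (a := a) (by rw [ha, H.d_ι])
    exact ⟨b, hb, (hR b f).2 ⟨a, hba.symm, ha⟩⟩
  · intro b f hb _ h
    obtain ⟨a, h1, h2⟩ := (hR b f).1 h
    constructor
    · rintro ⟨b', rfl⟩
      obtain ⟨f', hf'⟩ := H.column_exact_zero 0 (a - ε 0 b') (by
        rw [map_sub, h1, H.d_ε, sub_self])
      refine ⟨f', sub_eq_zero.1 (H.ι_injective _ _ ?_)⟩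
      rw [map_sub, ← H.δ_ι, hf', map_sub, H.δ_ε, h2, sub_zero, sub_self]
    · rintro ⟨f', rfl⟩
      obtain ⟨b', hb'⟩ := H.row_exact_zero 0 (a - ι 0 f') (by
        rw [map_sub, h2, H.δ_ι, sub_self])
      exact H.exists_dB_eq hb (b' := b') (by rw [hb', map_sub, H.d_ι, sub_zero, h1])

/-- The connecting map: solve `d a = ε b` at `s = 0` and send `b` to the row cocycle `δ a`. -/
lemma cohomology_shift (H : IsBiresolution dB dF d δ ε ι) (n : ℕ) :
    Nonempty (Cohomology dB (n + 2) ≃+ Cohomology H.rowCocycleDifferential (n + 1)) := by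
  have hR : ∀ b z, (b, z) ∈ (((d 0 (n + 1)).prod (δ 0 (n + 1))).range.comap
      ((ε (n + 2)).prodMap (δ 1 (n + 1)).ker.subtype)) ↔
      ∃ a, d 0 (n + 1) a = ε (n + 2) b ∧ δ 0 (n + 1) a = z := by
    simp [AddMonoidHom.mem_range]
  refine nonempty_cohomology_addEquiv_of_relation (((d 0 (n + 1)).prod (δ 0 (n + 1))).range.comap
    ((ε (n + 2)).prodMap (δ 1 (n + 1)).ker.subtype)) ?_ ?_ ?_
  · intro b hb
    obtain ⟨a, ha⟩ := H.column_exact 0 (n + 1) _ (H.ε_cocycle hb)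
    exact ⟨⟨δ 0 (n + 1) a, H.δ_δ _ _ _⟩, Subtype.ext ((H.d_δ _ _ _).trans
      (by rw [ha, H.δ_ε]; rfl)), (hR _ _).2 ⟨a, ha, rfl⟩⟩
  · rintro ⟨z, hz⟩ hdz
    obtain ⟨a, rfl⟩ := H.row_exact 0 (n + 1) z hz
    obtain ⟨b, hb, hba⟩ := H.exists_cocycle (a := a) (congrArg Subtype.val hdz)
    exact ⟨b, hb, (hR _ _).2 ⟨a, hba.symm, rfl⟩⟩
  · rintro b ⟨z, hz⟩ hb _ h
    obtain ⟨a, h1, h2⟩ := (hR _ _).1 h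
    subst h2
    constructor
    · rintro ⟨b', rfl⟩
      obtain ⟨a', ha'⟩ := H.column_exact 0 n (a - ε (n + 1) b') (by
        rw [map_sub, h1, H.d_ε, sub_self])
      refine ⟨⟨δ 0 n a', H.δ_δ _ _ _⟩, Subtype.ext ((H.d_δ _ _ _).trans ?_)⟩
      rw [ha', map_sub, H.δ_ε, sub_zero]
    · rintro ⟨⟨z', hz'⟩, h⟩
      obtain ⟨a', rfl⟩ := H.row_exact 0 n z' hz'
      have h' : d 1 n (δ 0 n a') = δ 0 (n + 1) a := congrArg Subtype.val h
      obtain ⟨b', hb'⟩ := H.row_exact_zero (n + 1) (a - d 0 n a') (by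
        rw [map_sub, ← H.d_δ, h', sub_self])
      exact H.exists_dB_eq hb (b' := b') (by rw [hb', map_sub, H.d_d, sub_zero, h1])

end IsBiresolution

/-- The two complexes that augment a biresolution have isomorphic cohomology. -/
theorem IsBiresolution.cohomology {B F : ℕ → Type w} {A : ℕ → ℕ → Type w}
    [∀ n, AddCommGroup (B n)] [∀ n, AddCommGroup (F n)] [∀ s n, AddCommGroup (A s n)]
    {dB : ∀ n, B n →+ B (n + 1)} {dF : ∀ n, F n →+ F (n + 1)}
    {d : ∀ s n, A s n →+ A s (n + 1)} {δ : ∀ s n, A s n →+ A (s + 1) n}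
    {ε : ∀ n, B n →+ A 0 n} {ι : ∀ s, F s →+ A s 0} (H : IsBiresolution dB dF d δ ε ι) (n : ℕ) :
    Nonempty (Cohomology dB n ≃+ Cohomology dF n) := by
  rcases n with _ | n
  · exact H.cohomology_zero
  induction n generalizing B F A with
  | zero => exact H.cohomology_one
  | succ n ih =>
    -- By definition, the cohomology of `fun n => dF (n + 1)` in degree `n + 1` is that of `dF` in
    -- degree `n + 2`, so `H.shift` has the right target.
    obtain ⟨e⟩ := H.cohomology_shift n
    obtain ⟨e'⟩ := ih H.shift
    exact ⟨e.trans e'⟩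

lemma nonempty_homology_iso_quotient (S : ShortComplex AddCommGrpCat.{w}) {C : Type w}
    [AddCommGroup C] (e : S.X₂ ≃+ C) (K P : AddSubgroup C)
    (hK : ∀ x, S.g x = 0 ↔ e x ∈ K) (hP : ∀ x, (∃ y, S.f y = x) ↔ e x ∈ P) :
    Nonempty (S.homology ≅ AddCommGrpCat.of (K ⧸ P.addSubgroupOf K)) := by
  obtain ⟨e'⟩ := nonempty_quotient_addEquiv_of_relation S.abToCycles.range (P.addSubgroupOf K)
    ((e.toAddMonoidHom.comp (AddMonoidHom.ker S.g.hom).subtype).coprod (-K.subtype)).ker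
    (fun x => ⟨⟨e x.1, (hK _).1 x.2⟩, by simp [AddMonoidHom.mem_ker]⟩)
    (fun y => ⟨⟨e.symm y.1, (hK _).2 (by simp)⟩, by simp [AddMonoidHom.mem_ker]⟩) (by
      rintro ⟨x, hx⟩ ⟨y, hy⟩ h
      obtain rfl : e x = y := by simpa [AddMonoidHom.mem_ker, add_neg_eq_zero] using h
      rw [AddSubgroup.mem_addSubgroupOf, ← hP, AddMonoidHom.mem_range]
      exact exists_congr fun z => Subtype.ext_iff)
  exact ⟨S.abHomologyIso ≪≫ e'.toAddCommGrpIso⟩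

/-- The homology of the cochain complex built from a sequence of homomorphisms. -/
lemma nonempty_homology_iso_cohomology {C : ℕ → Type w} [∀ n, AddCommGroup (C n)]
    (d : ∀ n, C n →+ C (n + 1))
    (hd : ∀ n, AddCommGrpCat.ofHom (d n) ≫ AddCommGrpCat.ofHom (d (n + 1)) = 0) (n : ℕ) :
    Nonempty ((CochainComplex.of (fun n => AddCommGrpCat.of (C n))
      (fun n => AddCommGrpCat.ofHom (d n)) hd).homology n ≅ AddCommGrpCat.of (Cohomology d n)) := by
  let Z := CochainComplex.of (fun n => AddCommGrpCat.of (C n))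
      (fun n => AddCommGrpCat.ofHom (d n)) hd
  have hZ : ∀ n, Z.d n (n + 1) = AddCommGrpCat.ofHom (d n) := fun n =>
    CochainComplex.of_d (fun n => AddCommGrpCat.of (C n)) (fun n => AddCommGrpCat.ofHom (d n)) n
  rcases n with _ | n
  · obtain ⟨e⟩ := nonempty_homology_iso_quotient (Z.sc' 0 0 1) (AddEquiv.refl (C 0)) (d 0).ker
      (coboundaries d 0) (fun x => by
        change Z.d 0 (0 + 1) x = 0 ↔ d 0 x = 0
        rw [hZ]
        rfl) (fun x => by
        change (∃ y, Z.d 0 0 y = x) ↔ x = 0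
        rw [Z.shape 0 0 (by simp)]
        exact ⟨fun ⟨_, h⟩ => h.symm, fun h => ⟨0, h.symm⟩⟩)
    exact ⟨Z.homologyIsoSc' 0 0 1 (by simp) (by simp) ≪≫ e⟩
  · obtain ⟨e⟩ := nonempty_homology_iso_quotient (Z.sc' n (n + 1) (n + 2))
      (AddEquiv.refl (C (n + 1))) (d (n + 1)).ker (coboundaries d (n + 1)) (fun x => by
        change Z.d (n + 1) (n + 1 + 1) x = 0 ↔ d (n + 1) x = 0
        rw [hZ]
        rfl) (fun x => by
        change (∃ y, Z.d n (n + 1) y = x) ↔ ∃ y, d n y = x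
        rw [hZ]
        rfl)
    exact ⟨Z.homologyIsoSc' n (n + 1) (n + 2) (by simp) (by simp) ≪≫ e⟩

end Algebra

end MTSpace

namespace MTSpace

open Function Set

/-! ### Cones of simplices along a leafwise contraction. -/

section Cone

/-- The parametrization of a simplex as the cone of its face opposite to the vertex `0`. -/
noncomputable def coneMap (n : ℕ) (p : Simplex n × unitInterval) : Simplex (n + 1) :=
  ⟨Fin.cons (p.2 : ℝ) fun i => (1 - (p.2 : ℝ)) * p.1 i, by
    refine ⟨fun i => ?_, ?_⟩
    · refine Fin.cases p.2.2.1 (fun i => ?_) i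
      exact mul_nonneg (sub_nonneg.2 p.2.2.2) (stdSimplex.zero_le p.1 i)
    · rw [Fin.sum_univ_succ]
      simp only [Fin.cons_zero, Fin.cons_succ]
      rw [← Finset.mul_sum, stdSimplex.sum_eq_one]
      ring⟩

@[simp]
lemma coneMap_zero {n : ℕ} (p : Simplex n × unitInterval) : coneMap n p 0 = p.2 := rfl

@[simp]
lemma coneMap_succ {n : ℕ} (p : Simplex n × unitInterval) (i : Fin (n + 1)) :
    coneMap n p i.succ = (1 - (p.2 : ℝ)) * p.1 i := rfl

lemma continuous_coneMap (n : ℕ) : Continuous (coneMap n) := by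
  refine Continuous.subtype_mk (continuous_pi fun i => ?_) _
  refine Fin.cases ?_ (fun i => ?_) i
  · exact continuous_subtype_val.comp continuous_snd
  · refine Continuous.mul (continuous_const.sub (continuous_subtype_val.comp continuous_snd)) ?_
    exact (continuous_apply i).comp (continuous_subtype_val.comp continuous_fst)

lemma simplex_sum_succ {n : ℕ} (x : Simplex (n + 1)) : ∑ i : Fin (n + 1), x i.succ = 1 - x 0 := by
  have := stdSimplex.sum_eq_one x
  rw [Fin.sum_univ_succ] at this
  linarith

/-- The projection of a simplex, minus the vertex `0`, to the opposite face. -/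
noncomputable def coneBase (n : ℕ) (x : Simplex (n + 1)) : Simplex n :=
  -- At the apex any point would do, since `coneMap` multiplies it by zero.
  ⟨fun i => if x 0 = 1 then (vertices n 0) i else x i.succ / (1 - x 0), by
    by_cases h : x 0 = 1
    · simp only [h, if_true]
      exact (vertices n 0).2
    · simp only [h, if_false]
      refine ⟨fun i => div_nonneg (stdSimplex.zero_le _ _)
        (sub_nonneg.2 (stdSimplex.le_one x 0)), ?_⟩
      rw [← Finset.sum_div, simplex_sum_succ, div_self (sub_ne_zero.2 (Ne.symm h))]⟩

/-- The barycentric coordinate at the vertex `0`. -/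
def coneHeight (n : ℕ) (x : Simplex (n + 1)) : unitInterval :=
  ⟨x 0, stdSimplex.zero_le x 0, stdSimplex.le_one x 0⟩

lemma measurable_simplex_apply {n : ℕ} (i : Fin (n + 1)) : Measurable fun x : Simplex n => x i :=
  (measurable_pi_apply i).comp measurable_subtype_coe

lemma measurable_coneBase (n : ℕ) : Measurable (coneBase n) := by
  refine Measurable.subtype_mk (measurable_pi_lambda _ fun i => ?_)
  exact Measurable.ite (measurable_simplex_apply 0 (measurableSet_singleton 1)) measurable_const
    ((measurable_simplex_apply i.succ).div (measurable_const.sub (measurable_simplex_apply 0)))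

lemma measurable_coneHeight (n : ℕ) : Measurable (coneHeight n) :=
  (measurable_simplex_apply 0).subtype_mk

lemma coneMap_coneBase {n : ℕ} (x : Simplex (n + 1)) :
    coneMap n (coneBase n x, coneHeight n x) = x := by
  ext i
  refine Fin.cases ?_ (fun i => ?_) i
  · rfl
  · rw [coneMap_succ]
    change (1 - x 0) * (if x 0 = 1 then (vertices n 0) i else x i.succ / (1 - x 0)) = x i.succ
    split_ifs with h
    · have h0 := simplex_sum_succ x
      rw [h, sub_self, Finset.sum_eq_zero_iff_of_nonneg fun i _ => stdSimplex.zero_le x _] at h0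
      rw [h, sub_self, zero_mul, h0 i (Finset.mem_univ i)]
    · rw [mul_div_cancel₀ _ (sub_ne_zero.2 (Ne.symm h))]

lemma coneBase_coneMap {n : ℕ} (y : Simplex n) (s : unitInterval) (hs : (s : ℝ) ≠ 1) :
    coneBase n (coneMap n (y, s)) = y := by
  ext i
  change (if coneMap n (y, s) 0 = 1 then (vertices n 0) i else
    coneMap n (y, s) i.succ / (1 - coneMap n (y, s) 0)) = y i
  rw [coneMap_zero, if_neg hs, coneMap_succ, mul_div_cancel_left₀ _ (sub_ne_zero.2 hs.symm)]

/-- A continuous surjection from a compact to a Hausdorff space. It reduces continuity on the cone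
to continuity on the cylinder. -/
lemma isQuotientMap_coneMap (n : ℕ) : Topology.IsQuotientMap (coneMap n) :=
  (continuous_coneMap n).isClosedMap.isQuotientMap (continuous_coneMap n)
    fun x => ⟨_, coneMap_coneBase x⟩

lemma simplexMap_apply {m n : ℕ} (f : Fin (m + 1) → Fin (n + 1)) (x : Simplex m)
    (j : Fin (n + 1)) : simplexMap f x j = ∑ i, if f i = j then x i else 0 := by
  change (FunOnFinite.linearMap ℝ ℝ f x) j = _
  rw [FunOnFinite.linearMap_apply_apply, Finset.sum_filter]

lemma simplexMap_succAbove_zero {n : ℕ} (y : Simplex n) :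
    simplexMap (0 : Fin (n + 2)).succAbove y = coneMap n (y, 0) := by
  ext j
  rw [simplexMap_apply]
  refine Fin.cases ?_ (fun j => ?_) j
  · simp
  · simp

lemma simplexMap_succAbove_succ {n : ℕ} (j : Fin (n + 2)) (y : Simplex n) (s : unitInterval) :
    simplexMap j.succ.succAbove (coneMap n (y, s)) =
      coneMap (n + 1) (simplexMap j.succAbove y, s) := by
  ext l
  rw [simplexMap_apply, Fin.sum_univ_succ]
  refine Fin.cases ?_ (fun l => ?_) l
  · simp
  · rw [coneMap_succ, simplexMap_apply, Finset.mul_sum]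
    simp only [Fin.succ_succAbove_zero, Fin.succ_succAbove_succ, Fin.succ_inj, mul_ite, mul_zero,
      coneMap_succ, (Fin.succ_ne_zero l).symm, if_false, zero_add]

lemma simplexMap_one_succAbove (y : Simplex 0) :
    simplexMap (1 : Fin 2).succAbove y = coneMap 0 (y, 1) := by
  ext l
  rw [simplexMap_apply, Fin.sum_univ_succ]
  have h : y 0 = 1 := stdSimplex.eq_one_of_unique (X := Fin 1) y 0
  refine Fin.cases ?_ (fun l => ?_) l
  · simp [h]
  · simp [(Fin.succ_ne_zero l).symm]

/-- Cones along a leafwise contraction of `V`: every simplex of `V` is the face opposite to the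
vertex `0` of its cone, and the other faces are the cones of its faces. -/
lemma IsMeasurablyContractible.exists_cone {X : Type u} [TopologicalSpace X] [MeasurableSpace X]
    {V : Set X} (hV : IsMeasurablyContractible V) (hVo : IsOpen V) (hVm : MeasurableSet V) :
    ∃ (r : V → V) (K : ∀ n, SingularSimplex X n → SingularSimplex X (n + 1)),
      (Measurable r ∧ (∀ x y : V, y ∈ leaf x → r y = r x) ∧ ∀ x, r x ∈ leaf x) ∧
      (∀ n σ, IsInside V σ → IsInside V (K n σ)) ∧
      (∀ n σ, IsInside V σ → (K n σ).comp (simplexMap (0 : Fin (n + 2)).succAbove) = σ) ∧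
      (∀ n σ, IsInside V σ → ∀ j : Fin (n + 2), (K (n + 1) σ).comp (simplexMap j.succ.succAbove) =
        K n (σ.comp (simplexMap j.succAbove))) ∧
      (∀ (σ : SingularSimplex X 0) (h : IsInside V σ),
        (K 0 σ).comp (simplexMap (1 : Fin 2).succAbove) =
          ContinuousMap.const _ (r ⟨σ (vertices 0 0), h _⟩ : X)) ∧
      ∀ (p : Probe X) n (σ : p.carrier → SingularSimplex X n), p.IsAdmissible σ →
        p.IsAdmissible fun t => K n (σ t) := by
  classical
  obtain ⟨H, hH, hH0, hH1⟩ := hV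
  have hleaf : ∀ {n} (σ : SingularSimplex X n) (h : IsInside V σ) (y y' : Simplex n),
      (⟨σ y', h y'⟩ : V) ∈ leaf (⟨σ y, h y⟩ : V) := by
    intro n σ h y y'
    exact (isPreconnected_range (f := fun y => (⟨σ y, h y⟩ : V))
      (σ.continuous.subtype_mk _)).subset_connectedComponent ⟨y, rfl⟩ ⟨y', rfl⟩
  have hpath : ∀ (x : V) s, H (x, s) ∈ leaf x := by
    intro x s
    exact (isPreconnected_range (f := fun s => H (x, s)) (hH.continuous.comp
      (Continuous.prodMk_right x))).subset_connectedComponent ⟨0, hH0 x⟩ ⟨s, rfl⟩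
  -- The height in the cone is the time of the homotopy. The arbitrary base point at the apex is
  -- harmless: `σ` lies in one leaf of `V`, and the homotopy ends at a single point for that leaf.
  let c : ∀ {n} (σ : SingularSimplex X n), IsInside V σ → Simplex (n + 1) → X :=
    fun {n} σ h x => H (⟨σ (coneBase n x), h _⟩, coneHeight n x)
  have hc : ∀ {n} (σ : SingularSimplex X n) (h : IsInside V σ) y s,
      c σ h (coneMap n (y, s)) = H (⟨σ y, h y⟩, s) := by
    intro n σ h y s
    have hs : coneHeight n (coneMap n (y, s)) = s := rfl
    by_cases h1 : (s : ℝ) = 1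
    · obtain rfl : s = 1 := Subtype.ext h1
      exact congrArg Subtype.val (hH1 _ _ (hleaf σ h y _))
    · simp only [c, hs, coneBase_coneMap y s h1]
  have hcc : ∀ {n} (σ : SingularSimplex X n) (h : IsInside V σ), Continuous (c σ h) := by
    intro n σ h
    refine (isQuotientMap_coneMap n).continuous_iff.2 ?_
    have : c σ h ∘ coneMap n = fun p => (H (⟨σ p.1, h p.1⟩, p.2) : X) :=
      funext fun p => hc σ h p.1 p.2
    rw [this]
    exact continuous_subtype_val.comp (hH.continuous.comp
      (((σ.continuous.comp continuous_fst).subtype_mk _).prodMk continuous_snd))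
  -- A simplex not contained in `V` gets the constant simplex at its vertex `0`, which keeps
  -- families measurable and in the prescribed leaves.
  let K : ∀ n, SingularSimplex X n → SingularSimplex X (n + 1) := fun n σ =>
    if h : IsInside V σ then ⟨c σ h, hcc σ h⟩ else σ.comp (simplexMap fun _ => 0)
  have hK : ∀ {n} (σ : SingularSimplex X n) (h : IsInside V σ) y s,
      K n σ (coneMap n (y, s)) = H (⟨σ y, h y⟩, s) := by
    intro n σ h y s
    simp only [K, dif_pos h]
    exact hc σ h y s
  refine ⟨fun x => H (x, 1), K, ⟨hH.measurable.comp (measurable_id.prodMk measurable_const),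
    hH1, fun x => hpath x 1⟩, ?_, ?_, ?_, ?_, ?_⟩
  · intro n σ h x
    rw [← coneMap_coneBase x, hK σ h]
    exact Subtype.coe_prop _
  · intro n σ h
    ext y
    change K n σ (simplexMap (0 : Fin (n + 2)).succAbove y) = σ y
    rw [simplexMap_succAbove_zero, hK σ h, hH0]
  · intro n σ h j
    ext x
    change K (n + 1) σ (simplexMap j.succ.succAbove x) = _
    rw [← coneMap_coneBase x, simplexMap_succAbove_succ, hK σ h, hK _ (h.comp _)]
    rfl
  · intro σ h
    ext y
    change K 0 σ (simplexMap (1 : Fin 2).succAbove y) = _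
    rw [simplexMap_one_succAbove, hK σ h,
      Subsingleton.elim (α := stdSimplex ℝ (Fin 1)) y (vertices 0 0)]
    rfl
  · intro p n σ hσ
    have hbase : Measurable fun q : Simplex (n + 1) × p.carrier => σ q.2 (coneBase n q.1) :=
      Measurable.comp (g := fun q : Simplex n × p.carrier => σ q.2 q.1) hσ.measurable
        (((measurable_coneBase n).comp measurable_fst).prodMk measurable_snd)
    refine ⟨?_, fun t x => ?_⟩
    · let s : Set (Simplex (n + 1) × p.carrier) := {q | IsInside V (σ q.2)}
      have hs : MeasurableSet s :=
        measurable_snd (hσ.measurable.measurableSet_isInside hVo hVm)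
      have h1 : Measurable fun q : s => c (σ q.1.2) q.2 q.1.1 :=
        measurable_subtype_coe.comp (hH.measurable.comp
          (((hbase.comp measurable_subtype_coe).subtype_mk).prodMk
            ((measurable_coneHeight n).comp (measurable_fst.comp measurable_subtype_coe))))
      have h2 : Measurable fun q : (sᶜ : Set (Simplex (n + 1) × p.carrier)) =>
          (σ q.1.2).comp (simplexMap fun _ => 0) q.1.1 :=
        Measurable.comp (g := fun q : Simplex (n + 1) × p.carrier =>
          (σ q.2).comp (simplexMap fun _ => 0) q.1) (hσ.measurable.comp_simplexMap _)
          measurable_subtype_coe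
      refine (congrArg Measurable (funext fun q => ?_)).mpr (Measurable.dite h1 h2 hs)
      by_cases h : IsInside V (σ q.2)
      · have h' : q ∈ s := h
        rw [dif_pos h']
        simp only [K, dif_pos h]
        rfl
      · have h' : q ∉ s := h
        rw [dif_neg h']
        simp only [K, dif_neg h]
    · by_cases h : IsInside V (σ t)
      · rw [← coneMap_coneBase x, hK _ h]
        have h1 := (continuous_subtype_val (p := (· ∈ V))).image_connectedComponent_subset
          (⟨σ t (coneBase n x), h _⟩ : V) ⟨_, hpath _ (coneHeight n x), rfl⟩
        have h2 := hσ.mem_leaf t (coneBase n x)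
        unfold leaf at h2 ⊢
        rwa [connectedComponent_eq h2]
      · simp only [K, dif_neg h]
        exact hσ.mem_leaf t _

end Cone

end MTSpace

namespace MTSpace

open Function Set

/-! ### The double complex of cochains supported in intersections of the cover. -/

section Local

/-- The intersection of the members of the covering given by a tuple of indices. -/
abbrev cap {X : Type u} (U : ℕ → Set X) {s : ℕ} (i : Fin (s + 1) → ℕ) : Set X := ⋂ k, U (i k)

lemma cap_subset {X : Type u} {U : ℕ → Set X} {s t : ℕ} (i : Fin (s + 1) → ℕ)
    (f : Fin (t + 1) → Fin (s + 1)) :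
    cap U i ⊆ cap U (i ∘ f) :=
  subset_iInter fun k => iInter_subset (fun k => U (i k)) (f k)

lemma isOpen_cap {X : Type u} [TopologicalSpace X] {U : ℕ → Set X}
    (hUo : ∀ n, IsOpen (U n)) {s : ℕ}
    (i : Fin (s + 1) → ℕ) : IsOpen (cap U i) :=
  isOpen_iInter_of_finite fun _ => hUo _

lemma measurableSet_cap {X : Type u} [MeasurableSpace X] {U : ℕ → Set X}
    (hUm : ∀ n, MeasurableSet (U n)) {s : ℕ} (i : Fin (s + 1) → ℕ) :
    MeasurableSet (cap U i) := MeasurableSet.iInter fun _ => hUm _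

variable {X : Type u} [TopologicalSpace X]

open scoped Classical in
/-- The restriction of a cochain to the simplices in `V`, extended by zero. -/
noncomputable def truncate {Γ : Type v} [AddCommGroup Γ] (V : Set X) (n : ℕ) :
    (SingularSimplex X n → Γ) →+ (SingularSimplex X n → Γ) where
  toFun ω σ := if IsInside V σ then ω σ else 0
  map_zero' := by ext; simp
  map_add' φ ψ := by ext σ; by_cases h : IsInside V σ <;> simp [h]

lemma isInside_zero_iff {V : Set X} {σ : SingularSimplex X 0} :
    IsInside V σ ↔ σ (vertices 0 0) ∈ V :=
  ⟨fun h => h _, fun h x => by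
    rwa [Subsingleton.elim (α := stdSimplex ℝ (Fin 1)) x (vertices 0 0)]⟩

lemma eq_const (σ : SingularSimplex X 0) : σ = ContinuousMap.const _ (σ (vertices 0 0)) := by
  ext x
  rw [Subsingleton.elim (α := stdSimplex ℝ (Fin 1)) x (vertices 0 0)]
  rfl

section Raw

variable {Γ : Type v} [AddCommGroup Γ] {V W : Set X} {n : ℕ}

lemma truncate_of_isInside {σ : SingularSimplex X n} (h : IsInside V σ)
    (ω : SingularSimplex X n → Γ) : truncate V n ω σ = ω σ := if_pos h

lemma truncate_of_not_isInside {σ : SingularSimplex X n} (h : ¬ IsInside V σ)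
    (ω : SingularSimplex X n → Γ) : truncate V n ω σ = 0 := if_neg h

lemma truncate_simplexCoboundary_truncate (h : V ⊆ W) (ω : SingularSimplex X n → Γ) :
    truncate V (n + 1) (simplexCoboundary X Γ n (truncate W n ω)) =
      truncate V (n + 1) (simplexCoboundary X Γ n ω) := by
  funext σ
  by_cases hσ : IsInside V σ
  · rw [truncate_of_isInside hσ, truncate_of_isInside hσ, simplexCoboundary_apply,
      simplexCoboundary_apply]
    exact Finset.sum_congr rfl fun i _ => by rw [truncate_of_isInside ((hσ.comp _).mono h)]
  · rw [truncate_of_not_isInside hσ, truncate_of_not_isInside hσ]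

end Raw

variable [MeasurableSpace X]
variable (𝒞 : Set (Probe X)) (Γ : Type v) [AddCommGroup Γ] [MeasurableSpace Γ]
variable [MeasurableAdd₂ Γ] [MeasurableNeg Γ]

/-- The measurable cochains supported on the simplices in `V`. -/
def LocalCochain (V : Set X) (n : ℕ) : AddSubgroup (SingularSimplex X n → Γ) where
  carrier := {ω | ω ∈ ProbeCochain 𝒞 Γ n ∧ ∀ σ, ¬ IsInside V σ → ω σ = 0}
  zero_mem' := ⟨zero_mem _, fun _ _ => rfl⟩
  add_mem' := fun h h' => ⟨add_mem h.1 h'.1, fun σ hσ => by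
    rw [Pi.add_apply, h.2 σ hσ, h'.2 σ hσ, add_zero]⟩
  neg_mem' := fun h => ⟨neg_mem h.1, fun σ hσ => by rw [Pi.neg_apply, h.2 σ hσ, neg_zero]⟩

variable {𝒞 Γ}

lemma truncate_mem {V : Set X} (hV : IsOpen V) (hVm : MeasurableSet V) {n : ℕ}
    {ω : SingularSimplex X n → Γ} (hω : ω ∈ ProbeCochain 𝒞 Γ n) :
    truncate V n ω ∈ LocalCochain 𝒞 Γ V n :=
  ⟨fun p hp σ hσ => Measurable.ite (hσ.measurable.measurableSet_isInside hV hVm) (hω p hp σ hσ)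
    measurable_const, fun _ hσ => truncate_of_not_isInside hσ ω⟩

variable (𝒞 Γ) (U : ℕ → Set X)

/-- The double complex of local cochains. -/
abbrev LocalCochains (s n : ℕ) : Type (max u v) :=
  ∀ i : Fin (s + 1) → ℕ, LocalCochain 𝒞 Γ (cap U i) n

variable {U}

variable (hUo : ∀ n, IsOpen (U n)) (hUm : ∀ n, MeasurableSet (U n))

/-- The coboundary of global cochains. -/
noncomputable def probeCoboundary (n : ℕ) : ProbeCochain 𝒞 Γ n →+ ProbeCochain 𝒞 Γ (n + 1) :=
  ((simplexCoboundary X Γ n).comp (ProbeCochain 𝒞 Γ n).subtype).codRestrict _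
    fun ω => simplexCoboundary_mem ω.2

/-- The singular coboundary of local cochains. -/
noncomputable def localCoboundary (s n : ℕ) :
    LocalCochains 𝒞 Γ U s n →+ LocalCochains 𝒞 Γ U s (n + 1) where
  toFun f i := ⟨truncate (cap U i) (n + 1) (simplexCoboundary X Γ n (f i).1),
    truncate_mem (isOpen_cap hUo i) (measurableSet_cap hUm i) (simplexCoboundary_mem (f i).2.1)⟩
  map_zero' := by funext i; apply Subtype.ext; simp
  map_add' f g := by funext i; apply Subtype.ext; simp

/-- The Čech coboundary of local cochains. -/
noncomputable def localCechCoboundary (s n : ℕ) :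
    LocalCochains 𝒞 Γ U s n →+ LocalCochains 𝒞 Γ U (s + 1) n where
  toFun f i := ⟨truncate (cap U i) n
      (∑ j : Fin (s + 2), (-1 : ℤ) ^ (j : ℕ) • (f (i ∘ j.succAbove)).1),
    truncate_mem (isOpen_cap hUo i) (measurableSet_cap hUm i)
      (sum_mem fun j _ => zsmul_mem (f (i ∘ j.succAbove)).2.1 _)⟩
  map_zero' := by funext i; apply Subtype.ext; simp
  map_add' f g := by
    funext i
    apply Subtype.ext
    simp [Finset.sum_add_distrib]

/-- The restrictions of a global cochain to the members of the covering. -/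
noncomputable def localRestriction (n : ℕ) : ProbeCochain 𝒞 Γ n →+ LocalCochains 𝒞 Γ U 0 n where
  toFun ω i := ⟨truncate (cap U i) n ω.1,
    truncate_mem (isOpen_cap hUo i) (measurableSet_cap hUm i) ω.2⟩
  map_zero' := by funext i; apply Subtype.ext; simp
  map_add' f g := by funext i; apply Subtype.ext; simp

variable {𝒞 Γ}

open scoped Classical in
/-- The cochain on points given by a map on `V`. -/
noncomputable def pointCochain {V : Set X} (f : V → Γ) (σ : SingularSimplex X 0) : Γ :=
  if h : σ (vertices 0 0) ∈ V then f ⟨σ (vertices 0 0), h⟩ else 0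

lemma IsMeasurableFamily.apply {T : Type*} [MeasurableSpace T] {n : ℕ}
    {σ : T → SingularSimplex X n} (hσ : IsMeasurableFamily σ) (x : Simplex n) :
    Measurable fun t => σ t x :=
  Measurable.comp (g := fun p : Simplex n × T => σ p.2 p.1) hσ
    (measurable_const.prodMk measurable_id)

lemma pointCochain_mem {V : Set X} (hVm : MeasurableSet V) {f : V → Γ} (hf : Measurable f) :
    pointCochain f ∈ LocalCochain 𝒞 Γ V 0 := by
  classical
  refine ⟨fun p hp σ hσ => ?_, fun σ hσ => dif_neg fun h => hσ (isInside_zero_iff.2 h)⟩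
  have hv := hσ.measurable.apply (vertices 0 0)
  exact Measurable.dite (s := {t | σ t (vertices 0 0) ∈ V})
    (f := fun t => f ⟨σ t.1 (vertices 0 0), t.2⟩) (g := fun _ => (0 : Γ))
    (hf.comp (hv.comp measurable_subtype_coe).subtype_mk) measurable_const (hv hVm)

variable (𝒞 Γ)

/-- The local cochains given by the Čech cochains. -/
noncomputable def cechInclusion (s : ℕ) : CechCochain Γ U s →+ LocalCochains 𝒞 Γ U s 0 where
  toFun f i := ⟨pointCochain (f i).1, pointCochain_mem (measurableSet_cap hUm i) (f i).2.1⟩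
  map_zero' := by
    funext i; apply Subtype.ext; funext σ
    by_cases h : σ (vertices 0 0) ∈ cap U i <;> simp [pointCochain, h]
  map_add' f g := by
    funext i; apply Subtype.ext; funext σ
    by_cases h : σ (vertices 0 0) ∈ cap U i <;> simp [pointCochain, h]

/-- The measurability of leafwise constant maps on `V` is detected by the probes. -/
def DetectsMeasurability (V : Set X) : Prop :=
  ∀ ω ∈ ProbeCochain 𝒞 Γ 0,
    (∀ x y : V, y ∈ leaf x →
      ω (ContinuousMap.const _ (y : X)) = ω (ContinuousMap.const _ (x : X))) →
    Measurable fun x : V => ω (ContinuousMap.const _ (x : X))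

variable {𝒞 Γ}

lemma localCoboundary_apply {s n : ℕ} (f : LocalCochains 𝒞 Γ U s n) {i : Fin (s + 1) → ℕ}
    {σ : SingularSimplex X (n + 1)} (h : IsInside (cap U i) σ) :
    (localCoboundary 𝒞 Γ hUo hUm s n f i).1 σ = simplexCoboundary X Γ n (f i).1 σ :=
  truncate_of_isInside h _

lemma localCechCoboundary_apply {s n : ℕ} (f : LocalCochains 𝒞 Γ U s n) {i : Fin (s + 2) → ℕ}
    {σ : SingularSimplex X n} (h : IsInside (cap U i) σ) :
    (localCechCoboundary 𝒞 Γ hUo hUm s n f i).1 σ =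
      ∑ j : Fin (s + 2), (-1 : ℤ) ^ (j : ℕ) • (f (i ∘ j.succAbove)).1 σ := by
  refine (truncate_of_isInside h _).trans ?_
  simp only [Finset.sum_apply, Pi.smul_apply]

lemma localRestriction_apply {n : ℕ} (ω : ProbeCochain 𝒞 Γ n) {i : Fin 1 → ℕ}
    {σ : SingularSimplex X n} (h : IsInside (cap U i) σ) :
    (localRestriction 𝒞 Γ hUo hUm n ω i).1 σ = ω.1 σ := truncate_of_isInside h _

lemma cechInclusion_apply {s : ℕ} (f : CechCochain Γ U s) {i : Fin (s + 1) → ℕ}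
    {σ : SingularSimplex X 0} (h : IsInside (cap U i) σ) :
    (cechInclusion 𝒞 Γ hUm s f i).1 σ = (f i).1 ⟨σ (vertices 0 0), h _⟩ := dif_pos (h _)

/-- Local cochains are equal if they agree on the simplices in the intersections. -/
lemma LocalCochains.ext {s n : ℕ} {f g : LocalCochains 𝒞 Γ U s n}
    (h : ∀ i σ, IsInside (cap U i) σ → (f i).1 σ = (g i).1 σ) : f = g := by
  funext i
  apply Subtype.ext
  funext σ
  by_cases hσ : IsInside (cap U i) σ
  · exact h i σ hσ
  · rw [(f i).2.2 σ hσ, (g i).2.2 σ hσ]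

end Local

end MTSpace

namespace MTSpace

open Function Set

/-! ### Exactness of the rows and columns. -/

section Resolution

variable {X : Type u} [TopologicalSpace X] [MeasurableSpace X]
variable {𝒞 : Set (Probe X)} {Γ : Type v} [AddCommGroup Γ] [MeasurableSpace Γ]
variable [MeasurableAdd₂ Γ] [MeasurableNeg Γ]
variable {U : ℕ → Set X} (hUo : ∀ n, IsOpen (U n)) (hUm : ∀ n, MeasurableSet (U n))

include hUo hUm

section Rows

open scoped Classical in
/-- The least index of a member of the covering that contains a simplex. -/
noncomputable def smallIndex (U : ℕ → Set X) {n : ℕ} (σ : SingularSimplex X n) : ℕ :=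
  sInf {j | IsInside (U j) σ}

omit hUo hUm [MeasurableSpace X] in
lemma isInside_smallIndex {n : ℕ} {σ : SingularSimplex X n} {j : ℕ} (h : IsInside (U j) σ) :
    IsInside (U (smallIndex U σ)) σ :=
  Nat.sInf_mem (s := {j | IsInside (U j) σ}) ⟨j, h⟩

lemma measurable_smallIndex {T : Type*} [MeasurableSpace T] [StandardBorelSpace T] {n : ℕ}
    {σ : T → SingularSimplex X n} (hσ : IsMeasurableFamily σ) :
    Measurable fun t => smallIndex U (σ t) := by
  classical
  have hm : ∀ j, MeasurableSet {t | IsInside (U j) (σ t)} := fun j =>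
    hσ.measurableSet_isInside (hUo j) (hUm j)
  -- The second alternative makes the search succeed for every `t`. Simplices in no member of the
  -- cover get index `0`, in agreement with `sInf ∅ = 0`.
  have hex : ∀ t, ∃ j, IsInside (U j) (σ t) ∨ ∀ k, ¬ IsInside (U k) (σ t) := by
    intro t
    by_cases h : ∃ k, IsInside (U k) (σ t)
    · exact h.imp fun _ => Or.inl
    · exact ⟨0, Or.inr (not_exists.1 h)⟩
  refine (congrArg Measurable (funext fun t => ?_)).mpr (measurable_find hex fun j => (hm j).union
    ((MeasurableSet.iInter fun k => (hm k).compl).congr ?_))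
  · by_cases h : ∃ k, IsInside (U k) (σ t)
    · have hex' : ∃ k, k ∈ {j | IsInside (U j) (σ t)} := h
      rw [smallIndex, Nat.sInf_def hex']
      refine Nat.find_congr' fun {k} => ?_
      exact ⟨Or.inl, fun h' => h'.resolve_right (not_forall_not.2 h)⟩
    · have he : {j | IsInside (U j) (σ t)} = ∅ := eq_empty_of_forall_notMem (not_exists.1 h)
      rw [smallIndex, he, Nat.sInf_empty]
      exact ((Nat.find_eq_zero _).2 (Or.inr (not_exists.1 h))).symm
  · ext t
    exact mem_iInter

omit hUo hUm [TopologicalSpace X] [MeasurableSpace X] in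
lemma cap_cons {s : ℕ} (j : ℕ) (i : Fin (s + 1) → ℕ) :
    cap U (Fin.cons j i : Fin (s + 2) → ℕ) = U j ∩ cap U i := by
  ext x
  simp [cap, Fin.forall_fin_succ]

omit hUo hUm in
lemma localCochain_congr {s n : ℕ} (f : LocalCochains 𝒞 Γ U s n) {i i' : Fin (s + 1) → ℕ}
    (h : i = i') (σ : SingularSimplex X n) : (f i).1 σ = (f i').1 σ := by rw [h]

/-- The contraction of the rows: evaluation at the least member containing a simplex. -/
lemma row_contraction_mem {s n : ℕ} (f : LocalCochains 𝒞 Γ U (s + 1) n) (i : Fin (s + 1) → ℕ) :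
    (fun σ => (f (Fin.cons (smallIndex U σ) i)).1 σ) ∈ LocalCochain 𝒞 Γ (cap U i) n := by
  refine ⟨fun p hp σ hσ => ?_, fun σ hσ => (f _).2.2 σ fun h => hσ (h.mono ?_)⟩
  · have h1 : Measurable fun q : ℕ × p.carrier => (f (Fin.cons q.1 i)).1 (σ q.2) :=
      measurable_from_prod_countable_right fun j => (f (Fin.cons j i)).2.1 p hp σ hσ
    exact h1.comp ((measurable_smallIndex hUo hUm hσ.measurable).prodMk measurable_id)
  · rw [cap_cons]
    exact inter_subset_right

lemma row_exact {s n : ℕ} (f : LocalCochains 𝒞 Γ U (s + 1) n)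
    (hf : localCechCoboundary 𝒞 Γ hUo hUm (s + 1) n f = 0) :
    ∃ g, localCechCoboundary 𝒞 Γ hUo hUm s n g = f := by
  -- The cocycle identity at `Fin.cons (smallIndex U σ) i` expresses the value of `f i` at `σ` as
  -- the coboundary of this witness. The prepended index depends only on `σ`, which the Čech
  -- coboundary leaves unchanged.
  refine ⟨fun i => ⟨_, row_contraction_mem hUo hUm f i⟩, LocalCochains.ext fun i σ hσ => ?_⟩
  rw [localCechCoboundary_apply hUo hUm _ hσ]
  have hU := isInside_smallIndex (hσ.mono (iInter_subset _ 0))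
  have hσ' : IsInside (cap U (Fin.cons (smallIndex U σ) i : Fin (s + 3) → ℕ)) σ := by
    rw [cap_cons]
    exact fun x => ⟨hU x, hσ x⟩
  have h := localCechCoboundary_apply hUo hUm f hσ'
  rw [hf, Fin.sum_univ_succ] at h
  simp only [Fin.val_zero, pow_zero, one_smul, Fin.val_succ, pow_succ, mul_neg, mul_one, neg_smul,
    Finset.sum_neg_distrib, localCochain_congr f (cons_comp_succAbove_zero _ i),
    localCochain_congr f (cons_comp_succAbove_succ _ i _)] at h
  exact (eq_of_sub_eq_zero ((sub_eq_add_neg _ _).trans h.symm)).symm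

lemma row_exact_zero {n : ℕ} (f : LocalCochains 𝒞 Γ U 0 n)
    (hf : localCechCoboundary 𝒞 Γ hUo hUm 0 n f = 0) :
    ∃ ω, localRestriction 𝒞 Γ hUo hUm n ω = f := by
  refine ⟨⟨fun σ => (f fun _ => smallIndex U σ).1 σ, fun p hp σ hσ => ?_⟩,
    LocalCochains.ext fun i σ hσ => ?_⟩
  · have h1 : Measurable fun q : ℕ × p.carrier => (f fun _ => q.1).1 (σ q.2) :=
      measurable_from_prod_countable_right fun j => (f fun _ => j).2.1 p hp σ hσ
    exact h1.comp ((measurable_smallIndex hUo hUm hσ.measurable).prodMk measurable_id)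
  · rw [localRestriction_apply hUo hUm _ hσ]
    have hU := isInside_smallIndex (hσ.mono (iInter_subset _ 0))
    have hσ' : IsInside (cap U (Fin.cons (smallIndex U σ) i : Fin 2 → ℕ)) σ := by
      rw [cap_cons]
      exact fun x => ⟨hU x, hσ x⟩
    have h := localCechCoboundary_apply hUo hUm f hσ'
    rw [hf, Fin.sum_univ_two, localCochain_congr f (cons_comp_succAbove_zero _ i),
      localCochain_congr f (i := (Fin.cons (smallIndex U σ) i : Fin 2 → ℕ) ∘ (1 : Fin 2).succAbove)
        (i' := fun _ => smallIndex U σ) (funext fun k => by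
        obtain rfl : k = 0 := Subsingleton.elim (α := Fin 1) k 0
        rfl)] at h
    simp only [Fin.val_zero, pow_zero, one_smul, Fin.val_one, pow_one, neg_smul] at h
    exact (eq_of_sub_eq_zero ((sub_eq_add_neg _ _).trans h.symm)).symm

end Rows

section Columns

/-- Evaluation on cones is a contraction: one face of the cone of `σ` is `σ`, and the others are the
cones of its faces. -/
lemma column_exact (hcontr : ∀ (s : ℕ) (i : Fin (s + 1) → ℕ), IsMeasurablyContractible (cap U i))
    {s n : ℕ} (f : LocalCochains 𝒞 Γ U s (n + 1))
    (hf : localCoboundary 𝒞 Γ hUo hUm s (n + 1) f = 0) :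
    ∃ g, localCoboundary 𝒞 Γ hUo hUm s n g = f := by
  choose r K hr hK1 hK2 hK3 hK4 hK5 using fun i => (hcontr s i).exists_cone
    (isOpen_cap hUo i) (measurableSet_cap hUm i)
  refine ⟨fun i => ⟨truncate (cap U i) n fun σ => (f i).1 (K i n σ),
    truncate_mem (isOpen_cap hUo i) (measurableSet_cap hUm i) fun p hp σ hσ =>
      (f i).2.1 p hp _ (hK5 i p n σ hσ)⟩, LocalCochains.ext fun i σ hσ => ?_⟩
  have h := localCoboundary_apply hUo hUm f (hK1 i _ _ hσ)
  rw [hf, simplexCoboundary_apply, Fin.sum_univ_succ, hK2 i _ _ hσ] at h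
  simp only [Fin.val_zero, pow_zero, one_smul, Fin.val_succ, pow_succ, mul_neg, mul_one, neg_smul,
    Finset.sum_neg_distrib, hK3 i _ _ hσ] at h
  rw [localCoboundary_apply hUo hUm _ hσ, simplexCoboundary_apply]
  simp only [truncate_of_isInside (hσ.comp _)]
  exact (eq_of_sub_eq_zero ((sub_eq_add_neg _ _).trans h.symm)).symm

/-- The cocycle condition on the cone of a point `x` equates the values at `x` and at `r x`, and `r`
is constant on leaves. Measurability along probes is turned into measurability on the intersection
by `hdet`. -/
lemma column_exact_zero
    (hcontr : ∀ (s : ℕ) (i : Fin (s + 1) → ℕ), IsMeasurablyContractible (cap U i))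
    (hdet : ∀ (s : ℕ) (i : Fin (s + 1) → ℕ), DetectsMeasurability 𝒞 Γ (cap U i))
    {s : ℕ} (f : LocalCochains 𝒞 Γ U s 0) (hf : localCoboundary 𝒞 Γ hUo hUm s 0 f = 0) :
    ∃ g, cechInclusion 𝒞 Γ hUm s g = f := by
  choose r K hr hK1 hK2 hK3 hK4 hK5 using fun i => (hcontr s i).exists_cone
    (isOpen_cap hUo i) (measurableSet_cap hUm i)
  have hfr : ∀ i (x : cap U i), (f i).1 (ContinuousMap.const _ (x : X)) =
      (f i).1 (ContinuousMap.const _ (r i x : X)) := by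
    intro i x
    have hx : IsInside (cap U i) (ContinuousMap.const (Simplex 0) (x : X)) := fun _ => x.2
    have h := localCoboundary_apply hUo hUm f (hK1 i _ _ hx)
    rw [hf, simplexCoboundary_apply, Fin.sum_univ_two, hK2 i _ _ hx, hK4 i _ hx] at h
    simp only [Fin.val_zero, pow_zero, one_smul, Fin.val_one, pow_one, neg_smul] at h
    exact eq_of_sub_eq_zero ((sub_eq_add_neg _ _).trans h.symm)
  have hconst : ∀ i (x y : cap U i), y ∈ leaf x → (f i).1 (ContinuousMap.const _ (y : X)) =
      (f i).1 (ContinuousMap.const _ (x : X)) := fun i x y hxy => by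
    rw [hfr, (hr i).2.1 x y hxy, ← hfr]
  refine ⟨fun i => ⟨fun x => (f i).1 (ContinuousMap.const _ (x : X)),
    hdet s i _ (f i).2.1 (hconst i), hconst i⟩, LocalCochains.ext fun i σ hσ => ?_⟩
  rw [cechInclusion_apply hUm _ hσ]
  exact congrArg (f i).1 (eq_const σ).symm

end Columns

/-- The local cochains resolve the global cochains and the Čech cochains. -/
theorem isBiresolution (hUc : ⋃ n, U n = univ)
    (hcontr : ∀ (s : ℕ) (i : Fin (s + 1) → ℕ), IsMeasurablyContractible (cap U i))
    (hdet : ∀ (s : ℕ) (i : Fin (s + 1) → ℕ), DetectsMeasurability 𝒞 Γ (cap U i)) :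
    IsBiresolution (probeCoboundary 𝒞 Γ) (cechCoboundary Γ U)
      (localCoboundary 𝒞 Γ hUo hUm) (localCechCoboundary 𝒞 Γ hUo hUm)
      (localRestriction 𝒞 Γ hUo hUm) (cechInclusion 𝒞 Γ hUm) where
  dB_dB n b := Subtype.ext (simplexCoboundary_comp n b.1)
  d_d s n a := LocalCochains.ext fun i σ hσ => by
    rw [localCoboundary_apply hUo hUm _ hσ]
    change simplexCoboundary X Γ (n + 1) (truncate _ _ (simplexCoboundary X Γ n (a i).1)) σ = 0
    rw [← truncate_of_isInside hσ (simplexCoboundary X Γ (n + 1) _),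
      truncate_simplexCoboundary_truncate subset_rfl, simplexCoboundary_comp, map_zero]
    rfl
  δ_δ s n a := LocalCochains.ext fun i σ hσ => by
    rw [localCechCoboundary_apply hUo hUm _ hσ]
    simp only [localCechCoboundary_apply hUo hUm _ (hσ.mono (cap_subset i _))]
    refine alternating_sum_eq_zero (fun (j : Fin (s + 3)) (k : Fin (s + 2)) =>
      (a ((i ∘ j.succAbove) ∘ k.succAbove)).1 σ) fun x y h => ?_
    exact localCochain_congr a (by rw [comp_assoc, comp_assoc, succAbove_comp_succAbove h]) σ
  d_δ s n a := LocalCochains.ext fun i σ hσ => by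
    rw [localCoboundary_apply hUo hUm _ hσ, localCechCoboundary_apply hUo hUm _ hσ,
      simplexCoboundary_apply]
    simp only [localCechCoboundary_apply hUo hUm _ (hσ.comp _), simplexCoboundary_apply,
      localCoboundary_apply hUo hUm _ (hσ.mono (cap_subset i _)), Finset.smul_sum]
    rw [Finset.sum_comm]
    exact Finset.sum_congr rfl fun _ _ => Finset.sum_congr rfl fun _ _ => smul_comm _ _ _
  δ_ε n b := LocalCochains.ext fun i σ hσ => by
    rw [localCechCoboundary_apply hUo hUm _ hσ, Fin.sum_univ_two,
      localRestriction_apply hUo hUm _ (hσ.mono (cap_subset i _)),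
      localRestriction_apply hUo hUm _ (hσ.mono (cap_subset i _))]
    simp
  d_ε n b := LocalCochains.ext fun i σ hσ => by
    rw [localCoboundary_apply hUo hUm _ hσ, localRestriction_apply hUo hUm _ hσ,
      simplexCoboundary_apply]
    simp only [localRestriction_apply hUo hUm _ (hσ.comp _)]
    rfl
  d_ι s f := LocalCochains.ext fun i σ hσ => by
    have key : ∀ y y' : Simplex 1, (f i).1 ⟨σ y', hσ y'⟩ = (f i).1 ⟨σ y, hσ y⟩ := fun y y' =>
      (f i).2.2 _ _ ((isPreconnected_range (f := fun y => (⟨σ y, hσ y⟩ : cap U i))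
        (σ.continuous.subtype_mk _)).subset_connectedComponent ⟨y, rfl⟩ ⟨y', rfl⟩)
    rw [localCoboundary_apply hUo hUm _ hσ, simplexCoboundary_apply, Fin.sum_univ_two,
      cechInclusion_apply hUm _ (hσ.comp _), cechInclusion_apply hUm _ (hσ.comp _)]
    simp only [Fin.val_zero, pow_zero, one_smul, Fin.val_one, pow_one, neg_smul]
    exact add_neg_eq_zero.2 (key _ _)
  δ_ι s f := LocalCochains.ext fun i σ hσ => by
    rw [localCechCoboundary_apply hUo hUm _ hσ, cechInclusion_apply hUm _ hσ]
    simp only [cechInclusion_apply hUm _ (hσ.mono (cap_subset i _))]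
    simp [cechCoboundary, LeafwiseConstant.restrict]
  ι_injective s f hf := by
    funext i
    apply Subtype.ext
    funext x
    have hx : IsInside (cap U i) (ContinuousMap.const (Simplex 0) (x : X)) := fun _ => x.2
    have := cechInclusion_apply (𝒞 := 𝒞) hUm f hx
    rw [hf] at this
    exact this.symm
  row_exact s n a := row_exact hUo hUm a
  row_exact_zero n a := row_exact_zero hUo hUm a
  column_exact s n a := column_exact hUo hUm hcontr a
  column_exact_zero s a := column_exact_zero hUo hUm hcontr hdet a
  kernel_acyclic n b hb hdb := by
    have hs : VanishesOnSmall U b.1 := fun j σ hσ => by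
      have h : IsInside (cap U fun _ : Fin 1 => j) σ := fun x => mem_iInter.2 fun _ => hσ x
      have := localRestriction_apply hUo hUm b h
      rw [hb] at this
      exact this.symm
    obtain ⟨η, hη, hηs, hd⟩ := exists_simplexCoboundary_eq hUo hUc b.2 hs
      (congrArg Subtype.val hdb)
    refine ⟨⟨η, hη⟩, LocalCochains.ext fun i σ hσ => ?_, Subtype.ext hd⟩
    rw [localRestriction_apply hUo hUm _ hσ]
    exact hηs (i 0) σ (hσ.mono (iInter_subset _ 0))
  kernel_zero b hb := by
    apply Subtype.ext
    funext σ
    obtain ⟨j, hj⟩ := mem_iUnion.1 (hUc ▸ mem_univ (σ (vertices 0 0)))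
    have h : IsInside (cap U fun _ : Fin 1 => j) σ :=
      isInside_zero_iff.2 (mem_iInter.2 fun _ => hj)
    have := localRestriction_apply hUo hUm b h
    rw [hb] at this
    exact this.symm

end Resolution

end MTSpace

namespace MTSpace

open Function Set

/-! ### Measurability of leafwise constant maps detected on a transversal. -/

section Detection

variable {X : Type u} [TopologicalSpace X] [MeasurableSpace X]

/-- A measurable lamination is locally connected. -/
lemma IsMeasurableLamination.exists_isPreconnected (hX : IsMeasurableLamination X) {x : X}
    {O : Set X} (hO : IsOpen O) (hx : x ∈ O) :
    ∃ C, IsOpen C ∧ _root_.IsPreconnected C ∧ x ∈ C ∧ C ⊆ O := by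
  obtain ⟨U, hU, hc⟩ := hX
  obtain ⟨n, hn⟩ := mem_iUnion.1 (hc ▸ mem_univ x)
  obtain ⟨hUo, -, P, T, _, _, _, _, _, _, _, _, _, _, _, φ, hφ, hφ'⟩ := hU n
  let q : P → X := fun p => φ.symm (p, (φ ⟨x, hn⟩).2)
  have hq : Continuous q :=
    continuous_subtype_val.comp (hφ'.continuous.comp (Continuous.prodMk_left _))
  have hqx : q (φ ⟨x, hn⟩).1 = x := by simp [q]
  obtain ⟨C, ⟨hCo, hCc⟩, hxC, hCO⟩ :=
    TopologicalSpace.IsTopologicalBasis.isOpen_isPreconnected.exists_subset_of_mem_open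
      (show (φ ⟨x, hn⟩).1 ∈ q ⁻¹' O by rwa [mem_preimage, hqx]) (hO.preimage hq)
  refine ⟨q '' C, ?_, hCc.image q hq.continuousOn, ⟨_, hxC, hqx⟩, image_subset_iff.2 hCO⟩
  have : q '' C = Subtype.val '' (φ ⁻¹' (C ×ˢ {(φ ⟨x, hn⟩).2})) := by
    ext y
    constructor
    · rintro ⟨p, hp, rfl⟩
      exact ⟨φ.symm (p, _), by simpa using hp, rfl⟩
    · rintro ⟨y, ⟨hy1, hy2⟩, rfl⟩
      refine ⟨(φ y).1, hy1, ?_⟩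
      have : (φ y).2 = (φ ⟨x, hn⟩).2 := hy2
      simp [q, ← this]
  rw [this]
  exact hUo.isOpenMap_subtype_val _ ((hCo.prod (isOpen_discrete _)).preimage hφ.continuous)

/-- The σ-algebra of a measurable lamination need not be the Borel one, but continuous maps from
Borel spaces are measurable. -/
lemma IsMeasurableLamination.measurable_of_continuous (hX : IsMeasurableLamination X)
    {Y : Type*} [TopologicalSpace Y] [MeasurableSpace Y] [BorelSpace Y] {f : Y → X}
    (hf : Continuous f) : Measurable f := by
  obtain ⟨U, hU, hc⟩ := hX
  have key : ∀ n, Measurable fun y : f ⁻¹' U n => f y := by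
    intro n
    obtain ⟨-, -, P, T, _, _, _, _, _, _, _, _, _, _, _, φ, hφ, hφ'⟩ := hU n
    let h : f ⁻¹' U n → P × T := fun y => φ ⟨f y, y.2⟩
    have hh : Continuous h :=
      hφ.continuous.comp ((hf.comp continuous_subtype_val).subtype_mk fun y => y.2)
    have h2 : Measurable fun y => (h y).2 := fun s _ =>
      ((isOpen_discrete s).preimage (continuous_snd.comp hh)).measurableSet
    have h1 : Measurable h := (continuous_fst.comp hh).measurable.prodMk h2
    refine (congrArg Measurable (funext fun y => ?_)).mpr
      (measurable_subtype_coe.comp (hφ'.measurable.comp h1))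
    simp [h]
  intro A hA
  have hfA : f ⁻¹' A = ⋃ n, Subtype.val '' ((fun y : f ⁻¹' U n => f y) ⁻¹' A) := by
    ext y
    simp only [mem_iUnion, mem_image, Subtype.exists, exists_and_right, exists_eq_right]
    exact ⟨fun hy => (iUnion_eq_univ_iff.1 hc (f y)).imp fun n hn => ⟨hn, hy⟩,
      fun ⟨n, _, hy⟩ => hy⟩
  rw [hfA]
  exact MeasurableSet.iUnion fun n =>
    ((hU n).1.preimage hf).measurableSet.subtype_image (key n hA)

variable {Γ : Type v} [AddCommGroup Γ] [MeasurableSpace Γ] [MeasurableAdd₂ Γ] [MeasurableNeg Γ]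

lemma isMeasurableFamily_const {T : Type*} [MeasurableSpace T] {f : T → X} (hf : Measurable f)
    (n : ℕ) : IsMeasurableFamily fun t => ContinuousMap.const (Simplex n) (f t) :=
  hf.comp measurable_snd

lemma detectsMeasurability_univ [StandardBorelSpace X] (V : Set X) :
    DetectsMeasurability (univ : Set (Probe X)) Γ V := fun _ hω _ =>
  (hω ⟨X, id⟩ (mem_univ _) _ ⟨isMeasurableFamily_const measurable_id 0, fun _ _ =>
    mem_connectedComponent⟩).comp measurable_subtype_coe

/-- The probe given by a measurable set. -/
def inclusionProbe [StandardBorelSpace X] (T : Set X) (hT : MeasurableSet T) : Probe X :=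
  { carrier := T
    standardBorelSpace := hT.standardBorel
    base := Subtype.val }

/-- A complete transversal of a lamination detects the measurability of leafwise constant maps. -/
lemma IsMeasurableLamination.detectsMeasurability [StandardBorelSpace X]
    (hX : IsMeasurableLamination X) {T : Set X} (hT : IsCompleteTransversal T) {V : Set X}
    (hVo : IsOpen V) (hVm : MeasurableSet V) (hV : IsMeasurablyContractible V) :
    DetectsMeasurability {inclusionProbe T hT.measurableSet} Γ V := by
  classical
  intro ω hω hconst
  obtain ⟨r, K, ⟨hr, hrc, hrl⟩, -⟩ := hV.exists_cone hVo hVm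
  obtain ⟨g, hg, hgl, hgd⟩ := hX.exists_leaf_maps
  have := hVm.standardBorel
  have := hT.measurableSet.standardBorel
  let f : V → Γ := fun x => ω (ContinuousMap.const _ (x : X))
  -- Move `t` along its leaf by `g k`, then to the representative given by `r`. The default value
  -- `t` stays in the leaf, so each `p (k, ·)` gives an admissible family over all of `T`.
  let p : ℕ × T → X := fun q => if h : g q.1 q.2 ∈ V then r ⟨g q.1 q.2, h⟩ else q.2
  have hG : Measurable fun q : ℕ × T => g q.1 q.2 :=
    measurable_from_prod_countable_right fun k => (hg k).comp measurable_subtype_coe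
  let Z : Set (ℕ × T) := {q | g q.1 q.2 ∈ V}
  have hZ : MeasurableSet Z := hG hVm
  have := hZ.standardBorel
  have hrZ : Measurable fun q : Z => r ⟨g q.1.1 q.1.2, q.2⟩ :=
    hr.comp (hG.comp measurable_subtype_coe).subtype_mk
  have hp : Measurable p := Measurable.dite (s := Z)
    (g := fun q : (Zᶜ : Set (ℕ × T)) => (q.1.2 : X))
    (measurable_subtype_coe.comp hrZ)
    (measurable_subtype_coe.comp (measurable_snd.comp measurable_subtype_coe)) hZ
  have hpl : ∀ q : ℕ × T, p q ∈ leaf (q.2 : X) := by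
    rintro ⟨k, t⟩
    by_cases h : g k t ∈ V
    · simp only [p, dif_pos h]
      have h1 := (continuous_subtype_val (p := (· ∈ V))).image_connectedComponent_subset
        (⟨g k t, h⟩ : V) ⟨_, hrl _, rfl⟩
      have h2 := hgl k t
      unfold leaf at h2 ⊢
      rwa [connectedComponent_eq h2]
    · simp only [p, dif_neg h]
      exact mem_connectedComponent
  have hωp : Measurable fun q : ℕ × T => ω (ContinuousMap.const _ (p q)) :=
    measurable_from_prod_countable_right fun k => hω _ (mem_singleton _)
      (fun t : T => ContinuousMap.const _ (p (k, t)))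
      ⟨isMeasurableFamily_const (hp.comp measurable_prodMk_left) 0, fun t _ => hpl (k, t)⟩
  -- The fixed points of `r` form a measurable set with exactly one point in each leaf of `V`.
  let Y : Set V := {x | r x = x}
  have hY : MeasurableSet Y := measurableSet_eq_fun hr measurable_id
  have := hY.standardBorel
  have hrY : ∀ x, r x ∈ Y := fun x => hrc x (r x) (hrl x)
  let Φ : Z → Y := fun q => ⟨r ⟨g q.1.1 q.1.2, q.2⟩, hrY _⟩
  have hΦ : Measurable Φ := hrZ.subtype_mk
  -- The leaf of `x` meets `T` at some `t`, whose dense orbit enters a connected neighbourhood of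
  -- `x` inside `V`. Connectedness matters because a leaf of `X` may split into several leaves of
  -- `V`; it yields the value `r x = x`.
  have hΦs : Surjective Φ := by
    rintro ⟨x, hx⟩
    obtain ⟨C, hCo, hCc, hxC, hCV⟩ := hX.exists_isPreconnected hVo x.2
    obtain ⟨t, htT, ht⟩ := hT.nonempty (x : X)
    have hxt : (x : X) ∈ leaf t := by
      unfold leaf at ht ⊢
      rw [← connectedComponent_eq ht]
      exact mem_connectedComponent
    obtain ⟨k, hk⟩ := hgd t x hxt C hCo hxC
    refine ⟨⟨(k, ⟨t, htT⟩), hCV hk⟩, Subtype.ext ?_⟩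
    refine (hrc x ⟨g k t, hCV hk⟩ ?_).trans hx
    have hCV' : _root_.IsPreconnected ((↑) ⁻¹' C : Set V) :=
      hCc.preimage_of_isOpenMap Subtype.val_injective hVo.isOpenMap_subtype_val
        (by rwa [Subtype.range_coe])
    exact hCV'.subset_connectedComponent hxC hk
  have hfY : Measurable fun y : Y => f y := by
    -- Measurability descends along a Borel surjection of standard Borel spaces, since the preimage
    -- of a measurable set and its complement are both analytic.
    refine (hΦ.measurable_comp_iff_of_surjective hΦs).1 ?_
    refine (congrArg Measurable (funext fun q => ?_)).mpr (hωp.comp measurable_subtype_coe)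
    have hq : g q.1.1 q.1.2 ∈ V := q.2
    simp only [Function.comp_apply, f, Φ, p, dif_pos hq]
  have hf : f = (fun y : Y => f y) ∘ fun x => ⟨r x, hrY x⟩ :=
    funext fun x => (hconst x (r x) (hrl x)).symm
  change Measurable f
  rw [hf]
  exact hfY.comp hr.subtype_mk

end Detection

/-! ### Singular and elementary cochains as cochains measurable along probes. -/

section Comparison

variable {X : Type u} [TopologicalSpace X] [MeasurableSpace X]
variable {Γ : Type v} [AddCommGroup Γ] [MeasurableSpace Γ] [MeasurableAdd₂ Γ] [MeasurableNeg Γ]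

lemma nonempty_cohomology_addEquiv {C C' : ℕ → Type w} [∀ n, AddCommGroup (C n)]
    [∀ n, AddCommGroup (C' n)] {d : ∀ n, C n →+ C (n + 1)} {d' : ∀ n, C' n →+ C' (n + 1)}
    (e : ∀ n, C n ≃+ C' n) (he : ∀ n x, e (n + 1) (d n x) = d' n (e n x)) (n : ℕ) :
    Nonempty (Cohomology d n ≃+ Cohomology d' n) := by
  have hd : ∀ x, d n x = 0 ↔ d' n (e n x) = 0 := fun x => by
    rw [← he]
    exact ((e (n + 1)).map_eq_zero_iff).symm
  refine nonempty_cohomology_addEquiv_of_relation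
    (((e n : C n →+ C' n).coprod (-AddMonoidHom.id (C' n))).ker) ?_ ?_ ?_
  · exact fun x hx => ⟨e n x, (hd x).1 hx, by simp [AddMonoidHom.mem_ker]⟩
  · exact fun y hy => ⟨(e n).symm y, (hd _).2 (by simpa using hy), by
      simp [AddMonoidHom.mem_ker]⟩
  · intro x y _ _ h
    obtain rfl : e n x = y := by simpa [AddMonoidHom.mem_ker, add_neg_eq_zero] using h
    rcases n with _ | n
    · simp [coboundaries]
    · constructor
      · rintro ⟨z, rfl⟩
        exact ⟨e n z, (he n z).symm⟩
      · rintro ⟨z, hz⟩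
        refine ⟨(e n).symm z, (e (n + 1)).injective ?_⟩
        rw [he, AddEquiv.apply_symm_apply, hz]

/-- Simplices are connected, so every measurable family is admissible for the probe whose base map
picks the vertex `0`. -/
lemma measurableCochain_eq_probeCochain (n : ℕ) :
    MeasurableCochain X Γ n = ProbeCochain (univ : Set (Probe X)) Γ n := by
  ext ω
  constructor
  · intro hω p _ σ hσ
    exact hω p.carrier σ hσ.measurable
  · intro hω T _ _ σ hσ
    exact hω ⟨T, fun t => σ t (vertices n 0)⟩ (mem_univ _) σ ⟨hσ, fun t x =>
      (isPreconnected_range (σ t).continuous).subset_connectedComponent ⟨_, rfl⟩ ⟨x, rfl⟩⟩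

variable [StandardBorelSpace X] {T : Set X}

/-- The elementary simplex defined over a single point. -/
def ElementarySimplex.single {n : ℕ} (σ : SingularSimplex X n) (hσ : Measurable σ) (t : T)
    (h : ∀ x, σ x ∈ leaf (t : X)) : ElementarySimplex T n where
  dom := {(t : X)}
  dom_subset := singleton_subset_iff.2 t.2
  measurableSet_dom := measurableSet_singleton _
  toFun _ := σ
  measurable := hσ.comp measurable_fst
  mem_leaf s x := by
    rw [show (s : X) = t from s.2]
    exact h x

omit [StandardBorelSpace X] in
lemma ElementarySimplex.measurable_toFun {n : ℕ} (τ : ElementarySimplex T n) (t : τ.dom) :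
    Measurable (τ.toFun t) :=
  Measurable.comp (g := fun p : Simplex n × τ.dom => τ.toFun p.2 p.1) τ.measurable
    measurable_prodMk_right

lemma ElementarySimplex.restrict_singleton {n : ℕ} (τ : ElementarySimplex T n) (t : T)
    (ht : (t : X) ∈ τ.dom) : τ.restrict {(t : X)} (measurableSet_singleton _)
      (singleton_subset_iff.2 ht) = single (τ.toFun ⟨t, ht⟩)
        (τ.measurable_toFun ⟨t, ht⟩) t (τ.mem_leaf ⟨t, ht⟩) := by
  unfold ElementarySimplex.restrict ElementarySimplex.single
  congr 1
  funext s
  obtain ⟨s, rfl⟩ := s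
  rfl

lemma ElementaryCochain.apply_eq_single {n : ℕ} (ω : ElementaryCochain T Γ n)
    (τ : ElementarySimplex T n) (t : T) (ht : (t : X) ∈ τ.dom) :
    ω.1 (.single (τ.toFun ⟨t, ht⟩) (τ.measurable_toFun ⟨t, ht⟩) t
      (τ.mem_leaf ⟨t, ht⟩)) t = ω.1 τ t := by
  rw [← ElementarySimplex.restrict_singleton, ω.2.2.2.1]
  exact indicator_of_mem (s := (Subtype.val ⁻¹' {(t : X)} : Set T)) rfl _

/-- The value of an elementary cochain at a simplex over a point only depends on the simplex. -/
lemma ElementaryCochain.single_eq_single {n : ℕ} (ω : ElementaryCochain T Γ n)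
    (σ : SingularSimplex X n) (hσ : Measurable σ) (t t' : T) (h : ∀ x, σ x ∈ leaf (t : X))
    (h' : ∀ x, σ x ∈ leaf (t' : X)) : ω.1 (.single σ hσ t h) t = ω.1 (.single σ hσ t' h') t' := by
  -- The map between two single points of one leaf is a holonomy, and pulling back along it changes
  -- the base point from `t'` to `t`.
  let e : Holonomy T :=
    { source := {(t : X)}
      target := {(t' : X)}
      source_subset := singleton_subset_iff.2 t.2
      target_subset := singleton_subset_iff.2 t'.2
      measurableSet_source := measurableSet_singleton _
      measurableSet_target := measurableSet_singleton _
      map := MeasurableEquiv.ofUniqueOfUnique _ _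
      map_mem_leaf := by
        rintro ⟨a, rfl⟩
        have h1 := h (vertices n 0)
        have h2 := h' (vertices n 0)
        unfold leaf at h1 h2 ⊢
        rw [connectedComponent_eq h1, ← connectedComponent_eq h2]
        exact mem_connectedComponent }
  let a : e.source := ⟨t, rfl⟩
  have ha : (e.map a : X) = t' := (e.map a).2
  have hdom : (t : X) ∈ ((ElementarySimplex.single σ hσ t' h').pullback e).dom := ⟨a, ha, rfl⟩
  have h1 := apply_eq_single ω _ t hdom
  have h2 := ω.2.2.2.2 (.single σ hσ t' h') e a
  refine h1.trans (h2.trans ?_)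
  congr 1

variable (hT : IsCompleteTransversal T)

open scoped Classical in
/-- The elementary cochain given by a cochain that is measurable along the transversal. -/
noncomputable def elementaryOfProbe (n : ℕ) :
    ProbeCochain {inclusionProbe T hT.measurableSet} Γ n →+ ElementaryCochain T Γ n where
  toFun ω := ⟨fun σ t => if h : (t : X) ∈ σ.dom then ω.1 (σ.toFun ⟨t, h⟩) else 0, by
    refine ⟨fun σ => ?_, fun σ t ht => dif_neg ht, fun σ S hS h => ?_, fun σ h a => ?_⟩
    · let D : Set T := {t | (t : X) ∈ σ.dom}
      have hD : MeasurableSet D := measurable_subtype_coe σ.measurableSet_dom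
      -- The probe is all of `T`, so the family is extended beyond its domain by constant simplices.
      let τ : T → SingularSimplex X n := fun t =>
        if h : (t : X) ∈ σ.dom then σ.toFun ⟨t, h⟩ else ContinuousMap.const _ (t : X)
      have hτ : (inclusionProbe T hT.measurableSet).IsAdmissible τ := by
        refine ⟨?_, fun (t : T) x => ?_⟩
        · change Measurable fun q : Simplex n × T => τ q.2 q.1
          let s : Set (Simplex n × T) := {q | (q.2 : X) ∈ σ.dom}
          have hs : MeasurableSet s := measurable_snd hD
          have h1 : Measurable fun q : s => σ.toFun ⟨q.1.2, q.2⟩ q.1.1 :=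
            Measurable.comp (g := fun p : Simplex n × σ.dom => σ.toFun p.2 p.1) σ.measurable
              ((measurable_fst.comp measurable_subtype_coe).prodMk (measurable_subtype_coe.comp
                (measurable_snd.comp measurable_subtype_coe)).subtype_mk)
          have h2 : Measurable fun q : (sᶜ : Set (Simplex n × T)) => (q.1.2 : X) :=
            measurable_subtype_coe.comp (measurable_snd.comp measurable_subtype_coe)
          refine (congrArg Measurable (funext fun q => ?_)).mpr (Measurable.dite h1 h2 hs)
          by_cases h : (q.2 : X) ∈ σ.dom
          · have h' : q ∈ s := h
            rw [dif_pos h']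
            simp only [τ, dif_pos h]
          · have h' : q ∉ s := h
            rw [dif_neg h']
            simp only [τ, dif_neg h]
            rfl
        · change τ t x ∈ leaf (t : X)
          by_cases h : (t : X) ∈ σ.dom
          · simp only [τ, dif_pos h]
            exact σ.mem_leaf ⟨t, h⟩ x
          · simp only [τ, dif_neg h]
            exact mem_connectedComponent
      have h3 : Measurable fun t : T => if t ∈ D then ω.1 (τ t) else 0 :=
        Measurable.ite hD (ω.2 _ (mem_singleton _) τ hτ) measurable_const
      refine (congrArg Measurable (funext fun t => ?_)).mpr h3
      by_cases h : (t : X) ∈ σ.dom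
      · have h' : t ∈ D := h
        simp only [dif_pos h, if_pos h', τ]
      · have h' : t ∉ D := h
        simp only [dif_neg h, if_neg h']
    · funext t
      by_cases ht : (t : X) ∈ S
      · rw [indicator_of_mem (s := (Subtype.val ⁻¹' S : Set T)) ht]
        dsimp only
        rw [dif_pos (h ht)]
        exact dif_pos ht
      · rw [indicator_of_notMem (s := (Subtype.val ⁻¹' S : Set T)) ht]
        exact dif_neg ht
    · by_cases ha : (h.map a : X) ∈ σ.dom
      · dsimp only
        rw [dif_pos ha]
        exact dif_pos (⟨a, ha, rfl⟩ : (a : X) ∈ (σ.pullback h).dom)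
      · dsimp only
        rw [dif_neg ha]
        refine dif_neg fun h' => ?_
        obtain ⟨a', ha', h'⟩ := h'
        obtain rfl := Subtype.ext h'
        exact ha ha'⟩
  map_zero' := by
    apply Subtype.ext; funext σ t
    by_cases h : (t : X) ∈ σ.dom <;> simp [h]
  map_add' ω ω' := by
    apply Subtype.ext; funext σ t
    by_cases h : (t : X) ∈ σ.dom <;> simp [h]

lemma elementaryOfProbe_apply {n : ℕ} (ω : ProbeCochain {inclusionProbe T hT.measurableSet} Γ n)
    {σ : ElementarySimplex T n} {t : T} (h : (t : X) ∈ σ.dom) :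
    (elementaryOfProbe hT n ω).1 σ t = ω.1 (σ.toFun ⟨t, h⟩) := dif_pos h

include hT in
omit [StandardBorelSpace X] in
lemma exists_base {n : ℕ} (σ : SingularSimplex X n) : ∃ t : T, ∀ x, σ x ∈ leaf (t : X) := by
  obtain ⟨t, htT, ht⟩ := hT.nonempty (σ (vertices n 0))
  refine ⟨⟨t, htT⟩, fun x => ?_⟩
  unfold leaf at ht ⊢
  rw [← connectedComponent_eq ht]
  exact (isPreconnected_range σ.continuous).subset_connectedComponent ⟨_, rfl⟩ ⟨x, rfl⟩

/-- An elementary cochain is determined by its values over single points, and these depend only on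
the singular simplex. Every singular simplex occurs there, since `T` meets its leaf and continuous
maps from simplices are measurable. -/
lemma elementaryOfProbe_bijective (hX : IsMeasurableLamination X) (n : ℕ) :
    Bijective (elementaryOfProbe (Γ := Γ) hT n) := by
  constructor
  · rw [injective_iff_map_eq_zero]
    intro ω hω
    apply Subtype.ext
    funext σ
    obtain ⟨t, ht⟩ := exists_base hT σ
    have := elementaryOfProbe_apply hT ω
      (σ := .single σ (hX.measurable_of_continuous σ.continuous) t ht) (t := t) rfl
    rw [hω] at this
    exact this.symm
  · intro ω'
    choose b hb using exists_base (X := X) hT (n := n)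
    refine ⟨⟨fun σ => ω'.1 (.single σ (hX.measurable_of_continuous σ.continuous)
      (b σ) (hb σ)) (b σ), ?_⟩, Subtype.ext (funext fun σ =>
      funext fun t => ?_)⟩
    · rintro _ rfl σ hσ
      let τ : ElementarySimplex T n :=
        { dom := T
          dom_subset := subset_rfl
          measurableSet_dom := hT.measurableSet
          toFun := σ
          measurable := hσ.measurable
          mem_leaf := hσ.mem_leaf }
      refine (congrArg Measurable (funext fun t : T => ?_)).mpr (ω'.2.1 τ)
      rw [← ElementaryCochain.apply_eq_single ω' τ t t.2]
      exact ElementaryCochain.single_eq_single ω' _ _ _ _ _ _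
    · by_cases h : (t : X) ∈ σ.dom
      · rw [elementaryOfProbe_apply hT _ h, ← ElementaryCochain.apply_eq_single ω' σ t h]
        exact ElementaryCochain.single_eq_single ω' _ _ _ _ _ _
      · rw [ω'.2.2.1 σ t h, (elementaryOfProbe hT n _).2.2.1 σ t h]

lemma elementaryOfProbe_coboundary (n : ℕ)
    (ω : ProbeCochain {inclusionProbe T hT.measurableSet} Γ n) :
    elementaryOfProbe hT (n + 1) (probeCoboundary _ Γ n ω) =
      elementaryCoboundary T Γ n (elementaryOfProbe hT n ω) := by
  apply Subtype.ext
  funext σ t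
  by_cases h : (t : X) ∈ σ.dom
  · rw [elementaryOfProbe_apply hT _ h]
    change (∑ i : Fin (n + 2), (-1 : ℤ) ^ (i : ℕ) •
      ω.1 ((σ.toFun ⟨t, h⟩).comp (simplexMap i.succAbove))) =
      (∑ i : Fin (n + 2), (-1 : ℤ) ^ (i : ℕ) •
        (elementaryOfProbe hT n ω).1 (σ.reindex i.succAbove)) t
    rw [Finset.sum_apply]
    refine Finset.sum_congr rfl fun i _ => ?_
    rw [Pi.smul_apply, elementaryOfProbe_apply hT ω (σ := σ.reindex i.succAbove) h]
    rfl
  · rw [(elementaryOfProbe hT (n + 1) _).2.2.1 σ t h, (elementaryCoboundary T Γ n _).2.2.1 σ t h]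

end Comparison

end MTSpace

theorem mainTheorem5 {X : Type u} [TopologicalSpace X] [MeasurableSpace X]
    (hX : MTSpace.IsMeasurableLamination X)
    {Γ : Type v} [AddCommGroup Γ] [MeasurableSpace Γ] [StandardBorelSpace Γ]
    [MeasurableAdd₂ Γ] [MeasurableNeg Γ]
    (U : ℕ → Set X) (hUo : ∀ n, IsOpen (U n)) (hUm : ∀ n, MeasurableSet (U n))
    (hUc : ⋃ n, U n = Set.univ)
    (hcontr : ∀ (s : ℕ) (i : Fin (s + 1) → ℕ), MTSpace.IsMeasurablyContractible (⋂ k, U (i k)))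
    (T : Set X) (hT : MTSpace.IsCompleteTransversal T) (n : ℕ) :
    Nonempty (MTSpace.singularCohomology X Γ n ≅ MTSpace.elementaryCohomology T Γ n) ∧
    Nonempty (MTSpace.singularCohomology X Γ n ≅ MTSpace.cechCohomology Γ U n) ∧
    Nonempty (MTSpace.elementaryCohomology T Γ n ≅ MTSpace.cechCohomology Γ U n) := by
  have := hX.standardBorelSpace
  obtain ⟨eS⟩ := MTSpace.nonempty_homology_iso_cohomology (MTSpace.singularCoboundary X Γ)
    (fun n => by ext ω : 2; exact MTSpace.singularCoboundary_comp X Γ n ω) n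
  obtain ⟨eE⟩ := MTSpace.nonempty_homology_iso_cohomology (MTSpace.elementaryCoboundary T Γ)
    (fun n => by ext ω : 2; exact MTSpace.elementaryCoboundary_comp T Γ n ω) n
  obtain ⟨eC⟩ := MTSpace.nonempty_homology_iso_cohomology (MTSpace.cechCoboundary Γ U)
    (fun n => by ext ω : 2; exact MTSpace.cechCoboundary_comp Γ U n ω) n
  -- The two instances of the biresolution, for all probes here and for the transversal alone in
  -- `e2`, share the same Čech complex.
  obtain ⟨e1⟩ := (MTSpace.isBiresolution (𝒞 := Set.univ) (Γ := Γ) hUo hUm hUc hcontr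
    fun s i => MTSpace.detectsMeasurability_univ _).cohomology n
  obtain ⟨e2⟩ := (MTSpace.isBiresolution (Γ := Γ) hUo hUm hUc hcontr
    fun s i => hX.detectsMeasurability hT (MTSpace.isOpen_cap hUo i)
      (MTSpace.measurableSet_cap hUm i) (hcontr s i)).cohomology n
  obtain ⟨e3⟩ := MTSpace.nonempty_cohomology_addEquiv (d := MTSpace.singularCoboundary X Γ)
    (d' := MTSpace.probeCoboundary Set.univ Γ)
    (fun n => AddEquiv.addSubgroupCongr (MTSpace.measurableCochain_eq_probeCochain n))
    (fun n ω => rfl) n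
  obtain ⟨e4⟩ := MTSpace.nonempty_cohomology_addEquiv
    (fun n => AddEquiv.ofBijective _ (MTSpace.elementaryOfProbe_bijective (Γ := Γ) hT hX n))
    (MTSpace.elementaryOfProbe_coboundary hT) n
  let iS : MTSpace.singularCohomology X Γ n ≅ MTSpace.cechCohomology Γ U n :=
    eS ≪≫ (e3.trans e1).toAddCommGrpIso ≪≫ eC.symm
  let iE : MTSpace.elementaryCohomology T Γ n ≅ MTSpace.cechCohomology Γ U n :=
    eE ≪≫ (e4.symm.trans e2).toAddCommGrpIso ≪≫ eC.symm
  exact ⟨⟨iS ≪≫ iE.symm⟩, ⟨iS⟩, ⟨iE⟩⟩
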